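/- Theorem. There is an algorithm that, given a simple graph $H$ with $k\ge 1$ edges and a simple graph $G$ with $n\ge 1$ vertices, computes the number $\#\mathrm{Sub}(H,G)$ of subgraphs of $G$ that are isomorphic to $H$ in time $k^{O(k)}\cdot n^{t+1}$, where $t$ is the maximum treewidth of a graph in the spasm of $H$. In detail: there are a single program and a constant $c$ such that the running time is at most $c\cdot k^{ck}\cdot n^{t+1}$ on all such inputs $(H,G)$. Here the spasm of $H$ is the set of all simple graphs $F$ (up to isomorphism) that admit a surjective homomorphism from $H$, i.e. a homomorphism that hits all vertices and all edges of $F$; equivalently, all loop-free graphs obtained from $H$ by merging vertices within independent sets. The treewidth of a graph is the minimum, over its tree decompositions, of the maximum bag size minus one. The algorithm runs on a deterministic random-access machine with words of $\lceil\log_2(|V(H)|+n+1)\rceil$ bits. The graphs are given by their numbers of vertices and their adjacency matrices. An integer that does not fit into one word (also when it is used as an address) occupies several words: reading or writing it is charged its number of words, and an arithmetic operation on a $p$-word and a $q$-word integer is charged $p\cdot q$ word operations. -/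

import Mathlib

/-! ### Treewidth, homomorphic images, spasm -/

/-- `(T, β)` is a tree decomposition of `G`: `T` is a tree, every vertex of `G` lies in the bags of
a nonempty connected set of nodes, and every edge of `G` is contained in some bag. -/
structure IsTreeDecomposition {V ι : Type} (G : SimpleGraph V) (T : SimpleGraph ι)
    (β : ι → Finset V) : Prop where
  isTree : T.IsTree
  connected : ∀ v : V, (T.induce {t | v ∈ β t}).Connected
  edge_mem : ∀ u v : V, G.Adj u v → ∃ t, u ∈ β t ∧ v ∈ β t

/-- `G` has a tree decomposition (over a finite tree) of width at most `w`, that is, one whose bags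
have at most `w + 1` elements. -/
def HasTreewidthLE {V : Type} (G : SimpleGraph V) (w : ℕ) : Prop :=
  ∃ (m : ℕ) (T : SimpleGraph (Fin m)) (β : Fin m → Finset V),
    IsTreeDecomposition G T β ∧ ∀ t, (β t).card ≤ w + 1

/-- The treewidth of a graph: the minimum width of a tree decomposition. (For the graph without
vertices the value is `0`.) -/
noncomputable def treewidth {V : Type} (G : SimpleGraph V) : ℕ :=
  sInf {w | HasTreewidthLE G w}

/-- A homomorphism is surjective if it hits all vertices and all edges of its target. -/
def IsSurjectiveHom {V W : Type} {H : SimpleGraph V} {F : SimpleGraph W} (f : H →g F) : Prop :=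
  Function.Surjective f ∧ ∀ x y, F.Adj x y → ∃ u v, H.Adj u v ∧ f u = x ∧ f v = y

/-- The spasm of `H`: all simple graphs (with vertex set `{0, …, m-1}` for some `m`) onto which
`H` has a surjective homomorphism. Each isomorphism class of homomorphic images of `H` occurs,
possibly through several labeled representatives. -/
def spasm {V : Type} (H : SimpleGraph V) : Set (Σ m : ℕ, SimpleGraph (Fin m)) :=
  {F | ∃ f : H →g F.2, IsSurjectiveHom f}

/-- The maximum treewidth of the graphs in the spasm of `H`. -/
noncomputable def maxSpasmTreewidth {V : Type} (H : SimpleGraph V) : ℕ :=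
  sSup ((fun F => treewidth F.2) '' spasm H)

theorem treewidth_le_card {m : ℕ} (G : SimpleGraph (Fin m)) : treewidth G ≤ m := by
  refine Nat.sInf_le ⟨1, ⊥, fun _ => Finset.univ, ⟨.of_subsingleton, fun v => ?_, ?_⟩, ?_⟩
  · have : Nonempty {t : Fin 1 | v ∈ (Finset.univ : Finset (Fin m))} := ⟨⟨0, by simp⟩⟩
    exact SimpleGraph.Connected.of_subsingleton
  · intro u v _
    exact ⟨0, by simp, by simp⟩
  · intro _
    simp

/-- `maxSpasmTreewidth H` is a genuine maximum. -/
theorem isGreatest_maxSpasmTreewidth {h : ℕ} (H : SimpleGraph (Fin h)) :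
    IsGreatest ((fun F => treewidth F.2) '' spasm H) (maxSpasmTreewidth H) := by
  have hb : BddAbove ((fun F => treewidth F.2) '' spasm H) := by
    refine ⟨h, ?_⟩
    rintro _ ⟨⟨m, F⟩, ⟨f, hf, -⟩, rfl⟩
    have := Fintype.card_le_of_surjective _ hf
    simp only [Fintype.card_fin] at this
    exact (treewidth_le_card F).trans this
  have hne : ((fun F => treewidth F.2) '' spasm H).Nonempty :=
    ⟨_, ⟨h, H⟩, ⟨SimpleGraph.Hom.id, fun x => ⟨x, rfl⟩, fun x y hxy => ⟨x, y, hxy, rfl, rfl⟩⟩, rfl⟩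
  exact ⟨Nat.sSup_mem hne hb, fun _ hx => le_csSup hb hx⟩

/-! ### Random-access machine with words of fixed length

A program works on registers and on finitely many random-access arrays; all cells hold natural
numbers, and a number that does not fit in one word is stored in several words. The running time is
the number of word operations: constants, registers and array cells are charged by the number of
words of their address and of their content, and an arithmetic operation on numbers of `p` and `q`
words is charged `p * q` (schoolbook multiplication and division). -/

namespace WordRAM

/-- The arithmetic operations (`sub` is truncated, `lt` and `eq` return `1` or `0`). -/
inductive Op
  | add | sub | mul | div | mod | lt | eq

/-- The result of an operation. -/
def Op.eval : Op → ℕ → ℕ → ℕ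
  | .add, x, y => x + y
  | .sub, x, y => x - y
  | .mul, x, y => x * y
  | .div, x, y => x / y
  | .mod, x, y => x % y
  | .lt, x, y => if x < y then 1 else 0
  | .eq, x, y => if x = y then 1 else 0

/-- Expressions: constants, the register `i`, the cell of array `a` at a computed address, and
arithmetic operations. -/
inductive Expr
  | const (m : ℕ)
  | reg (i : ℕ)
  | load (a : ℕ) (e : Expr)
  | op (o : Op) (e₁ e₂ : Expr)

/-- Programs. -/
inductive Cmd
  | skip
  | assign (i : ℕ) (e : Expr)
  | store (a : ℕ) (addr e : Expr)
  | seq (p q : Cmd)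
  | ite (e : Expr) (p q : Cmd)
  | while (e : Expr) (p : Cmd)

/-- The content of the registers and of the arrays. -/
structure State where
  reg : ℕ → ℕ
  arr : ℕ → ℕ → ℕ

/-- Number of words of length `L` that are charged for the number `x` (its binary length divided
by `L`, rounded down, plus one). -/
def words (L x : ℕ) : ℕ := 1 + Nat.size x / L

/-- The value of an expression. -/
def Expr.eval (s : State) : Expr → ℕ
  | .const m => m
  | .reg i => s.reg i
  | .load a e => s.arr a (e.eval s)
  | .op o e₁ e₂ => o.eval (e₁.eval s) (e₂.eval s)

/-- The number of word operations for evaluating an expression, for words of length `L`. -/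
def Expr.cost (L : ℕ) (s : State) : Expr → ℕ
  | .const m => words L m
  | .reg i => words L (s.reg i)
  | .load a e => e.cost L s + words L (e.eval s) + words L (s.arr a (e.eval s))
  | .op _ e₁ e₂ => e₁.cost L s + e₂.cost L s + words L (e₁.eval s) * words L (e₂.eval s)

/-- `Exec L p s s' T`: for words of length `L`, the program `p` started in state `s` halts in state
`s'` after exactly `T` word operations. -/
inductive Exec (L : ℕ) : Cmd → State → State → ℕ → Prop
  | skip (s : State) : Exec L .skip s s 1
  | assign (i : ℕ) (e : Expr) (s : State) :
      Exec L (.assign i e) s { s with reg := Function.update s.reg i (e.eval s) }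
        (1 + e.cost L s)
  | store (a : ℕ) (addr e : Expr) (s : State) :
      Exec L (.store a addr e) s
        { s with arr := Function.update s.arr a
                          (Function.update (s.arr a) (addr.eval s) (e.eval s)) }
        (1 + addr.cost L s + e.cost L s)
  | seq {p q : Cmd} {s₁ s₂ s₃ : State} {T₁ T₂ : ℕ} :
      Exec L p s₁ s₂ T₁ → Exec L q s₂ s₃ T₂ → Exec L (.seq p q) s₁ s₃ (T₁ + T₂)
  | ite_true {e : Expr} {p q : Cmd} {s s' : State} {T : ℕ} :
      e.eval s ≠ 0 → Exec L p s s' T → Exec L (.ite e p q) s s' (1 + e.cost L s + T)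
  | ite_false {e : Expr} {p q : Cmd} {s s' : State} {T : ℕ} :
      e.eval s = 0 → Exec L q s s' T → Exec L (.ite e p q) s s' (1 + e.cost L s + T)
  | while_false {e : Expr} {p : Cmd} {s : State} :
      e.eval s = 0 → Exec L (.while e p) s s (1 + e.cost L s)
  | while_true {e : Expr} {p : Cmd} {s₁ s₂ s₃ : State} {T₁ T₂ : ℕ} :
      e.eval s₁ ≠ 0 → Exec L p s₁ s₂ T₁ → Exec L (.while e p) s₂ s₃ T₂ →
      Exec L (.while e p) s₁ s₃ (1 + e.cost L s₁ + T₁ + T₂)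

/-- The machine is deterministic. -/
theorem Exec.unique {L : ℕ} {p : Cmd} {s s₁ s₂ : State} {T₁ T₂ : ℕ}
    (h₁ : Exec L p s s₁ T₁) (h₂ : Exec L p s s₂ T₂) : s₁ = s₂ ∧ T₁ = T₂ := by
  induction h₁ generalizing s₂ T₂ with
  | skip | assign | store => cases h₂; exact ⟨rfl, rfl⟩
  | seq _ _ ih₁ ih₂ =>
    cases h₂ with
    | seq a b =>
      obtain ⟨rfl, rfl⟩ := ih₁ a
      obtain ⟨rfl, rfl⟩ := ih₂ b
      exact ⟨rfl, rfl⟩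
  | ite_true h _ ih =>
    cases h₂ with
    | ite_true _ a => obtain ⟨rfl, rfl⟩ := ih a; exact ⟨rfl, rfl⟩
    | ite_false h' _ => exact absurd h' h
  | ite_false h _ ih =>
    cases h₂ with
    | ite_true h' _ => exact absurd h h'
    | ite_false _ a => obtain ⟨rfl, rfl⟩ := ih a; exact ⟨rfl, rfl⟩
  | while_false h =>
    cases h₂ with
    | while_false _ => exact ⟨rfl, rfl⟩
    | while_true h' _ _ => exact absurd h h'
  | while_true h _ _ ih₁ ih₂ =>
    cases h₂ with
    | while_false h' => exact absurd h' h
    | while_true _ a b =>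
      obtain ⟨rfl, rfl⟩ := ih₁ a
      obtain ⟨rfl, rfl⟩ := ih₂ b
      exact ⟨rfl, rfl⟩

/-- Row-by-row adjacency matrix of a graph with vertex set `{0, …, m-1}`: the entry at address
`i * m + j` is `1` if `i` and `j` are adjacent, and all other entries are `0`. -/
noncomputable def adjArray {m : ℕ} (G : SimpleGraph (Fin m)) (x : ℕ) : ℕ :=
  open Classical in if ∃ i j : Fin m, x = i * m + j ∧ G.Adj i j then 1 else 0

/-- The initial state on input `(H, G)`: registers `0` and `1` hold the numbers of vertices of `H`
and `G`, arrays `0` and `1` hold their adjacency matrices, and all other cells are `0`. -/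
noncomputable def input {h n : ℕ} (H : SimpleGraph (Fin h)) (G : SimpleGraph (Fin n)) : State where
  reg i := if i = 0 then h else if i = 1 then n else 0
  arr a x := if a = 0 then adjArray H x else if a = 1 then adjArray G x else 0

/-- The word length on inputs `(H, G)` with `h` and `n` vertices: the binary length of `h + n`. -/
def wordLength (h n : ℕ) : ℕ := Nat.size (h + n)

end WordRAM

/-!
The algorithm counts injective homomorphisms and divides by the number of automorphisms.

Let `B` be the graph that `H` induces on its `m ≤ 2k` vertices that are not isolated. Every
subgraph of `G` isomorphic to `H` is the image of equally many injective homomorphisms from `H`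
(`InjCount.copyCount_mul`), and isolated vertices contribute falling factorials only, so `#Sub(H,
G) = inj(B, G) * (n - m).choose (h - m) / inj(B, B)` (`InjCount.copyCount_eq_div`).

The indicator of injectivity of a function `x` on `Fin m` is the product of `1 - #{j < i | x j = x
i}` over all `i`. Expanding it turns `inj(B, G)` into a signed sum over the at most `m ^ m`
functions `p` with `p i ≤ i`, in which `p` contributes the number of homomorphisms that are
constant on the orbits of `p` (`InjCount.injCount_eq`). These are the homomorphisms from a
quotient of `B`. A quotient with a loop contributes `0`, and a quotient without loops belongs to
the spasm of `H` up to isolated vertices, so its treewidth is at most `t`.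

A tree decomposition of width `t` yields an order of the vertices in which elimination creates at
most `t` later neighbours for each vertex (`TreeElim.exists_order`, `IsPattern.hasOrder`). The
program finds an order of minimum width by trying all `m ^ m` candidates for every width.
Eliminating the vertices along such an order is a dynamic program whose tables have at most `n ^
t` entries, each of which is a sum over `n` values (`ElimDP.total_eq`, `dpProg_tri`). Altogether
the number of steps is `m ^ O(m) * n ^ (t + 1)` (`injProg_tri`, `countProg_tri`).

The program is written in a small language with bounded loops, whose terms may contain sums and
products over at most `m` values. It is compiled to the machine (`HCmd.toCmd`). All numbers that
occur in its registers and arrays are at most `(n + 2) ^ (2 * m + 2)` and hence have `O(m)` words,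
so a step takes time polynomial in `m`, with an exponent that depends on the program only
(`HCmd.exec`). The binomial coefficient may have up to `n` bits; it is computed in time `O(n ^ 2)`
(`finalCmd_exec`), which is within the bound because `t ≥ 1` as soon as `H` has an edge.
-/

/-! ### Dynamic programming along an elimination order -/

namespace ElimDP

open Finset Function

/-- No element below `i` is a successor of `c`. -/
def Alive (S : ℕ → ℕ → Prop) (c i : ℕ) : Prop := ∀ l < i, ¬S c l

open Classical in
/-- The table of position `c`: the sum over all values of position `c` and of the positions whose
elimination it depends on, as a function of the values of the successors of `c`. -/
noncomputable def table (S : ℕ → ℕ → Prop) (n : ℕ) (w : ℕ → (ℕ → ℕ) → ℕ) (c : ℕ) (x : ℕ → ℕ) : ℕ :=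
  ∑ v ∈ range n, w c (update x c v) *
    ∏ d : Fin c, if S d c ∧ Alive S d c then table S n w d (update x c v) else 1
termination_by c
decreasing_by exact d.2

/-- The sum over all values of the positions below `i`. -/
def total (n : ℕ) (w : ℕ → (ℕ → ℕ) → ℕ) : ℕ → (ℕ → ℕ) → ℕ
  | 0, _ => 1
  | i + 1, x => ∑ v ∈ range n, w i (update x i v) * total n w i (update x i v)

variable {S : ℕ → ℕ → Prop} {n : ℕ} {w w' : ℕ → (ℕ → ℕ) → ℕ}

open Classical in
theorem table_eq (c : ℕ) (x : ℕ → ℕ) : table S n w c x = ∑ v ∈ range n, w c (update x c v) *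
    ∏ d ∈ range c, if S d c ∧ Alive S d c then table S n w d (update x c v) else 1 := by
  rw [table]
  refine sum_congr rfl fun v _ => ?_
  rw [Finset.prod_range (fun d => if S d c ∧ Alive S d c then table S n w d (update x c v) else 1)]

/-- The weight of a position depends on its own value and on those of its successors only. -/
def Local (S : ℕ → ℕ → Prop) (w : ℕ → (ℕ → ℕ) → ℕ) : Prop :=
  ∀ c x x', x c = x' c → (∀ j, S c j → x j = x' j) → w c x = w c x'

theorem table_congr (hcl : ∀ c i j, S c i → S c j → i < j → S i j) (hw : Local S w) {c : ℕ}
    {x x' : ℕ → ℕ} (h : ∀ j, S c j → x j = x' j) : table S n w c x = table S n w c x' := by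
  classical
  induction c using Nat.strong_induction_on generalizing x x' with
  | _ c ih =>
    have hu : ∀ v, ∀ j, S c j → update x c v j = update x' c v j := by
      intro v j hj
      by_cases hjc : j = c
      · subst hjc; simp
      · simp [hjc, h j hj]
    rw [table_eq, table_eq]
    refine sum_congr rfl fun v _ => ?_
    congr 1
    · exact hw _ _ _ (by simp) (hu v)
    · refine prod_congr rfl fun d hd => ?_
      split
      · rename_i hdc
        refine ih d (mem_range.1 hd) fun j hj => ?_
        by_cases hjc : j = c
        · subst hjc; simp
        · have : c < j := by
            by_contra hlt
            exact hdc.2 j (by omega) hj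
          exact hu v j (hcl d c j hdc.1 hj this)
      · rfl

open Classical in
/-- Eliminating the positions below `i` leaves the product of the tables of those positions that are
not yet used in another table. -/
theorem total_eq (hlt : ∀ c j, S c j → c < j) (hcl : ∀ c i j, S c i → S c j → i < j → S i j)
    (hw : Local S w) (i : ℕ) (x : ℕ → ℕ) :
    total n w i x = ∏ c ∈ range i, if Alive S c i then table S n w c x else 1 := by
  induction i generalizing x with
  | zero => simp [total]
  | succ i ih =>
    rw [total, prod_range_succ]
    have h1 : Alive S i (i + 1) := fun l hl hs => by have := hlt _ _ hs; omega
    rw [if_pos h1, table_eq, mul_sum]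
    refine sum_congr rfl fun v _ => ?_
    rw [ih, mul_left_comm, ← prod_mul_distrib]
    congr 1
    refine prod_congr rfl fun c _ => ?_
    have h2 : Alive S c (i + 1) ↔ Alive S c i ∧ ¬S c i := by
      unfold Alive
      constructor
      · exact fun h => ⟨fun l hl => h l (by omega), h i (by omega)⟩
      · rintro ⟨h, h'⟩ l hl
        rcases Nat.lt_succ_iff_lt_or_eq.1 hl with hl | rfl
        · exact h l hl
        · exact h'
    by_cases ha : Alive S c i <;> by_cases hs : S c i <;> simp [h2, ha, hs]
    refine table_congr hcl hw fun j hj => ?_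
    rw [update_of_ne]
    rintro rfl
    exact hs hj

theorem table_mono (hw : ∀ c x, w c x ≤ w' c x) (c : ℕ) (x : ℕ → ℕ) :
    table S n w c x ≤ table S n w' c x := by
  classical
  induction c using Nat.strong_induction_on generalizing x with
  | _ c ih =>
    rw [table_eq, table_eq]
    refine sum_le_sum fun v _ => Nat.mul_le_mul (hw _ _) ?_
    refine prod_le_prod' fun d hd => ?_
    split
    · exact ih d (mem_range.1 hd) _
    · rfl

theorem one_le_table_one (hn : 1 ≤ n) (c : ℕ) (x : ℕ → ℕ) :
    1 ≤ table S n (fun _ _ => 1) c x := by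
  classical
  induction c using Nat.strong_induction_on generalizing x with
  | _ c ih =>
    rw [table_eq]
    refine (single_le_sum (f := fun v => 1 * ∏ d ∈ range c, if S d c ∧ Alive S d c then
      table S n (fun _ _ => 1) d (update x c v) else 1) (fun _ _ => Nat.zero_le _)
      (mem_range.2 hn)).trans' ?_
    rw [one_mul]
    refine Finset.one_le_prod' fun d hd => ?_
    split
    · exact ih d (mem_range.1 hd) _
    · rfl

theorem total_one (i : ℕ) (x : ℕ → ℕ) : total n (fun _ _ => 1) i x = n ^ i := by
  induction i generalizing x with
  | zero => rfl
  | succ i ih => simp [total, ih, pow_succ, mul_comm]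

/-- Weights of at most `1` give small tables: compare with the constant weight `1`. -/
theorem table_le (hlt : ∀ c j, S c j → c < j) (hcl : ∀ c i j, S c i → S c j → i < j → S i j)
    (hw : ∀ c x, w c x ≤ 1) (hn : 1 ≤ n) (c : ℕ) (x : ℕ → ℕ) : table S n w c x ≤ n ^ (c + 1) := by
  classical
  refine (table_mono hw c x).trans ?_
  rw [← total_one (n := n) (c + 1) x, total_eq hlt hcl (fun _ _ _ _ _ => rfl)]
  have h1 : Alive S c (c + 1) := fun l hl hs => by have := hlt _ _ hs; omega
  refine (single_le_prod' (f := fun c' => if Alive S c' (c + 1) then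
    table S n (fun _ _ => 1) c' x else 1) (fun d _ => ?_) (mem_range.2 (Nat.lt_succ_self c))).trans'
    (by rw [if_pos h1])
  split
  · exact one_le_table_one hn _ _
  · rfl

theorem total_le (hw : ∀ c x, w c x ≤ 1) (i : ℕ) (x : ℕ → ℕ) : total n w i x ≤ n ^ i := by
  rw [← total_one (n := n) i x]
  induction i generalizing x with
  | zero => rfl
  | succ i ih => exact sum_le_sum fun v _ => Nat.mul_le_mul (hw _ _) (ih _)

/-- The assignment that agrees with `y` below `i` and with `x` elsewhere. -/
def ext (i : ℕ) (y : Fin i → Fin n) (x : ℕ → ℕ) (j : ℕ) : ℕ := if h : j < i then y ⟨j, h⟩ else x j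

/-- Expanding the iterated sum. -/
theorem total_eq_sum (hlt : ∀ c j, S c j → c < j) (hw : Local S w) (i : ℕ) (x : ℕ → ℕ) :
    total n w i x = ∑ y : Fin i → Fin n, ∏ c ∈ range i, w c (ext i y x) := by
  induction i generalizing x with
  | zero => simp [total]
  | succ i ih =>
    rw [total, ← (Fin.snocEquiv fun _ => Fin n).sum_comp, Fintype.sum_prod_type, Finset.sum_range]
    refine sum_congr rfl fun v _ => ?_
    rw [ih, mul_sum]
    refine sum_congr rfl fun y _ => ?_
    have he : ext (i + 1) ((Fin.snocEquiv fun _ => Fin n) (v, y)) x = ext i y (update x i v) := by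
      funext j
      simp only [ext, Fin.snocEquiv_apply]
      rcases lt_trichotomy j i with h | rfl | h
      · rw [dif_pos (by omega), dif_pos h]
        congr 1
        exact Fin.snoc_castSucc (α := fun _ => Fin n) v y ⟨j, h⟩
      · rw [dif_pos (by omega), dif_neg (lt_irrefl _), update_self]
        congr 1
        exact Fin.snoc_last (α := fun _ => Fin n) v y
      · rw [dif_neg (by omega), dif_neg (by omega), update_of_ne (by omega)]
    rw [prod_range_succ, he, mul_comm]
    congr 1
    refine hw _ _ _ (by simp [ext]) fun j hj => ?_
    have := hlt _ _ hj
    simp [ext, show ¬j < i by omega]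

end ElimDP

/-! ### Injective homomorphisms as a signed sum over quotients -/

namespace InjCount

open Finset Function

variable {m n : ℕ}

/-- The number of injective homomorphisms from `B` to `A`. -/
noncomputable def injCount {V W : Type} (B : SimpleGraph V) (A : SimpleGraph W) : ℕ :=
  Nat.card {x : V → W // (∀ i j, B.Adj i j → A.Adj (x i) (x j)) ∧ Injective x}

open Classical in
/-- The number of homomorphisms from `B` to `A` that are constant on the orbits of `p`. -/
noncomputable def homCount (B : SimpleGraph (Fin m)) (A : SimpleGraph (Fin n))
    (p : Fin m → Fin m) : ℕ :=
  #{x : Fin m → Fin n | (∀ i j, B.Adj i j → A.Adj (x i) (x j)) ∧ ∀ i, x (p i) = x i}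

open Classical in
/-- The indicator of injectivity of `x` is the product of `1 - #{j < i | x j = x i}` over all `i`:
if `x` is not injective, then the factor of the first `i` with `x i` among the preceding values
vanishes. Expanding the product gives the sum over all functions `p` with `p i ≤ i`. -/
theorem indicator_injective (x : Fin m → Fin n) :
    (if Injective x then 1 else 0 : ℤ) = ∑ p : Fin m → Fin m, if ∀ i, p i ≤ i then
      (-1) ^ #{i | p i < i} * (if ∀ i, x (p i) = x i then 1 else 0) else 0 := by
  let a : Fin m → Fin m → ℤ := fun i j => if j = i then 1 else if j < i ∧ x j = x i then -1 else 0
  have h1 : ∏ i, ∑ j, a i j = if Injective x then 1 else 0 := by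
    split
    · rename_i hx
      refine prod_eq_one fun i _ => ?_
      rw [sum_eq_single i]
      · simp [a]
      · intro j _ hj
        simp only [a, if_neg hj]
        exact if_neg fun h => hj (hx h.2)
      · simp
    · rename_i hx
      have hex : ∃ i : Fin m, ∃ j < i, x j = x i := by
        simp only [Injective, not_forall] at hx
        obtain ⟨i, j, h, hij⟩ := hx
        rcases lt_or_gt_of_ne hij with h' | h'
        · exact ⟨j, i, h', h⟩
        · exact ⟨i, j, h', h.symm⟩
      obtain ⟨i, ⟨j, hji, hj⟩, hmin⟩ := WellFounded.has_min (wellFounded_lt (α := Fin m))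
        {i | ∃ j < i, x j = x i} hex
      refine prod_eq_zero (mem_univ i) ?_
      rw [sum_eq_add_of_mem i j (mem_univ _) (mem_univ _) hji.ne']
      · simp [a, hji.ne, hji, hj]
      · intro l _ hl
        simp only [a, if_neg hl.1]
        refine if_neg fun h => ?_
        rcases lt_or_gt_of_ne hl.2 with h' | h'
        · exact hmin j ⟨l, h', h.2.trans hj.symm⟩ hji
        · exact hmin l ⟨j, h', hj.trans h.2.symm⟩ h.1
  rw [← h1, prod_univ_sum, Fintype.piFinset_univ]
  refine sum_congr rfl fun p _ => ?_
  by_cases hp : ∀ i, p i ≤ i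
  · rw [if_pos hp]
    by_cases hx : ∀ i, x (p i) = x i
    · rw [if_pos hx, mul_one]
      have h2 : ∀ i, a i (p i) = if p i < i then -1 else 1 := by
        intro i
        rcases (hp i).lt_or_eq with h | h
        · simp [a, h, h.ne, hx i]
        · simp [a, h]
      simp only [h2]
      rw [prod_ite, prod_const, prod_const_one, mul_one]
    · rw [if_neg hx, mul_zero]
      simp only [not_forall] at hx
      obtain ⟨i, hi⟩ := hx
      refine prod_eq_zero (mem_univ i) ?_
      have : p i ≠ i := fun h => hi (by rw [h])
      simp [a, this, hi]
  · rw [if_neg hp]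
    simp only [not_forall, not_le] at hp
    obtain ⟨i, hi⟩ := hp
    refine prod_eq_zero (mem_univ i) ?_
    simp [a, hi.ne', hi.not_gt]

open Classical in
/-- Injective homomorphisms as a signed sum of homomorphisms that identify vertices. -/
theorem injCount_eq (B : SimpleGraph (Fin m)) (A : SimpleGraph (Fin n)) :
    (injCount B A : ℤ) = ∑ p : Fin m → Fin m, if ∀ i, p i ≤ i then
      (-1) ^ #{i | p i < i} * (homCount B A p : ℤ) else 0 := by
  have h1 : (injCount B A : ℤ) = ∑ x : Fin m → Fin n,
      if ∀ i j, B.Adj i j → A.Adj (x i) (x j) then (if Injective x then 1 else 0 : ℤ) else 0 := by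
    rw [injCount, Nat.card_eq_fintype_card, Fintype.card_subtype, card_filter, Nat.cast_sum]
    exact sum_congr rfl fun x _ => by split_ifs <;> simp_all
  have h2 : ∀ p, (homCount B A p : ℤ) = ∑ x : Fin m → Fin n,
      if ∀ i j, B.Adj i j → A.Adj (x i) (x j) then (if ∀ i, x (p i) = x i then 1 else 0 : ℤ)
      else 0 := by
    intro p
    rw [homCount, card_filter, Nat.cast_sum]
    exact sum_congr rfl fun x _ => by split_ifs <;> simp_all
  simp only [h1, h2, indicator_injective]
  simp only [mul_sum]
  have h3 : ∀ p : Fin m → Fin m, (if ∀ i, p i ≤ i then ∑ x : Fin m → Fin n, (-1) ^ #{i | p i < i} *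
      (if ∀ i j, B.Adj i j → A.Adj (x i) (x j) then (if ∀ i, x (p i) = x i then 1 else 0 : ℤ)
      else 0) else 0) = ∑ x : Fin m → Fin n, if ∀ i j, B.Adj i j → A.Adj (x i) (x j) then
      (if ∀ i, p i ≤ i then (-1) ^ #{i | p i < i} * (if ∀ i, x (p i) = x i then 1 else 0 : ℤ)
        else 0) else 0 := by
    intro p
    split_ifs with h
    · exact sum_congr rfl fun x _ => by split_ifs <;> simp
    · simp
  simp only [h3]
  rw [sum_comm]
  refine sum_congr rfl fun x _ => ?_
  split_ifs
  · rfl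
  · simp

/-! ### Quotients -/

/-- Adjacency in the quotient of `B` by the fibres of `R`. -/
def QAdj (B : SimpleGraph (Fin m)) (R : Fin m → Fin m) (a b : Fin m) : Prop :=
  ∃ i j, B.Adj i j ∧ R i = a ∧ R j = b

theorem QAdj.symm {B : SimpleGraph (Fin m)} {R : Fin m → Fin m} {a b : Fin m} (h : QAdj B R a b) :
    QAdj B R b a := by
  obtain ⟨i, j, h, ha, hb⟩ := h
  exact ⟨j, i, h.symm, hb, ha⟩

/-- `R` maps every `i` to the fixed point of `p` that is reached from `i`. -/
structure IsRoot (p R : Fin m → Fin m) : Prop where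
  le : ∀ i, p i ≤ i
  eq : ∀ i, R i = if p i = i then i else R (p i)

namespace IsRoot

variable {p R : Fin m → Fin m} (h : IsRoot p R)
include h

theorem p_root (i : Fin m) : p (R i) = R i := by
  induction i using WellFoundedLT.induction with
  | _ i ih =>
    rw [h.eq]
    split
    · rename_i h'; exact h'
    · rename_i h'; exact ih _ ((h.le i).lt_of_ne h')

theorem root_root (i : Fin m) : R (R i) = R i := by
  rw [h.eq (R i), if_pos (h.p_root i)]

theorem root_p (i : Fin m) : R (p i) = R i := by
  rw [h.eq i]
  split
  · rename_i h'; rw [h', h.eq i, if_pos h']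
  · rfl

theorem const_iff {α : Type*} (x : Fin m → α) : (∀ i, x (p i) = x i) ↔ ∀ i, x (R i) = x i := by
  constructor
  · intro hx i
    induction i using WellFoundedLT.induction with
    | _ i ih =>
      rw [h.eq]
      split
      · rfl
      · rename_i h'; rw [ih _ ((h.le i).lt_of_ne h'), hx]
  · intro hx i
    rw [← hx (p i), h.root_p, hx]

open Classical in
/-- The homomorphisms that are constant on the blocks correspond to the homomorphisms of the
quotient, whose values at the elements that are not representatives are fixed to be `0`. -/
theorem homCount_eq [NeZero n] (B : SimpleGraph (Fin m)) (A : SimpleGraph (Fin n)) :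
    homCount B A p = #{y : Fin m → Fin n | (∀ a, R a = a ∨ y a = 0) ∧
      ∀ a b, QAdj B R a b → A.Adj (y a) (y b)} := by
  refine card_nbij' (fun x a => if R a = a then x a else 0) (fun y i => y (R i)) ?_ ?_ ?_ ?_
  · intro x hx
    simp only [coe_filter, mem_univ, true_and, Set.mem_ofPred_eq] at hx ⊢
    rw [h.const_iff] at hx
    refine ⟨fun a => ?_, ?_⟩
    · by_cases ha : R a = a <;> simp [ha]
    · rintro a b ⟨i, j, hij, rfl, rfl⟩
      simp only [h.root_root, if_true, hx.2]
      exact hx.1 i j hij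
  · intro y hy
    simp only [coe_filter, mem_univ, true_and, Set.mem_ofPred_eq] at hy ⊢
    exact ⟨fun i j hij => hy.2 _ _ ⟨i, j, hij, rfl, rfl⟩, fun i => by rw [h.root_p]⟩
  · intro x hx
    simp only [coe_filter, mem_univ, true_and, Set.mem_ofPred_eq] at hx
    rw [h.const_iff] at hx
    funext i
    simp [h.root_root, hx.2]
  · intro y hy
    simp only [coe_filter, mem_univ, true_and, Set.mem_ofPred_eq] at hy
    funext a
    by_cases ha : R a = a
    · simp [ha]
    · simp [ha, (hy.1 a).resolve_left ha]

theorem homCount_eq_zero {B : SimpleGraph (Fin m)} {A : SimpleGraph (Fin n)} {a : Fin m}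
    (hl : QAdj B R a a) : homCount B A p = 0 := by
  classical
  obtain ⟨i, j, hij, hi, hj⟩ := hl
  rw [homCount, card_eq_zero, filter_eq_empty_iff]
  rintro x - ⟨h1, h2⟩
  rw [h.const_iff] at h2
  have := h1 i j hij
  rw [← h2 i, ← h2 j, hi, hj] at this
  exact this.ne rfl

end IsRoot

/-! ### Homomorphisms of a quotient as a sum of local weights -/

open Classical in
/-- The weight of position `c`: its value is free only for representatives, and all edges to later
positions have to be mapped to edges. -/
noncomputable def weight (m : ℕ) (Rt : ℕ → Prop) (M Ad : ℕ → ℕ → Prop) (c : ℕ) (x : ℕ → ℕ) : ℕ :=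
  (if Rt c ∨ x c = 0 then 1 else 0) *
    ∏ j ∈ range m, if c < j ∧ M c j then (if Ad (x c) (x j) then 1 else 0) else 1

variable {Rt : ℕ → Prop} {M Ad S : ℕ → ℕ → Prop}

theorem weight_le (c : ℕ) (x : ℕ → ℕ) : weight m Rt M Ad c x ≤ 1 := by
  classical
  have h : ∏ j ∈ range m, (if c < j ∧ M c j then (if Ad (x c) (x j) then 1 else 0) else 1) ≤ 1 :=
    prod_le_one' fun j _ => by split_ifs <;> simp
  unfold weight
  split_ifs
  · simpa using h
  · simp

theorem weight_local (hS : ∀ c j, c < j → j < m → M c j → S c j) :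
    ElimDP.Local S (weight m Rt M Ad) := by
  intro c x x' hc hj
  unfold weight
  rw [hc]
  congr 1
  refine prod_congr rfl fun j hjm => ?_
  split_ifs with h1 h2 h3 h3
  · rfl
  · rw [hj j (hS c j h1.1 (mem_range.1 hjm) h1.2)] at h2; exact absurd h2 h3
  · rw [hj j (hS c j h1.1 (mem_range.1 hjm) h1.2)] at h2; exact absurd h3 h2
  · rfl
  · rfl

open Classical in
theorem prod_weight (x : ℕ → ℕ) : ∏ c ∈ range m, weight m Rt M Ad c x =
    if (∀ c < m, Rt c ∨ x c = 0) ∧ ∀ c < m, ∀ j < m, c < j → M c j → Ad (x c) (x j) then 1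
    else 0 := by
  unfold weight
  rw [prod_mul_distrib]
  split_ifs with h
  · rw [prod_eq_one fun c hc => if_pos (h.1 c (mem_range.1 hc)), one_mul]
    refine prod_eq_one fun c hc => prod_eq_one fun j hj => ?_
    split_ifs with h1 h2
    · rfl
    · exact absurd (h.2 c (mem_range.1 hc) j (mem_range.1 hj) h1.1 h1.2) h2
    · rfl
  · rw [not_and_or] at h
    push Not at h
    rcases h with ⟨c, hc, h1⟩ | ⟨c, hc, j, hj, h1, h2, h3⟩
    · rw [prod_eq_zero (mem_range.2 hc), zero_mul]
      rw [if_neg (by tauto)]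
    · rw [mul_comm, prod_eq_zero (mem_range.2 hc), zero_mul]
      exact prod_eq_zero (mem_range.2 hj) (by rw [if_pos ⟨h1, h2⟩, if_neg h3])

/-- Summing the weights along an order `σ` counts the homomorphisms of a quotient without loops. -/
theorem total_weight [NeZero n] {B : SimpleGraph (Fin m)} {A : SimpleGraph (Fin n)}
    {p R : Fin m → Fin m} (hR : IsRoot p R) (hl : ∀ a, ¬QAdj B R a a) (σ : Equiv.Perm (Fin m))
    (hRt : ∀ c : Fin m, Rt c ↔ R (σ c) = σ c)
    (hM : ∀ c j : Fin m, M c j ↔ QAdj B R (σ c) (σ j))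
    (hAd : ∀ u v : Fin n, Ad u v ↔ A.Adj u v)
    (hlt : ∀ c j, S c j → c < j) (hS : ∀ c j, c < j → j < m → M c j → S c j) :
    ElimDP.total n (weight m Rt M Ad) m (fun _ => 0) = homCount B A p := by
  classical
  rw [ElimDP.total_eq_sum hlt (weight_local hS), hR.homCount_eq, card_filter,
    ← (Equiv.arrowCongr σ.symm (Equiv.refl (Fin n))).sum_comp]
  refine sum_congr rfl fun y _ => ?_
  rw [prod_weight]
  congr 1
  rw [eq_iff_iff]
  have hv : ∀ c : Fin m, ElimDP.ext m ((Equiv.arrowCongr σ.symm (Equiv.refl (Fin n))) y)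
      (fun _ => 0) c = y (σ c) := fun c => by simp [ElimDP.ext]
  constructor
  · rintro ⟨h1, h2⟩
    refine ⟨fun a => ?_, fun a b hab => ?_⟩
    · have := h1 (σ.symm a) (σ.symm a).2
      rw [hRt, hv, σ.apply_symm_apply] at this
      exact this.imp_right fun h => Fin.ext (by simpa using h)
    · have hne : σ.symm a ≠ σ.symm b := fun h => by
        rw [σ.symm.injective h] at hab; exact hl _ hab
      rcases lt_or_gt_of_ne hne with h | h
      · have := h2 _ (σ.symm a).2 _ (σ.symm b).2 h ((hM _ _).2 (by simpa using hab))
        rwa [hv, hv, hAd, σ.apply_symm_apply, σ.apply_symm_apply] at this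
      · have := h2 _ (σ.symm b).2 _ (σ.symm a).2 h ((hM _ _).2 (by simpa using hab.symm))
        rw [hv, hv, hAd, σ.apply_symm_apply, σ.apply_symm_apply] at this
        exact this.symm
  · rintro ⟨h1, h2⟩
    refine ⟨fun c hc => ?_, fun c hc j hj hcj hm => ?_⟩
    · have := h1 (σ ⟨c, hc⟩)
      rw [← hRt] at this
      refine this.imp_right fun h => ?_
      rw [hv ⟨c, hc⟩, h]
      simp
    · have := h2 _ _ ((hM ⟨c, hc⟩ ⟨j, hj⟩).1 hm)
      rw [← hAd] at this
      rw [hv ⟨c, hc⟩, hv ⟨j, hj⟩]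
      exact this

end InjCount

/-! ### Elimination orders from tree decompositions -/

namespace TreeElim

open SimpleGraph

/-- A tree has a depth function and a parent function: of two adjacent nodes, one is the parent of
the other. -/
theorem exists_parent {ι : Type} {T : SimpleGraph ι} (hT : T.IsTree) :
    ∃ (par : ι → ι) (dep : ι → ℕ), ∀ x y, T.Adj x y →
      (y = par x ∧ dep x = dep y + 1) ∨ (x = par y ∧ dep y = dep x + 1) := by
  obtain ⟨r⟩ := hT.connected.nonempty
  choose q hq hql using fun v => hT.connected.exists_path_of_dist r v
  have key : ∀ v u, T.Adj v u → T.dist r v = T.dist r u + 1 → u = (q v).penultimate := by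
    intro v u h hd
    refine hT.isAcyclic.eq_penultimate_of_adj_end (hq v) h ?_
    refine hT.isAcyclic.mem_support_of_ne_mem_support_of_adj_of_isPath (hq v) (hq u) h fun hv => ?_
    have h1 := congrArg Walk.length (hT.isAcyclic.path_concat (hq v) (hq u) h hv)
    rw [Walk.length_concat, hql, hql] at h1
    omega
  refine ⟨fun v => (q v).penultimate, fun v => T.dist r v, fun x y h => ?_⟩
  rcases hT.dist_eq_dist_add_one_of_adj r h with h1 | h1
  · exact .inl ⟨key x y h h1, h1⟩
  · exact .inr ⟨key y x h.symm h1, h1⟩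

section

variable {ι : Type} {T : SimpleGraph ι} {par : ι → ι} {dep : ι → ℕ}
  (hpar : ∀ x y, T.Adj x y → (y = par x ∧ dep x = dep y + 1) ∨ (x = par y ∧ dep y = dep x + 1))

include hpar

/-- If a connected set of nodes contains `t` but not its parent, then all its nodes descend
from `t`. -/
theorem descendant {X : Set ι} (hX : (T.induce X).Preconnected) {t : ι} (ht : t ∈ X)
    (hmin : ∀ y ∈ X, T.Adj t y → dep t ≠ dep y + 1) {y : ι} (hy : y ∈ X) :
    ∃ j, par^[j] y = t ∧ dep y = dep t + j := by
  have h := (reachable_iff_reflTransGen _ _).1 (hX ⟨t, ht⟩ ⟨y, hy⟩)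
  suffices H : ∀ z : X, Relation.ReflTransGen (T.induce X).Adj ⟨t, ht⟩ z →
      ∃ j, par^[j] z.1 = t ∧ dep z.1 = dep t + j from H _ h
  intro z hz
  induction hz with
  | refl => exact ⟨0, rfl, rfl⟩
  | @tail a b _ hab ih =>
    obtain ⟨j, hj, hd⟩ := ih
    have hab' : T.Adj a.1 b.1 := hab
    rcases hpar _ _ hab' with ⟨h1, h2⟩ | ⟨h1, h2⟩
    · cases j with
      | zero =>
        simp only [Function.iterate_zero, id_eq] at hj
        rw [hj] at hab' h2
        exact absurd h2 (hmin _ b.2 hab')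
      | succ j =>
        refine ⟨j, ?_, by omega⟩
        rw [h1, ← Function.iterate_succ_apply, hj]
    · refine ⟨j + 1, ?_, by omega⟩
      rw [Function.iterate_succ_apply, ← h1, hj]

/-- A connected set of nodes that contains `x` and a node of smaller depth contains the parent of
`x`. -/
theorem parent_mem {X : Set ι} (hX : (T.induce X).Preconnected) {x y : ι} (hx : x ∈ X) (hy : y ∈ X)
    (hlt : dep y < dep x) : par x ∈ X ∧ dep x = dep (par x) + 1 := by
  by_contra hcon
  obtain ⟨j, -, hj⟩ := descendant hpar hX hx (fun z hz hxz hd => hcon (by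
    rcases hpar _ _ hxz with ⟨h1, h2⟩ | ⟨h1, h2⟩
    · rw [← h1]; exact ⟨hz, h2⟩
    · omega)) hy
  omega

/-- Let `X` and `Y` be intersecting connected sets of nodes. If the depth of the topmost node `t`
of `X` is at least that of some node of `Y`, then `Y` contains `t`. -/
theorem top_mem {X Y : Set ι} (hX : (T.induce X).Preconnected) (hY : (T.induce Y).Preconnected)
    {s t u : ι} (hsX : s ∈ X) (hsY : s ∈ Y) (htX : t ∈ X) (ht : ∀ y ∈ X, dep t ≤ dep y)
    (huY : u ∈ Y) (hu : dep u ≤ dep t) : t ∈ Y := by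
  obtain ⟨j, hj, hd⟩ := descendant hpar hX htX (fun y hy _ hd => by have := ht y hy; omega) hsX
  have key : ∀ i ≤ j, par^[i] s ∈ Y ∧ dep s = dep (par^[i] s) + i := by
    intro i hi
    induction i with
    | zero => exact ⟨hsY, rfl⟩
    | succ i ih =>
      obtain ⟨h1, h2⟩ := ih (by omega)
      have h3 := parent_mem hpar hY h1 huY (by omega)
      rw [Function.iterate_succ_apply']
      exact ⟨h3.1, by omega⟩
  rw [← hj]
  exact (key j le_rfl).1

end

/-- Ordering the vertices by decreasing depth of their topmost bags gives an elimination order: the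
vertices that follow `i` and share a bag with `i` all lie in the topmost bag of `i`. -/
theorem exists_order {m k w : ℕ} {T : SimpleGraph (Fin k)} (hT : T.IsTree)
    {β : Fin k → Finset (Fin m)} (hβ : ∀ v, (T.induce {t | v ∈ β t}).Preconnected)
    (hw : ∀ t, (β t).card ≤ w + 1) :
    ∃ (σ : Equiv.Perm (Fin m)) (C : Fin m → Fin m → Prop),
      (∀ i j t, σ i ∈ β t → σ j ∈ β t → C i j) ∧
      (∀ c i j, c < i → i < j → C c i → C c j → C i j) ∧
      ∀ i (s : Finset (Fin m)), (∀ j ∈ s, i < j ∧ C i j) → s.card ≤ w := by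
  classical
  obtain ⟨par, dep, hpar⟩ := exists_parent hT
  have htop : ∀ v, ∃ t, (∃ s, v ∈ β s) → v ∈ β t ∧ ∀ s, v ∈ β s → dep t ≤ dep s := by
    intro v
    by_cases h : ∃ s, v ∈ β s
    · obtain ⟨t, ht, hmin⟩ := Finset.exists_min_image (Finset.univ.filter fun s => v ∈ β s) dep
        (by obtain ⟨s, hs⟩ := h; exact ⟨s, by simpa using hs⟩)
      simp only [Finset.mem_filter, Finset.mem_univ, true_and] at ht hmin
      exact ⟨t, fun _ => ⟨ht, hmin⟩⟩
    · obtain ⟨r⟩ := hT.connected.nonempty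
      exact ⟨r, fun h' => absurd h' h⟩
  choose top htop using htop
  let f : Fin m → ℕᵒᵈ := fun v => OrderDual.toDual (dep (top v))
  have hmono : ∀ i j, i < j → dep (top (Tuple.sort f j)) ≤ dep (top (Tuple.sort f i)) :=
    fun i j hij => Tuple.monotone_sort f hij.le
  set σ := Tuple.sort f
  have key : ∀ i j t, i < j → σ i ∈ β t → σ j ∈ β t → σ j ∈ β (top (σ i)) := by
    intro i j t hij hi hj
    have h1 := htop (σ i) ⟨t, hi⟩
    have h2 := htop (σ j) ⟨t, hj⟩
    exact top_mem hpar (hβ (σ i)) (hβ (σ j)) (s := t) hi hj h1.1 h1.2 h2.1 (hmono i j hij)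
  refine ⟨σ, fun i j => ∃ t, σ i ∈ β t ∧ σ j ∈ β t, fun i j t h1 h2 => ⟨t, h1, h2⟩, ?_, ?_⟩
  · rintro c i j hci hij ⟨t, h1, h2⟩ ⟨t', h3, h4⟩
    exact ⟨_, key c i t hci h1 h2, key c j t' (hci.trans hij) h3 h4⟩
  · intro i s hs
    rcases s.eq_empty_or_nonempty with rfl | ⟨j, hj⟩
    · simp
    · obtain ⟨-, t, hi, -⟩ := hs j hj
      have h1 : insert i s ⊆ (β (top (σ i))).map σ.symm.toEmbedding := by
        intro l hl
        simp only [Finset.mem_map, Equiv.coe_toEmbedding]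
        rcases Finset.mem_insert.1 hl with rfl | hl
        · exact ⟨σ l, (htop (σ l) ⟨t, hi⟩).1, by simp⟩
        · obtain ⟨hil, t', h3, h4⟩ := hs l hl
          exact ⟨σ l, key i l t' hil h3 h4, by simp⟩
      have h2 := Finset.card_le_card h1
      rw [Finset.card_map, Finset.card_insert_of_notMem (fun h => (hs i h).1.false)] at h2
      have := hw (top (σ i))
      omega

end TreeElim

namespace WordRAM

/-! ### Terms with bounded sums and products -/

/-- Terms: expressions that may also branch and take sums and products over `x < m`, where the
range `m` is always the content of register `2` and `x` is a register. -/
inductive Tm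
  | const (c : ℕ)
  | reg (i : ℕ)
  | load (a : ℕ) (t : Tm)
  | op (o : Op) (t u : Tm)
  | ite (c t u : Tm)
  | sum (x : ℕ) (t : Tm)
  | prod (x : ℕ) (t : Tm)

namespace Tm

/-- The value of a term; `ar` gives the contents of the arrays and `r` those of the registers. -/
def eval (ar : ℕ → ℕ → ℕ) : Tm → (ℕ → ℕ) → ℕ
  | const c, _ => c
  | reg i, r => r i
  | load a t, r => ar a (t.eval ar r)
  | op o t u, r => o.eval (t.eval ar r) (u.eval ar r)
  | ite c t u, r => if c.eval ar r ≠ 0 then t.eval ar r else u.eval ar r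
  | sum x t, r => ∑ v ∈ Finset.range (r 2), t.eval ar (Function.update r x v)
  | prod x t, r => ∏ v ∈ Finset.range (r 2), t.eval ar (Function.update r x v)

/-- The registers that serve as summation variables in a term. -/
def bound : Tm → List ℕ
  | const _ => []
  | reg _ => []
  | load _ t => t.bound
  | op _ t u => t.bound ++ u.bound
  | ite c t u => c.bound ++ (t.bound ++ u.bound)
  | sum x t => x :: t.bound
  | prod x t => x :: t.bound

/-- The registers whose content the value of a term may depend on. -/
def free : Tm → List ℕ
  | const _ => []
  | reg i => [i]
  | load _ t => t.free
  | op _ t u => t.free ++ u.free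
  | ite c t u => c.free ++ (t.free ++ u.free)
  | sum x t => 2 :: t.free.filter (· ≠ x)
  | prod x t => 2 :: t.free.filter (· ≠ x)

/-- Well-formed terms: the constants are at most `2`, the summation variables lie in `[50, 100)`,
the other variables below `100`, and no summation variable of one part is free in another part that
is evaluated later. -/
def wf : Tm → Bool
  | const c => c ≤ 2
  | reg i => i < 100
  | load _ t => t.wf
  | op _ t u => t.wf && (u.wf && t.bound.all (· ∉ u.free))
  | ite c t u => c.wf && (t.wf && (u.wf && c.bound.all fun x => x ∉ t.free ∧ x ∉ u.free))
  | sum x t => (t.wf && t.free.all (· ∉ t.bound)) && (x ∉ t.bound && (50 ≤ x && x < 100))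
  | prod x t => (t.wf && t.free.all (· ∉ t.bound)) && (x ∉ t.bound && (50 ≤ x && x < 100))

/-- Exponent in the bound `A ^ K ^ t.vexp` of the value of a term `t` whose inputs are at most
`A`. -/
def vexp : Tm → ℕ
  | const _ => 0
  | reg _ => 0
  | load _ _ => 0
  | op _ t u => t.vexp + u.vexp + 1
  | ite _ t u => t.vexp + u.vexp
  | sum _ t => t.vexp + 1
  | prod _ t => t.vexp + 1

/-- Exponent in the bound `K ^ t.cexp` of the evaluation time of a term `t`. -/
def cexp : Tm → ℕ
  | const _ => 3
  | reg _ => 3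
  | load _ t => t.cexp + t.vexp + 6
  | op _ t u => t.cexp + u.cexp + t.vexp + u.vexp + 8
  | ite c t u => c.cexp + t.cexp + u.cexp + c.vexp + 5
  | sum _ t => t.cexp + 2 * t.vexp + 20
  | prod _ t => t.cexp + 2 * t.vexp + 20

/-- Evaluates a term into register `d`, using the registers above `d` for intermediate results. -/
def comp : Tm → ℕ → Cmd
  | const c, d => .assign d (.const c)
  | reg i, d => .assign d (.reg i)
  | load a t, d => .seq (t.comp d) (.assign d (.load a (.reg d)))
  | op o t u, d => .seq (t.comp d) (.seq (u.comp (d + 1)) (.assign d (.op o (.reg d) (.reg (d + 1)))))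
  | ite c t u, d => .seq (c.comp d) (.ite (.reg d) (t.comp d) (u.comp d))
  | sum x t, d => .seq (.assign d (.const 0)) (.seq (.assign x (.const 0))
      (.while (.op .lt (.reg x) (.reg 2)) (.seq
        (.seq (t.comp (d + 1)) (.assign d (.op .add (.reg d) (.reg (d + 1)))))
        (.assign x (.op .add (.reg x) (.const 1))))))
  | prod x t, d => .seq (.assign d (.const 1)) (.seq (.assign x (.const 0))
      (.while (.op .lt (.reg x) (.reg 2)) (.seq
        (.seq (t.comp (d + 1)) (.assign d (.op .mul (.reg d) (.reg (d + 1)))))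
        (.assign x (.op .add (.reg x) (.const 1))))))

theorem eval_congr (ar : ℕ → ℕ → ℕ) (t : Tm) {r r' : ℕ → ℕ} (h : ∀ i ∈ t.free, r i = r' i) :
    t.eval ar r = t.eval ar r' := by
  induction t generalizing r r' with
  | const => rfl
  | reg i => exact h i (by simp [free])
  | load a t ih => simp only [eval]; rw [ih h]
  | op o t u iht ihu =>
    simp only [free, List.mem_append] at h
    simp only [eval]
    rw [iht fun i hi => h i (.inl hi), ihu fun i hi => h i (.inr hi)]
  | ite c t u ihc iht ihu =>
    simp only [free, List.mem_append] at h
    simp only [eval]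
    rw [ihc fun i hi => h i (.inl hi), iht fun i hi => h i (.inr (.inl hi)),
      ihu fun i hi => h i (.inr (.inr hi))]
  | sum x t ih | prod x t ih =>
    simp only [free, List.mem_cons, List.mem_filter, decide_eq_true_eq] at h
    simp only [eval]
    rw [h 2 (.inl rfl)]
    refine Finset.fold_congr fun v _ => ih fun i hi => ?_
    by_cases hx : i = x
    · subst hx; simp
    · simp [hx, h i (.inr ⟨hi, by simpa using hx⟩)]

end Tm

/-- The parameters of the time bounds: words have `L` bits, all registers and cells contain numbers
of at most `A`, and numbers up to `A` occupy `O(K)` words. Intermediate values are bounded by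
`A ^ K ^ a` for a constant `a`, so that they occupy polynomially many words in `K`; the strict
inequalities between exponents below absorb constant factors by `2 ≤ K`. -/
structure Par (L A K : ℕ) : Prop where
  two_le : 2 ≤ K
  le : K ≤ A
  le_pow : A ≤ 2 ^ (L * K)
  pos : 1 ≤ L

namespace Par

variable {L A K : ℕ}

theorem one_le (P : Par L A K) : 1 ≤ K := P.two_le.trans' one_le_two

theorem pow_mono (P : Par L A K) {a b : ℕ} (h : a ≤ b) : K ^ a ≤ K ^ b :=
  Nat.pow_le_pow_right P.one_le h

theorem add_le (P : Par L A K) {x y a b c : ℕ} (hx : x ≤ K ^ a) (hy : y ≤ K ^ b) (ha : a < c)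
    (hb : b < c) : x + y ≤ K ^ c := by
  obtain ⟨c, rfl⟩ : ∃ d, c = d + 1 := ⟨c - 1, by omega⟩
  have h1 := hx.trans (P.pow_mono (Nat.le_of_lt_succ ha))
  have h2 := hy.trans (P.pow_mono (Nat.le_of_lt_succ hb))
  calc x + y ≤ K ^ c * 2 := by omega
    _ ≤ K ^ (c + 1) := by rw [pow_succ]; exact Nat.mul_le_mul_left _ P.two_le

theorem one_add_le (P : Par L A K) {x a : ℕ} (hx : x ≤ K ^ a) : 1 + x ≤ K ^ (a + 1) :=
  P.add_le (a := 0) (by simp) hx (by omega) (by omega)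

theorem mul_le (_ : Par L A K) {x y a b : ℕ} (hx : x ≤ K ^ a) (hy : y ≤ K ^ b) :
    x * y ≤ K ^ (a + b) := by
  rw [pow_add]; exact Nat.mul_le_mul hx hy

theorem two_le_A (P : Par L A K) : 2 ≤ A := P.two_le.trans P.le

theorem words_le (P : Par L A K) {x a : ℕ} (hx : x ≤ A ^ K ^ a) : words L x ≤ K ^ (a + 2) := by
  have h1 : x ≤ 2 ^ (L * (K * K ^ a)) := by
    rw [← mul_assoc, pow_mul]; exact hx.trans (Nat.pow_le_pow_left P.le_pow _)
  have h2 : Nat.size x ≤ L * (K * K ^ a) + 1 := by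
    rw [Nat.size_le, pow_succ]; have := Nat.two_pow_pos (L * (K * K ^ a)); omega
  have hL := P.pos
  have h3 : Nat.size x / L ≤ K ^ (a + 1) + 1 := by
    calc Nat.size x / L ≤ (L * (K * K ^ a) + L) / L := Nat.div_le_div_right (by omega)
      _ = K ^ (a + 1) + 1 := by
        rw [← Nat.mul_succ, Nat.mul_div_cancel_left _ hL, pow_succ, mul_comm K]
  have h4 : 2 ≤ K ^ (a + 1) := P.two_le.trans (by simpa using P.pow_mono (show 1 ≤ a + 1 by omega))
  calc words L x ≤ K ^ (a + 1) * 2 := by unfold words; omega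
    _ ≤ _ := by rw [pow_succ K (a + 1)]; exact Nat.mul_le_mul_left _ P.two_le

theorem words_le_of_le (P : Par L A K) {x : ℕ} (hx : x ≤ A) : words L x ≤ K ^ 2 :=
  P.words_le (a := 0) (by simpa using hx)

theorem A_pow_mono (P : Par L A K) {a b : ℕ} (h : a ≤ b) : A ^ K ^ a ≤ A ^ K ^ b :=
  Nat.pow_le_pow_right (P.two_le_A.trans' one_le_two) (P.pow_mono h)

theorem le_A_pow (P : Par L A K) {x a : ℕ} (hx : x ≤ A) : x ≤ A ^ K ^ a :=
  hx.trans ((P.A_pow_mono (Nat.zero_le a)).trans' (by simp))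

theorem mul_le_A (P : Par L A K) {x y a b : ℕ} (hx : x ≤ A ^ K ^ a) (hy : y ≤ A ^ K ^ b) :
    x * y ≤ A ^ K ^ (a + b + 1) := by
  calc x * y ≤ A ^ K ^ a * A ^ K ^ b := Nat.mul_le_mul hx hy
    _ = A ^ (K ^ a + K ^ b) := (pow_add ..).symm
    _ ≤ _ := Nat.pow_le_pow_right (P.two_le_A.trans' one_le_two)
      (P.add_le le_rfl le_rfl (by omega) (by omega))

theorem two_le_A_pow (P : Par L A K) (a : ℕ) : 2 ≤ A ^ K ^ a := P.le_A_pow P.two_le_A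

theorem op_le (P : Par L A K) (o : Op) {x y a b : ℕ} (hx : x ≤ A ^ K ^ a) (hy : y ≤ A ^ K ^ b) :
    o.eval x y ≤ A ^ K ^ (a + b + 1) := by
  have hx' := hx.trans (P.A_pow_mono (show a ≤ a + b + 1 by omega))
  have h2 := P.two_le_A_pow (a + b + 1)
  cases o with
  | add =>
    have h1 : x + y ≤ A ^ K ^ a * A ^ K ^ b :=
      (Nat.add_le_add hx hy).trans (Nat.add_le_mul (P.two_le_A_pow a) (P.two_le_A_pow b))
    exact h1.trans (P.mul_le_A le_rfl le_rfl)
  | sub => exact (Nat.sub_le _ _).trans hx'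
  | mul => exact P.mul_le_A hx hy
  | div => exact (Nat.div_le_self _ _).trans hx'
  | mod => exact (Nat.mod_le _ _).trans hx'
  | lt | eq => simp only [Op.eval]; split <;> omega

/-- Time of an operation on two registers. -/
theorem cost_op_le (P : Par L A K) (o : Op) (s : State) {i j a b : ℕ} (hi : s.reg i ≤ A ^ K ^ a)
    (hj : s.reg j ≤ A ^ K ^ b) :
    1 + Expr.cost L s (.op o (.reg i) (.reg j)) ≤ K ^ (a + b + 6) := by
  have h1 := P.one_add_le (P.words_le hi)
  have h2 := P.one_add_le (P.words_le hj)
  refine (P.mul_le h1 h2).trans' ?_ |>.trans (P.pow_mono (by omega))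
  simp only [Expr.cost, Expr.eval]
  apply le_of_eq; ring

end Par

/-- A loop that lets the register `x` run through all numbers below the content `N` of the register
`b`. The invariant `I j` holds before iteration `j`, which takes time `τ j`, and `γ` bounds the number
of words of the counter. -/
theorem exec_for {L x b γ : ℕ} {body : Cmd} (N : ℕ) (τ : ℕ → ℕ) (I : ℕ → State → Prop) (s : State)
    (hx : s.reg x = 0) (hb : s.reg b = N) (h0 : I 0 s) (hxb : x ≠ b)
    (hγ : ∀ j ≤ N, words L j ≤ γ) (hγ1 : words L 1 ≤ γ)
    (hbody : ∀ j < N, ∀ s, I j s → s.reg x = j → s.reg b = N → ∃ s' T, Exec L body s s' T ∧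
      T ≤ τ j ∧ s'.reg x = j ∧ s'.reg b = N ∧
      I (j + 1) { s' with reg := Function.update s'.reg x (j + 1) }) :
    ∃ s' T, Exec L (.while (.op .lt (.reg x) (.reg b))
        (.seq body (.assign x (.op .add (.reg x) (.const 1))))) s s' T ∧
      I N s' ∧ s'.reg x = N ∧ T ≤ ∑ j ∈ Finset.range N, (τ j + 2 * (1 + γ) ^ 2) + (1 + γ) ^ 2 := by
  have cost : ∀ j ≤ N, ∀ s : State, s.reg x = j → s.reg b = N →
      1 + Expr.cost L s (.op .lt (.reg x) (.reg b)) ≤ (1 + γ) ^ 2 := by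
    intro j hj s h1 h2
    simp only [Expr.cost, Expr.eval, h1, h2]
    have a1 := hγ j hj
    have a2 := hγ N le_rfl
    have a3 := Nat.mul_le_mul a1 a2
    nlinarith
  suffices H : ∀ i ≤ N, ∀ s, s.reg x = N - i → s.reg b = N → I (N - i) s →
      ∃ s' T, Exec L (.while (.op .lt (.reg x) (.reg b))
        (.seq body (.assign x (.op .add (.reg x) (.const 1))))) s s' T ∧
      I N s' ∧ s'.reg x = N ∧
      T ≤ ∑ j ∈ Finset.Ico (N - i) N, (τ j + 2 * (1 + γ) ^ 2) + (1 + γ) ^ 2 by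
    obtain ⟨s', T, h⟩ := H N le_rfl s (by simpa using hx) hb (by simpa using h0)
    exact ⟨s', T, by simpa using h⟩
  intro i
  induction i with
  | zero =>
    intro _ s h1 h2 h3
    refine ⟨s, _, .while_false ?_, h3, h1, ?_⟩
    · simp [Expr.eval, Op.eval, h1, h2]
    · simpa using cost N le_rfl s h1 h2
  | succ i ih =>
    intro hi s h1 h2 h3
    obtain ⟨s1, T1, e1, ht1, hx1, hb1, hI1⟩ := hbody _ (by omega) s h3 h1 h2
    obtain ⟨s2, T2, e2, hI2, hx2, ht2⟩ := ih (by omega)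
      { s1 with reg := Function.update s1.reg x (N - (i + 1) + 1) } (by simp; omega)
      (by simp [hxb.symm, hb1]) (by rwa [show N - i = N - (i + 1) + 1 by omega])
    have e3 := Exec.assign (L := L) x (.op .add (.reg x) (.const 1)) s1
    simp only [Expr.eval, Op.eval, hx1] at e3
    refine ⟨s2, _, .while_true ?_ (.seq e1 e3) e2, hI2, hx2, ?_⟩
    · simp only [Expr.eval, Op.eval, h1, h2]; rw [if_pos (by omega)]; simp
    · have c1 := cost _ (by omega) s h1 h2
      have c2 : 1 + Expr.cost L s1 (.op .add (.reg x) (.const 1)) ≤ (1 + γ) ^ 2 := by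
        simp only [Expr.cost, Expr.eval, hx1]
        have a1 := hγ (N - (i + 1)) (by omega)
        have a3 := Nat.mul_le_mul a1 hγ1
        nlinarith
      rw [Finset.sum_Ico_eq_sum_range] at ht2 ⊢
      have e5 : N - (N - (i + 1)) = N - (N - i) + 1 := by omega
      rw [e5, Finset.sum_range_succ', add_zero]
      have e4 : ∀ k, N - (i + 1) + (k + 1) = N - i + k := by intro k; omega
      simp only [e4]
      omega

namespace Tm

variable {L A K : ℕ}

theorem update_le (P : Par L A K) {t : Tm} {x : ℕ} {r : ℕ → ℕ}
    (hr : ∀ i ∈ (sum x t).free, r i ≤ A) (h2 : r 2 ≤ K) {v : ℕ} (hv : v < r 2) :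
    ∀ i ∈ t.free, Function.update r x v i ≤ A := by
  simp only [free, List.mem_cons, List.mem_filter, decide_eq_true_eq] at hr
  intro i hi
  by_cases hx : i = x
  · subst hx; simp only [Function.update_self]; exact (hv.le.trans h2).trans P.le
  · rw [Function.update_of_ne hx]; exact hr i (.inr ⟨hi, by simpa using hx⟩)

theorem prod_le (P : Par L A K) {f : ℕ → ℕ} {e j : ℕ} (hj : j ≤ K)
    (hf : ∀ v < j, f v ≤ A ^ K ^ e) : ∏ v ∈ Finset.range j, f v ≤ A ^ K ^ (e + 1) := by
  calc _ ≤ (A ^ K ^ e) ^ j := by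
        refine (Finset.prod_le_pow_card _ _ (A ^ K ^ e)
          fun v hv => hf v (Finset.mem_range.1 hv)).trans (by simp)
    _ ≤ (A ^ K ^ e) ^ K := Nat.pow_le_pow_right (by have := P.two_le_A_pow e; omega) hj
    _ = _ := by rw [← pow_mul, pow_succ]

theorem eval_le (P : Par L A K) {ar : ℕ → ℕ → ℕ} (har : ∀ a x, ar a x ≤ A) (t : Tm)
    (hwf : t.wf) {r : ℕ → ℕ} (hr : ∀ i ∈ t.free, r i ≤ A) (h2 : r 2 ≤ K) :
    t.eval ar r ≤ A ^ K ^ t.vexp := by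
  induction t generalizing r with
  | const c =>
    simp only [wf, decide_eq_true_eq] at hwf
    exact (hwf.trans (P.two_le_A_pow _))
  | reg i => exact P.le_A_pow (hr i (by simp [free]))
  | load a t ih => exact P.le_A_pow (har _ _)
  | op o t u iht ihu =>
    simp only [free, List.mem_append] at hr
    simp only [wf, Bool.and_eq_true] at hwf
    exact P.op_le o (iht hwf.1 (fun i hi => hr i (.inl hi)) h2)
      (ihu hwf.2.1 (fun i hi => hr i (.inr hi)) h2)
  | ite c t u ihc iht ihu =>
    simp only [free, List.mem_append] at hr
    simp only [wf, Bool.and_eq_true] at hwf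
    simp only [eval, vexp]
    split
    · exact (iht hwf.2.1 (fun i hi => hr i (.inr (.inl hi))) h2).trans (P.A_pow_mono (by omega))
    · exact (ihu hwf.2.2.1 (fun i hi => hr i (.inr (.inr hi))) h2).trans (P.A_pow_mono (by omega))
  | sum x t ih =>
    simp only [wf, Bool.and_eq_true] at hwf
    simp only [eval, vexp]
    calc _ ≤ r 2 * A ^ K ^ t.vexp := by
          refine (Finset.sum_le_card_nsmul _ _ (A ^ K ^ t.vexp)
            fun v hv => ih hwf.1.1 ?_ ?_).trans (by simp)
          · exact update_le P hr h2 (Finset.mem_range.1 hv)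
          · rw [Function.update_of_ne (by simp at hwf; omega)]; exact h2
      _ ≤ _ := by
        simpa using P.mul_le_A (a := 0) (by simpa using h2.trans P.le) (le_refl (A ^ K ^ t.vexp))
  | prod x t ih =>
    simp only [wf, Bool.and_eq_true] at hwf
    refine prod_le P h2 fun v hv => ih hwf.1.1 ?_ ?_
    · exact update_le P hr h2 hv
    · rw [Function.update_of_ne (by simp at hwf; omega)]; exact h2

theorem le_bound (t : Tm) (hwf : t.wf) : ∀ i ∈ t.bound, 50 ≤ i := by
  induction t <;> simp_all [wf, bound, or_imp, forall_and]

theorem bound_lt (t : Tm) (hwf : t.wf) : ∀ i ∈ t.bound, i < 100 := by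
  induction t <;> simp_all [wf, bound, or_imp, forall_and]

theorem free_lt (t : Tm) (hwf : t.wf) : ∀ i ∈ t.free, i < 100 := by
  induction t with
  | const | load => simp_all [wf, free]
  | reg => simp_all [wf, free]
  | op | ite => simp_all [wf, free, or_imp, forall_and]
  | sum x t ih | prod x t ih =>
    simp only [wf, Bool.and_eq_true] at hwf
    simp only [free, List.mem_cons, List.mem_filter]
    rintro i (rfl | hi)
    · omega
    · exact ih hwf.1.1 i hi.1

/-- What it means that the code of `t` with target register `d` is correct and fast. -/
def Correct (L A K : ℕ) (t : Tm) (d : ℕ) : Prop :=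
  ∀ s : State, (∀ a x, s.arr a x ≤ A) → (∀ i ∈ t.free, s.reg i ≤ A) → s.reg 2 ≤ K →
    ∃ s' T, Exec L (t.comp d) s s' T ∧ T ≤ K ^ t.cexp ∧ s'.arr = s.arr ∧
      s'.reg d = t.eval s.arr s.reg ∧ ∀ i < d, i ∉ t.bound → s'.reg i = s.reg i

theorem fold_exec (P : Par L A K) (t : Tm) (hwf : t.wf) (x d c : ℕ) (o : Op) (F : ℕ → ℕ)
    (hd : 100 ≤ d) (hc : c ≤ 2) (hx : x ∉ t.bound) (hx50 : 50 ≤ x) (hx100 : x < 100)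
    (hb2 : 2 ∉ t.bound) (ih : Correct L A K t (d + 1)) (s : State) (har : ∀ a x, s.arr a x ≤ A)
    (hr : ∀ i ∈ (sum x t).free, s.reg i ≤ A) (h2 : s.reg 2 ≤ K) (hF0 : F 0 = c)
    (hF : ∀ j < s.reg 2, F (j + 1) = o.eval (F j) (t.eval s.arr (Function.update s.reg x j)))
    (hFA : ∀ j ≤ s.reg 2, F j ≤ A ^ K ^ (t.vexp + 1)) (hfb : ∀ i ∈ t.free, i ∉ t.bound)
    (hf100 : ∀ i ∈ t.free, i < 100) :
    ∃ s' T, Exec L (.seq (.assign d (.const c)) (.seq (.assign x (.const 0))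
      (.while (.op .lt (.reg x) (.reg 2)) (.seq
        (.seq (t.comp (d + 1)) (.assign d (.op o (.reg d) (.reg (d + 1)))))
        (.assign x (.op .add (.reg x) (.const 1))))))) s s' T ∧
      T ≤ K ^ (t.cexp + 2 * t.vexp + 20) ∧ s'.arr = s.arr ∧
      s'.reg d = F (s.reg 2) ∧ ∀ i < d, i ∉ x :: t.bound → s'.reg i = s.reg i := by
  set N := s.reg 2 with hN
  have e1 := Exec.assign (L := L) d (.const c) s
  set s1 : State := { s with reg := Function.update s.reg d c } with hs1
  have e2 := Exec.assign (L := L) x (.const 0) s1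
  set s2 : State := { s1 with reg := Function.update s1.reg x 0 } with hs2
  have hxd : x ≠ d := by omega
  have wA : ∀ j ≤ A, words L j ≤ K ^ 2 := fun j => P.words_le_of_le
  obtain ⟨s3, T3, e3, ⟨ha3, hd3, hr3⟩, hx3, ht3⟩ := exec_for (L := L) (x := x) (b := 2) (γ := K ^ 2)
    (body := .seq (t.comp (d + 1)) (.assign d (.op o (.reg d) (.reg (d + 1))))) N
    (fun _ => K ^ t.cexp + K ^ (2 * t.vexp + 7))
    (fun j s' => s'.arr = s.arr ∧ s'.reg d = F j ∧ ∀ i < d, i ∉ x :: t.bound → s'.reg i = s.reg i)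
    s2 (by simp [hs2]) (by simp [hs2, hs1]; rw [Function.update_of_ne (by omega),
      Function.update_of_ne (by omega)]) ⟨rfl, by simp [hs2, hs1, hxd.symm, hF0], by
        intro i hi hix
        simp only [List.mem_cons, not_or] at hix
        simp [hs2, hs1, hix.1, hi.ne]⟩ (by omega)
    (fun j hj => wA j ((hj.trans h2).trans P.le)) (wA 1 (by have := P.two_le_A; omega)) (by
      rintro j hj s' ⟨i1, i2, i3⟩ i4 i5
      have hfr : ∀ i ∈ t.free, s'.reg i = Function.update s.reg x j i := by
        intro i hi
        by_cases hix : i = x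
        · subst hix; simp [i4]
        · rw [Function.update_of_ne hix]
          exact i3 i ((hf100 i hi).trans_le hd) (by simp [hix, hfb i hi])
      obtain ⟨s4, T4, e4, t4, a4, v4, f4⟩ := ih s' (by rw [i1]; exact har) (fun i hi => by
        rw [hfr i hi]; exact update_le P hr h2 hj i hi) (by omega)
      have hval : t.eval s'.arr s'.reg = t.eval s.arr (Function.update s.reg x j) := by
        rw [i1]; exact eval_congr _ _ hfr
      have hvle : t.eval s.arr (Function.update s.reg x j) ≤ A ^ K ^ t.vexp := by
        refine eval_le P har t hwf (update_le P hr h2 hj) ?_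
        rw [Function.update_of_ne (by omega)]; exact h2
      have hd4 : s4.reg d = F j := by
        rw [f4 d (by omega), i2]
        intro hdb
        have := bound_lt t hwf d hdb
        omega
      have e5 := Exec.assign (L := L) d (.op o (.reg d) (.reg (d + 1))) s4
      simp only [Expr.eval, hd4, v4, hval, ← hF j hj] at e5
      refine ⟨_, _, .seq e4 e5, ?_, ?_, ?_, ?_⟩
      · refine Nat.add_le_add t4 ((P.cost_op_le o s4 (a := t.vexp + 1) (b := t.vexp) ?_ ?_).trans
          (P.pow_mono (by omega)))
        · rw [hd4]; exact hFA j hj.le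
        · rw [v4, hval]; exact hvle
      · simp only [Function.update_of_ne hxd]
        rw [f4 x (by omega) hx, i4]
      · simp only [Function.update_of_ne (show 2 ≠ d by omega)]
        rw [f4 2 (by omega) hb2, i5]
      · refine ⟨a4.trans i1, by simp [hxd.symm], fun i hi hix => ?_⟩
        have := hix
        simp only [List.mem_cons, not_or] at this
        dsimp only
        rw [Function.update_of_ne this.1, Function.update_of_ne hi.ne,
          f4 i (by omega) this.2, i3 i hi hix])
  refine ⟨s3, _, .seq e1 (.seq e2 e3), ?_, ha3, hd3, hr3⟩
  have hcA := wA c (hc.trans P.two_le_A)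
  have h0A := wA 0 (by omega)
  have q1 := P.one_add_le hcA
  have q2 := P.one_add_le h0A
  have q3 : (1 + K ^ 2) ^ 2 ≤ K ^ 6 := by
    calc (1 + K ^ 2) ^ 2 ≤ (K ^ 3) ^ 2 := Nat.pow_le_pow_left (P.one_add_le le_rfl) 2
      _ = K ^ 6 := by rw [← pow_mul]
  have q4 : 2 * (1 + K ^ 2) ^ 2 ≤ K ^ 7 := by
    rw [two_mul]; exact P.add_le q3 q3 (by omega) (by omega)
  set v := t.vexp
  set e := t.cexp
  have q5 : K ^ e + K ^ (2 * v + 7) + 2 * (1 + K ^ 2) ^ 2 ≤ K ^ (e + 2 * v + 9) :=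
    P.add_le (P.add_le le_rfl le_rfl (show e < e + 2 * v + 8 by omega) (by omega)) q4 (by omega)
      (by omega)
  have q6 : ∑ j ∈ Finset.range N, (K ^ e + K ^ (2 * v + 7) + 2 * (1 + K ^ 2) ^ 2)
      ≤ K ^ (e + 2 * v + 10) := by
    rw [Finset.sum_const, Finset.card_range, smul_eq_mul, pow_succ _ (_ + 9), mul_comm _ K]
    exact Nat.mul_le_mul h2 q5
  have q7 := ht3.trans (P.add_le q6 q3 (show _ < e + 2 * v + 11 by omega) (by omega))
  have q8 := P.add_le q2 q7 (show _ < e + 2 * v + 12 by omega) (by omega)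
  have q9 := P.add_le q1 q8 (show _ < e + 2 * v + 20 by omega) (by omega)
  simpa only [Expr.cost] using q9

/-- The code of a well-formed term computes its value, in time polynomial in `K`. -/
theorem correct (P : Par L A K) (t : Tm) (hwf : t.wf) (d : ℕ) (hd : 100 ≤ d) :
    t.Correct L A K d := by
  induction t generalizing d with
  | const c =>
    intro s har hr h2
    simp only [wf, decide_eq_true_eq] at hwf
    refine ⟨_, _, .assign _ _ _, ?_, rfl, by simp [Expr.eval, eval], fun i hi _ => by simp [hi.ne]⟩
    exact P.one_add_le (P.words_le_of_le (hwf.trans P.two_le_A))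
  | reg i =>
    intro s har hr h2
    refine ⟨_, _, .assign _ _ _, ?_, rfl, by simp [Expr.eval, eval], fun i hi _ => by simp [hi.ne]⟩
    exact P.one_add_le (P.words_le_of_le (hr i (by simp [free])))
  | load a t ih =>
    intro s har hr h2
    simp only [wf] at hwf
    obtain ⟨s1, T1, e1, t1, a1, v1, f1⟩ := ih hwf d hd s har hr h2
    have hv := eval_le P har t hwf hr h2
    refine ⟨_, _, .seq e1 (.assign _ _ _), ?_, a1, by simp [Expr.eval, eval, a1, v1],
      fun i hi hib => by simp only [Function.update_of_ne hi.ne]; exact f1 i hi hib⟩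
    simp only [Expr.cost, Expr.eval, a1, v1, cexp]
    have w1 := P.words_le hv
    have w2 := P.words_le_of_le (har a (t.eval s.arr s.reg))
    have q := P.add_le (P.add_le w1 w1 (show _ < t.vexp + 3 by omega) (by omega)) w2
      (show _ < t.vexp + 4 by omega) (by omega)
    exact P.add_le t1 (P.one_add_le q) (by omega) (by omega)
  | op o t u iht ihu =>
    intro s har hr h2
    simp only [free, List.mem_append] at hr
    simp only [wf, Bool.and_eq_true, List.all_eq_true, decide_eq_true_eq] at hwf
    obtain ⟨wt, wu, hdis⟩ := hwf
    obtain ⟨s1, T1, e1, t1, a1, v1, f1⟩ := iht wt d hd s har (fun i hi => hr i (.inl hi)) h2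
    have hu : ∀ i ∈ u.free, s1.reg i = s.reg i := fun i hi =>
      f1 i ((free_lt u wu i hi).trans_le hd) (fun hb => hdis i hb hi)
    have h21 : s1.reg 2 = s.reg 2 := f1 2 (by omega) (fun hb => by
      have := le_bound t wt 2 hb; omega)
    obtain ⟨s2, T2, e2, t2, a2, v2, f2⟩ := ihu wu (d + 1) (by omega) s1 (by rw [a1]; exact har)
      (fun i hi => by rw [hu i hi]; exact hr i (.inr hi)) (by rw [h21]; exact h2)
    have hv2 : u.eval s1.arr s1.reg = u.eval s.arr s.reg := by rw [a1]; exact eval_congr _ _ hu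
    have hd2 : s2.reg d = t.eval s.arr s.reg := by
      rw [f2 d (by omega) (fun hb => by have := bound_lt u wu d hb; omega), v1]
    have hvt := eval_le P har t wt (fun i hi => hr i (.inl hi)) h2
    have hvu := eval_le P har u wu (fun i hi => hr i (.inr hi)) h2
    refine ⟨_, _, .seq e1 (.seq e2 (.assign _ _ _)), ?_, a2.trans a1,
      by simp [Expr.eval, eval, v2, hv2, hd2], fun i hi hib => ?_⟩
    · have q := P.cost_op_le o s2 (i := d) (j := d + 1) (by rw [hd2]; exact hvt)
        (by rw [v2, hv2]; exact hvu)
      exact P.add_le t1 (P.add_le t2 q (show _ < u.cexp + t.vexp + u.vexp + 7 by omega) (by omega))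
        (by simp only [cexp]; omega) (by simp only [cexp]; omega)
    · simp only [bound, List.mem_append, not_or] at hib
      simp only [Function.update_of_ne hi.ne]
      rw [f2 i (by omega) hib.2, f1 i hi hib.1]
  | ite c t u ihc iht ihu =>
    intro s har hr h2
    simp only [free, List.mem_append] at hr
    simp only [wf, Bool.and_eq_true, List.all_eq_true, decide_eq_true_eq] at hwf
    obtain ⟨wc, wt, wu, hdis⟩ := hwf
    obtain ⟨s1, T1, e1, t1, a1, v1, f1⟩ := ihc wc d hd s har (fun i hi => hr i (.inl hi)) h2
    have ht : ∀ i ∈ t.free, s1.reg i = s.reg i := fun i hi =>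
      f1 i ((free_lt t wt i hi).trans_le hd) (fun hb => (hdis i hb).1 hi)
    have hu : ∀ i ∈ u.free, s1.reg i = s.reg i := fun i hi =>
      f1 i ((free_lt u wu i hi).trans_le hd) (fun hb => (hdis i hb).2 hi)
    have h21 : s1.reg 2 = s.reg 2 := f1 2 (by omega) (fun hb => by
      have := le_bound c wc 2 hb; omega)
    have hvc := P.words_le (eval_le P har c wc (fun i hi => hr i (.inl hi)) h2)
    rw [← v1] at hvc
    have q1 := P.one_add_le hvc
    by_cases hz : c.eval s.arr s.reg = 0
    · obtain ⟨s2, T2, e2, t2, a2, v2, f2⟩ := ihu wu d hd s1 (by rw [a1]; exact har)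
        (fun i hi => by rw [hu i hi]; exact hr i (.inr (.inr hi))) (by rw [h21]; exact h2)
      refine ⟨_, _, .seq e1 (.ite_false (by simp [Expr.eval, v1, hz]) e2), ?_, a2.trans a1, ?_, ?_⟩
      · simp only [Expr.cost]
        exact P.add_le t1 (P.add_le q1 t2 (show _ < c.cexp + t.cexp + u.cexp + c.vexp + 4 by omega)
          (by omega)) (by simp only [cexp]; omega) (by simp only [cexp]; omega)
      · rw [v2, a1, eval_congr _ _ hu]; simp [eval, hz]
      · intro i hi hib
        simp only [bound, List.mem_append, not_or] at hib
        rw [f2 i hi hib.2.2, f1 i hi hib.1]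
    · obtain ⟨s2, T2, e2, t2, a2, v2, f2⟩ := iht wt d hd s1 (by rw [a1]; exact har)
        (fun i hi => by rw [ht i hi]; exact hr i (.inr (.inl hi))) (by rw [h21]; exact h2)
      refine ⟨_, _, .seq e1 (.ite_true (by simp [Expr.eval, v1, hz]) e2), ?_, a2.trans a1, ?_, ?_⟩
      · simp only [Expr.cost]
        exact P.add_le t1 (P.add_le q1 t2 (show _ < c.cexp + t.cexp + u.cexp + c.vexp + 4 by omega)
          (by omega)) (by simp only [cexp]; omega) (by simp only [cexp]; omega)
      · rw [v2, a1, eval_congr _ _ ht]; simp [eval, hz]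
      · intro i hi hib
        simp only [bound, List.mem_append, not_or] at hib
        rw [f2 i hi hib.2.1, f1 i hi hib.1]
  | sum x t ih =>
    intro s har hr h2
    have hev : ∀ j ≤ s.reg 2, ∑ v ∈ Finset.range j, t.eval s.arr (Function.update s.reg x v) ≤
        A ^ K ^ (t.vexp + 1) := fun j hj =>
      (Finset.sum_le_sum_of_subset (Finset.range_mono hj)).trans
        (eval_le P har (.sum x t) hwf hr h2)
    simp only [wf, Bool.and_eq_true, decide_eq_true_eq, List.all_eq_true] at hwf
    obtain ⟨⟨wt, hfb⟩, hx, hx1, hx2⟩ := hwf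
    exact fold_exec P t wt x d 0 .add
      (fun j => ∑ v ∈ Finset.range j, t.eval s.arr (Function.update s.reg x v)) hd (by omega)
      hx hx1 hx2 (fun hb => by have := le_bound t wt 2 hb; omega)
      (ih wt (d + 1) (by omega)) s har hr h2 rfl
      (fun j _ => Finset.sum_range_succ _ _) hev hfb (free_lt t wt)
  | prod x t ih =>
    intro s har hr h2
    simp only [wf, Bool.and_eq_true, decide_eq_true_eq, List.all_eq_true] at hwf
    obtain ⟨⟨wt, hfb⟩, hx, hx1, hx2⟩ := hwf
    refine fold_exec P t wt x d 1 .mul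
      (fun j => ∏ v ∈ Finset.range j, t.eval s.arr (Function.update s.reg x v)) hd (by omega)
      hx hx1 hx2 (fun hb => by have := le_bound t wt 2 hb; omega)
      (ih wt (d + 1) (by omega)) s har hr h2 rfl
      (fun j _ => Finset.prod_range_succ _ _) (fun j hj => ?_) hfb (free_lt t wt)
    refine prod_le P (hj.trans h2) fun v hv => eval_le P har t wt (update_le P hr h2 (by omega)) ?_
    rw [Function.update_of_ne (by omega)]; exact h2

end Tm
end WordRAM

namespace WordRAM

/-! ### Programs with bounded loops -/

/-- Writes `v` to register `i`. -/
def State.set (s : State) (i v : ℕ) : State := { s with reg := Function.update s.reg i v }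

/-- Writes `v` to the cell `x` of array `a`. -/
def State.upd (s : State) (a x v : ℕ) : State :=
  { s with arr := Function.update s.arr a (Function.update (s.arr a) x v) }

@[simp] theorem State.set_reg (s : State) (i v j : ℕ) :
    (s.set i v).reg j = if j = i then v else s.reg j := by
  simp [State.set, Function.update_apply]

@[simp] theorem State.set_arr (s : State) (i v : ℕ) : (s.set i v).arr = s.arr := rfl

@[simp] theorem State.upd_reg (s : State) (a x v : ℕ) : (s.upd a x v).reg = s.reg := rfl

theorem State.upd_arr (s : State) (a x v b y : ℕ) :
    (s.upd a x v).arr b y = if b = a ∧ y = x then v else s.arr b y := by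
  simp only [State.upd, Function.update_apply]
  by_cases h : b = a
  · subst h; simp [Function.update_apply]
  · simp [h]

/-- The value of a term in a state. -/
def Tm.val (t : Tm) (s : State) : ℕ := t.eval s.arr s.reg

/-- Programs that compute with terms and whose only loops are bounded: `loop x b p` runs `p` for
all values of the register `x` below the content of the register `b`. -/
inductive HCmd
  | skip
  | assign (r : ℕ) (t : Tm)
  | store (a : ℕ) (t u : Tm)
  | seq (p q : HCmd)
  | ite (t : Tm) (p q : HCmd)
  | loop (x b : ℕ) (p : HCmd)

/-- The result of the first `n` iterations of a loop with body `f`. -/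
def iter (f : ℕ → State → State) : ℕ → State → State
  | 0, s => s
  | n + 1, s => f n (iter f n s)

namespace HCmd

/-- The final state of a program. -/
def run : HCmd → State → State
  | skip, s => s
  | assign r t, s => s.set r (t.val s)
  | store a t u, s => s.upd a (t.val s) (u.val s)
  | seq p q, s => q.run (p.run s)
  | ite t p q, s => if t.val s ≠ 0 then p.run s else q.run s
  | loop x b p, s => (iter (fun j s => p.run (s.set x j)) (s.reg b) s).set x (s.reg b)

/-- The number of steps of a program, where each evaluation of a term is one step. -/
def steps : HCmd → State → ℕ
  | skip, _ => 1
  | assign _ _, _ => 1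
  | store _ _ _, _ => 1
  | seq p q, s => p.steps s + q.steps (p.run s)
  | ite t p q, s => 1 + if t.val s ≠ 0 then p.steps s else q.steps s
  | loop x b p, s => 1 + ∑ j ∈ Finset.range (s.reg b),
      (1 + p.steps ((iter (fun j s => p.run (s.set x j)) j s).set x j))

/-- A run is safe if all values that it stores are at most `A`, and at most `K` in register `2`. -/
def Safe (A K : ℕ) : HCmd → State → Prop
  | skip, _ => True
  | assign r t, s => t.val s ≤ A ∧ (r = 2 → t.val s ≤ K)
  | store _ _ u, s => u.val s ≤ A
  | seq p q, s => p.Safe A K s ∧ q.Safe A K (p.run s)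
  | ite t p q, s => if t.val s ≠ 0 then p.Safe A K s else q.Safe A K s
  | loop x b p, s => ∀ j < s.reg b,
      p.Safe A K ((iter (fun j s => p.run (s.set x j)) j s).set x j)

/-- The registers that a program writes to. -/
def wr : HCmd → List ℕ
  | skip => []
  | assign r _ => [r]
  | store _ _ _ => []
  | seq p q => p.wr ++ q.wr
  | ite _ p q => p.wr ++ q.wr
  | loop x _ p => x :: p.wr

/-- The arrays that a program writes to. -/
def wa : HCmd → List ℕ
  | skip => []
  | assign _ _ => []
  | store a _ _ => [a]
  | seq p q => p.wa ++ q.wa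
  | ite _ p q => p.wa ++ q.wa
  | loop _ _ p => p.wa

/-- Well-formed programs: the registers below `50` are used outside of sums and products, and the
body of a loop writes neither to the loop variable nor to its bound. -/
def wf : HCmd → Bool
  | skip => true
  | assign r t => r < 50 && (t.wf && t.free.all (· < 50))
  | store _ t u => (t.wf && t.free.all (· < 50)) && (u.wf && u.free.all (· < 50))
  | seq p q => p.wf && q.wf
  | ite t p q => (t.wf && t.free.all (· < 50)) && (p.wf && q.wf)
  | loop x b p => (x < 50 && b < 50) && (p.wf && (x ∉ p.wr && (b ∉ p.wr && (x ≠ b && x ≠ 2))))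

/-- Exponent in the bound of the time of a step. -/
def cexp : HCmd → ℕ
  | skip => 0
  | assign _ t => t.cexp + 4
  | store _ t u => t.cexp + u.cexp + t.vexp + 6
  | seq p q => p.cexp + q.cexp
  | ite t p q => t.cexp + t.vexp + p.cexp + q.cexp + 4
  | loop _ _ p => p.cexp + 9

/-- The program as a program of the machine. -/
def toCmd : HCmd → Cmd
  | skip => .skip
  | assign r t => .seq (t.comp 100) (.assign r (.reg 100))
  | store a t u => .seq (t.comp 100) (.seq (u.comp 101) (.store a (.reg 100) (.reg 101)))
  | seq p q => .seq p.toCmd q.toCmd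
  | ite t p q => .seq (t.comp 100) (.ite (.reg 100) p.toCmd q.toCmd)
  | loop x b p => .seq (.assign x (.const 0)) (.while (.op .lt (.reg x) (.reg b))
      (.seq p.toCmd (.assign x (.op .add (.reg x) (.const 1)))))

theorem iter_induction {f : ℕ → State → State} {n : ℕ} {s : State} (I : ℕ → State → Prop)
    (h0 : I 0 s) (h : ∀ j < n, ∀ s', I j s' → I (j + 1) (f j s')) {j : ℕ} (hj : j ≤ n) :
    I j (iter f j s) := by
  induction j with
  | zero => exact h0
  | succ j ih => exact h j hj _ (ih (by omega))

theorem run_reg (p : HCmd) (s : State) {i : ℕ} (hi : i ∉ p.wr) : (p.run s).reg i = s.reg i := by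
  induction p generalizing s with
  | skip => rfl
  | assign r t => simp only [wr, List.mem_singleton] at hi; simp [run, hi]
  | store => rfl
  | seq p q ihp ihq =>
    simp only [wr, List.mem_append, not_or] at hi
    simp only [run]; rw [ihq _ hi.2, ihp _ hi.1]
  | ite t p q ihp ihq =>
    simp only [wr, List.mem_append, not_or] at hi
    simp only [run]; split
    · exact ihp _ hi.1
    · exact ihq _ hi.2
  | loop x b p ih =>
    simp only [wr, List.mem_cons, not_or] at hi
    simp only [run, State.set_reg, if_neg hi.1]
    refine iter_induction (fun _ s' => s'.reg i = s.reg i) rfl (fun j _ s' hs' => ?_) le_rfl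
    rw [ih _ hi.2, State.set_reg, if_neg hi.1, hs']

theorem run_arr (p : HCmd) (s : State) {a : ℕ} (ha : a ∉ p.wa) : (p.run s).arr a = s.arr a := by
  induction p generalizing s with
  | skip => rfl
  | assign r t => rfl
  | store b t u =>
    simp only [wa, List.mem_singleton] at ha
    simp [run, State.upd, Function.update_of_ne ha]
  | seq p q ihp ihq =>
    simp only [wa, List.mem_append, not_or] at ha
    simp only [run]; rw [ihq _ ha.2, ihp _ ha.1]
  | ite t p q ihp ihq =>
    simp only [wa, List.mem_append, not_or] at ha
    simp only [run]; split
    · exact ihp _ ha.1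
    · exact ihq _ ha.2
  | loop x b p ih =>
    simp only [wa] at ha
    simp only [run, State.set_arr]
    refine iter_induction (fun _ s' => s'.arr a = s.arr a) rfl (fun j _ s' hs' => ?_) le_rfl
    rw [ih _ ha, State.set_arr, hs']

end HCmd

/-- Agreement up to the registers that are reserved for the evaluation of terms. -/
def Sim (s σ : State) : Prop := s.arr = σ.arr ∧ ∀ i < 50, s.reg i = σ.reg i

/-- All contents of the state of a program are at most `A`, and register `2` is at most `K`. -/
def Bdd (A K : ℕ) (σ : State) : Prop :=
  (∀ i < 50, σ.reg i ≤ A) ∧ (∀ a x, σ.arr a x ≤ A) ∧ σ.reg 2 ≤ K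

variable {L A K : ℕ}

/-- Evaluating a term changes neither the state of the program nor the intermediate results that are
stored below the target register. -/
theorem Tm.exec (P : Par L A K) (t : Tm) (hwf : t.wf) (hfr : ∀ i ∈ t.free, i < 50) (d : ℕ)
    (hd : 100 ≤ d) {s σ : State} (h : Sim s σ) (hB : Bdd A K σ) :
    ∃ s' T, Exec L (t.comp d) s s' T ∧ T ≤ K ^ t.cexp ∧ Sim s' σ ∧ s'.reg d = t.val σ ∧
      ∀ i < d, 100 ≤ i → s'.reg i = s.reg i := by
  have hf : ∀ i ∈ t.free, s.reg i = σ.reg i := fun i hi => h.2 i (hfr i hi)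
  obtain ⟨s', T, e, ht, ha, hv, hr⟩ := t.correct P hwf d hd s (by rw [h.1]; exact hB.2.1)
    (fun i hi => by rw [hf i hi]; exact hB.1 i (hfr i hi))
    (by rw [h.2 2 (by omega)]; exact hB.2.2)
  refine ⟨s', T, e, ht, ⟨ha.trans h.1, fun i hi => ?_⟩, ?_, fun i hi h100 => ?_⟩
  · rw [hr i (by omega) (fun hb => by have := t.le_bound hwf i hb; omega), h.2 i hi]
  · rw [hv, h.1]; exact t.eval_congr _ hf
  · exact hr i hi (fun hb => by have := t.bound_lt hwf i hb; omega)

theorem Tm.val_le (P : Par L A K) (t : Tm) (hwf : t.wf) (hfr : ∀ i ∈ t.free, i < 50) {σ : State}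
    (hB : Bdd A K σ) : t.val σ ≤ A ^ K ^ t.vexp :=
  t.eval_le P hB.2.1 hwf (fun i hi => hB.1 i (hfr i hi)) hB.2.2

theorem Sim.set {s σ : State} (h : Sim s σ) (r v : ℕ) : Sim (s.set r v) (σ.set r v) :=
  ⟨h.1, fun i hi => by simp [h.2 i hi]⟩

theorem Bdd.set {σ : State} (h : Bdd A K σ) {r v : ℕ} (hv : v ≤ A) (h2 : r = 2 → v ≤ K) :
    Bdd A K (σ.set r v) := by
  refine ⟨fun i hi => ?_, h.2.1, ?_⟩
  · simp only [State.set_reg]; split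
    · exact hv
    · exact h.1 i hi
  · simp only [State.set_reg]; split
    · exact h2 (by omega)
    · exact h.2.2

theorem Bdd.upd {σ : State} (h : Bdd A K σ) {a x v : ℕ} (hv : v ≤ A) : Bdd A K (σ.upd a x v) := by
  refine ⟨h.1, fun b y => ?_, h.2.2⟩
  rw [State.upd_arr]; split
  · exact hv
  · exact h.2.1 b y

/-- A safe run of a program with bounded loops is executed by the machine, and each step takes time
polynomial in `K`. -/
theorem HCmd.exec (P : Par L A K) (p : HCmd) (hwf : p.wf) {s σ : State} (h : Sim s σ)
    (hB : Bdd A K σ) (hS : p.Safe A K σ) :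
    ∃ s' T, Exec L p.toCmd s s' T ∧ Sim s' (p.run σ) ∧ Bdd A K (p.run σ) ∧
      T ≤ p.steps σ * K ^ p.cexp := by
  induction p generalizing s σ with
  | skip => exact ⟨s, 1, .skip s, h, hB, by simp [steps, cexp]⟩
  | assign r t =>
    simp only [wf, Bool.and_eq_true, decide_eq_true_eq, List.all_eq_true] at hwf
    obtain ⟨hr, wt, ft⟩ := hwf
    obtain ⟨s1, T1, e1, t1, h1, v1, -⟩ := t.exec P wt ft 100 le_rfl h hB
    refine ⟨_, _, .seq e1 (.assign _ _ _), ?_, hB.set hS.1 hS.2, ?_⟩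
    · simp only [Expr.eval, v1]; exact h1.set r (t.val σ)
    · simp only [steps, cexp, one_mul, Expr.cost, v1]
      exact P.add_le t1 (P.one_add_le (P.words_le_of_le hS.1)) (by omega) (by omega)
  | store a t u =>
    simp only [wf, Bool.and_eq_true, decide_eq_true_eq, List.all_eq_true] at hwf
    obtain ⟨⟨wt, ft⟩, wu, fu⟩ := hwf
    obtain ⟨s1, T1, e1, t1, h1, v1, -⟩ := t.exec P wt ft 100 le_rfl h hB
    obtain ⟨s2, T2, e2, t2, h2, v2, f2⟩ := u.exec P wu fu 101 (by omega) h1 hB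
    have v3 : s2.reg 100 = t.val σ := by rw [f2 100 (by omega) le_rfl, v1]
    refine ⟨_, _, .seq e1 (.seq e2 (.store _ _ _ _)), ?_, hB.upd hS, ?_⟩
    · simp only [Expr.eval, v2, v3, run, h2.1]
      exact ⟨rfl, h2.2⟩
    · simp only [steps, cexp, one_mul, Expr.cost, v2, v3]
      have q1 := P.one_add_le (P.words_le (t.val_le P wt ft hB))
      have q2 := P.words_le_of_le hS
      exact P.add_le t1 (P.add_le t2 (P.add_le q1 q2 (show _ < t.vexp + 4 by omega) (by omega))
        (show _ < u.cexp + t.vexp + 5 by omega) (by omega)) (by omega) (by omega)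
  | seq p q ihp ihq =>
    simp only [wf, Bool.and_eq_true] at hwf
    obtain ⟨s1, T1, e1, h1, b1, t1⟩ := ihp hwf.1 h hB hS.1
    obtain ⟨s2, T2, e2, h2, b2, t2⟩ := ihq hwf.2 h1 b1 hS.2
    refine ⟨s2, _, .seq e1 e2, h2, b2, ?_⟩
    simp only [steps, cexp, add_mul]
    exact Nat.add_le_add (t1.trans (Nat.mul_le_mul_left _ (P.pow_mono (by omega))))
      (t2.trans (Nat.mul_le_mul_left _ (P.pow_mono (by omega))))
  | ite t p q ihp ihq =>
    simp only [wf, Bool.and_eq_true, decide_eq_true_eq, List.all_eq_true] at hwf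
    obtain ⟨⟨wt, ft⟩, wp, wq⟩ := hwf
    obtain ⟨s1, T1, e1, t1, h1, v1, -⟩ := t.exec P wt ft 100 le_rfl h hB
    have q1 := P.one_add_le (P.words_le (t.val_le P wt ft hB))
    have q2 := P.add_le t1 q1
      (show _ < t.cexp + t.vexp + p.cexp + q.cexp + 4 by omega) (by omega)
    by_cases hz : t.val σ = 0
    · simp only [Safe, hz, ne_eq, not_true, if_false] at hS
      obtain ⟨s2, T2, e2, h2, b2, t2⟩ := ihq wq h1 hB hS
      refine ⟨s2, _, .seq e1 (.ite_false (by simp [Expr.eval, v1, hz]) e2), ?_, ?_, ?_⟩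
      · simpa [run, hz] using h2
      · simpa [run, hz] using b2
      · simp only [steps, cexp, add_mul, Expr.cost, v1, hz, one_mul, ne_eq, not_true, if_false]
        rw [hz] at q2
        rw [← add_assoc]
        exact Nat.add_le_add q2 (t2.trans (Nat.mul_le_mul_left _ (P.pow_mono (by omega))))
    · simp only [Safe, hz, ne_eq, not_false_eq_true, if_true] at hS
      obtain ⟨s2, T2, e2, h2, b2, t2⟩ := ihp wp h1 hB hS
      refine ⟨s2, _, .seq e1 (.ite_true (by simp [Expr.eval, v1, hz]) e2), ?_, ?_, ?_⟩
      · simpa [run, hz] using h2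
      · simpa [run, hz] using b2
      · simp only [steps, cexp, add_mul, Expr.cost, v1, hz, one_mul, ne_eq, not_false_eq_true,
          if_true]
        rw [← add_assoc]
        exact Nat.add_le_add q2 (t2.trans (Nat.mul_le_mul_left _ (P.pow_mono (by omega))))
  | loop x b p ih =>
    simp only [wf, Bool.and_eq_true, decide_eq_true_eq] at hwf
    obtain ⟨⟨hx, hb⟩, wp, hxw, hbw, hxb, hx2⟩ := hwf
    set N := σ.reg b with hN
    set st : ℕ → State := fun j => iter (fun j s => p.run (s.set x j)) j σ with hst
    have hNA : N ≤ A := hB.1 b hb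
    have wA : ∀ j ≤ A, words L j ≤ K ^ 2 := fun j => P.words_le_of_le
    have hreg : ∀ j, (st j).reg b = N := by
      intro j
      refine iter_induction (n := j) (fun _ s' => s'.reg b = N) rfl (fun j _ s' hs' => ?_) le_rfl
      rw [run_reg _ _ hbw, State.set_reg, if_neg hxb.symm, hs']
    have e1 := Exec.assign (L := L) x (.const 0) s
    obtain ⟨s', T, e2, ⟨h2, b2⟩, hx', t2⟩ := exec_for (L := L) (x := x) (b := b) (γ := K ^ 2)
      (body := p.toCmd) N (fun j => p.steps ((st j).set x j) * K ^ p.cexp)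
      (fun j s' => Sim s' ((st j).set x j) ∧ Bdd A K ((st j).set x j)) (s.set x 0) (by simp)
      (by simp [hxb.symm, h.2 b hb, hN]) ⟨h.set x 0, hB.set (by omega) (by omega)⟩ hxb
      (fun j hj => wA j (hj.trans hNA)) (wA 1 (by have := P.two_le_A; omega)) (by
        rintro j hj s' ⟨h', b'⟩ hx' hb'
        obtain ⟨s'', T'', e'', h'', b'', t''⟩ := ih wp h' b' (hS j hj)
        refine ⟨s'', T'', e'', t'', ?_, ?_, ?_, ?_⟩
        · rw [h''.2 x hx, run_reg _ _ hxw]; simp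
        · rw [h''.2 b hb, run_reg _ _ hbw]; simp [hxb.symm, hreg]
        · exact h''.set x (j + 1)
        · exact b''.set (by omega) (fun h => absurd h hx2))
    refine ⟨s', _, .seq e1 e2, h2, b2, ?_⟩
    have q0 := P.one_add_le (wA 0 (by omega))
    have q3 : (1 + K ^ 2) ^ 2 ≤ K ^ 6 := by
      calc (1 + K ^ 2) ^ 2 ≤ (K ^ 3) ^ 2 := Nat.pow_le_pow_left (P.one_add_le le_rfl) 2
        _ = K ^ 6 := by rw [← pow_mul]
    have q4 : 2 * (1 + K ^ 2) ^ 2 ≤ K ^ (p.cexp + 9) := by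
      rw [two_mul]; exact P.add_le q3 q3 (by omega) (by omega)
    simp only [steps, cexp, add_mul, Expr.cost, Finset.sum_mul, one_mul]
    have q5 : ∑ j ∈ Finset.range N, (p.steps ((st j).set x j) * K ^ p.cexp + 2 * (1 + K ^ 2) ^ 2) ≤
        ∑ j ∈ Finset.range N, (K ^ (p.cexp + 9) +
          p.steps ((st j).set x j) * K ^ (p.cexp + 9)) := by
      refine Finset.sum_le_sum fun j _ => ?_
      rw [add_comm]
      exact Nat.add_le_add q4 (Nat.mul_le_mul_left _ (P.pow_mono (by omega)))
    have q6 := P.add_le q0 q3 (show _ < p.cexp + 9 by omega) (by omega)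
    have := Nat.add_le_add q6 q5
    refine le_trans ?_ this
    omega

end WordRAM

namespace WordRAM

/-! ### Rules for reasoning about programs -/

/-- The run of `p` from `s` is safe, takes at most `τ` steps and ends in a state with property `Q`. -/
def Tri (A K : ℕ) (p : HCmd) (s : State) (τ : ℕ) (Q : State → Prop) : Prop :=
  p.Safe A K s ∧ p.steps s ≤ τ ∧ Q (p.run s)

/-- `s'` differs from `s` only in registers from `wr` and arrays from `wa`. -/
structure Frame (wr wa : List ℕ) (s s' : State) : Prop where
  reg : ∀ i, i ∉ wr → s'.reg i = s.reg i
  arr : ∀ a, a ∉ wa → s'.arr a = s.arr a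

namespace Tri

variable {A K : ℕ} {p q : HCmd} {s : State} {τ τ₁ τ₂ : ℕ} {Q R : State → Prop}

theorem mono (h : Tri A K p s τ₁ Q) (hτ : τ₁ ≤ τ) : Tri A K p s τ Q :=
  ⟨h.1, h.2.1.trans hτ, h.2.2⟩

theorem weaken (h : Tri A K p s τ R) (hQ : ∀ s', Frame p.wr p.wa s s' → R s' → Q s') :
    Tri A K p s τ Q :=
  ⟨h.1, h.2.1, hQ _ ⟨fun _ hi => p.run_reg s hi, fun _ ha => p.run_arr s ha⟩ h.2.2⟩

theorem skip (h : Q s) : Tri A K .skip s 1 Q := ⟨trivial, le_rfl, h⟩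

theorem assign {r : ℕ} {t : Tm} {v : ℕ} (hv : t.val s = v) (hA : v ≤ A) (hK : r = 2 → v ≤ K)
    (hQ : Q (s.set r v)) : Tri A K (.assign r t) s 1 Q := by
  subst hv; exact ⟨⟨hA, hK⟩, le_rfl, hQ⟩

theorem store {a : ℕ} {t u : Tm} {x v : ℕ} (hx : t.val s = x) (hv : u.val s = v) (hA : v ≤ A)
    (hQ : Q (s.upd a x v)) : Tri A K (.store a t u) s 1 Q := by
  subst hv hx; exact ⟨hA, le_rfl, hQ⟩

theorem seq (h₁ : Tri A K p s τ₁ R)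
    (h₂ : ∀ s', Frame p.wr p.wa s s' → R s' → Tri A K q s' τ₂ Q) :
    Tri A K (.seq p q) s (τ₁ + τ₂) Q := by
  have h := h₂ _ ⟨fun _ hi => p.run_reg s hi, fun _ ha => p.run_arr s ha⟩ h₁.2.2
  exact ⟨⟨h₁.1, h.1⟩, Nat.add_le_add h₁.2.1 h.2.1, h.2.2⟩

theorem seq_assign {r : ℕ} {t : Tm} {v : ℕ} (hv : t.val s = v) (hA : v ≤ A) (hK : r = 2 → v ≤ K)
    (h : Tri A K q (s.set r v) τ Q) : Tri A K (.seq (.assign r t) q) s (1 + τ) Q :=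
  (Tri.assign (Q := (· = s.set r v)) hv hA hK rfl).seq fun _ _ h' => h' ▸ h

theorem seq_store {a : ℕ} {t u : Tm} {x v : ℕ} (hx : t.val s = x) (hv : u.val s = v) (hA : v ≤ A)
    (h : Tri A K q (s.upd a x v) τ Q) : Tri A K (.seq (.store a t u) q) s (1 + τ) Q :=
  (Tri.store (Q := (· = s.upd a x v)) hx hv hA rfl).seq fun _ _ h' => h' ▸ h

theorem ite {t : Tm} (h₁ : t.val s ≠ 0 → Tri A K p s τ Q) (h₂ : t.val s = 0 → Tri A K q s τ Q) :
    Tri A K (.ite t p q) s (1 + τ) Q := by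
  by_cases h : t.val s = 0
  · have := h₂ h
    exact ⟨by simpa [HCmd.Safe, h] using this.1, by simpa [HCmd.steps, h] using this.2.1,
      by simpa [HCmd.run, h] using this.2.2⟩
  · have := h₁ h
    exact ⟨by simpa [HCmd.Safe, h] using this.1, by simpa [HCmd.steps, h] using this.2.1,
      by simpa [HCmd.run, h] using this.2.2⟩

/-- The rule for loops whose iterations may take different numbers of steps. -/
theorem loop' {x b : ℕ} (N : ℕ) (hN : s.reg b = N) (τ : ℕ → ℕ) (I : ℕ → State → Prop) (h0 : I 0 s)
    (h : ∀ j < N, ∀ s', Frame (x :: p.wr) p.wa s s' → I j s' →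
      Tri A K p (s'.set x j) (τ j) (I (j + 1)))
    (hQ : ∀ s', Frame (x :: p.wr) p.wa s s' → I N s' → Q (s'.set x N)) :
    Tri A K (.loop x b p) s (1 + ∑ j ∈ Finset.range N, (1 + τ j)) Q := by
  subst hN
  have key : ∀ j ≤ s.reg b, Frame (x :: p.wr) p.wa s (iter (fun j s => p.run (s.set x j)) j s) ∧
      I j (iter (fun j s => p.run (s.set x j)) j s) := by
    intro j hj
    refine HCmd.iter_induction (n := s.reg b)
      (fun j s' => Frame (x :: p.wr) p.wa s s' ∧ I j s') ⟨⟨fun _ _ => rfl, fun _ _ => rfl⟩, h0⟩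
      (fun j hj s' hs' => ⟨⟨fun i hi => ?_, fun a ha => ?_⟩, (h j hj s' hs'.1 hs'.2).2.2⟩) hj
    · have hi' := hi
      simp only [List.mem_cons, not_or] at hi'
      rw [p.run_reg _ hi'.2, State.set_reg, if_neg hi'.1, hs'.1.reg i hi]
    · rw [p.run_arr _ ha, State.set_arr, hs'.1.arr a ha]
  refine ⟨fun j hj => (h j hj _ (key j hj.le).1 (key j hj.le).2).1, ?_,
    hQ _ (key _ le_rfl).1 (key _ le_rfl).2⟩
  simp only [HCmd.steps]
  refine Nat.add_le_add_left (Finset.sum_le_sum fun j hj => ?_) _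
  have hj := Finset.mem_range.1 hj
  exact Nat.add_le_add_left (h j hj _ (key j hj.le).1 (key j hj.le).2).2.1 _

/-- The rule for loops: `I j` is the invariant before the iteration `j`. -/
theorem loop {x b : ℕ} (N : ℕ) (hN : s.reg b = N) (I : ℕ → State → Prop) (h0 : I 0 s)
    (h : ∀ j < N, ∀ s', Frame (x :: p.wr) p.wa s s' → I j s' →
      Tri A K p (s'.set x j) τ (I (j + 1)))
    (hQ : ∀ s', Frame (x :: p.wr) p.wa s s' → I N s' → Q (s'.set x N)) :
    Tri A K (.loop x b p) s (1 + N * (1 + τ)) Q := by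
  refine (loop' N hN (fun _ => τ) I h0 h hQ).mono ?_
  simp

end Tri

namespace Tm

instance : Add Tm := ⟨.op .add⟩
instance : Sub Tm := ⟨.op .sub⟩
instance : Mul Tm := ⟨.op .mul⟩
instance : Div Tm := ⟨.op .div⟩
instance : Mod Tm := ⟨.op .mod⟩
instance (k : ℕ) : OfNat Tm k := ⟨.const k⟩

/-- `1` if `t < u`, and `0` otherwise. -/
abbrev lt (t u : Tm) : Tm := .op .lt t u

/-- `1` if `t = u`, and `0` otherwise. -/
abbrev eq (t u : Tm) : Tm := .op .eq t u

variable (ar : ℕ → ℕ → ℕ) (r : ℕ → ℕ) (t u c : Tm)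

@[simp] theorem eval_add : (t + u).eval ar r = t.eval ar r + u.eval ar r := rfl
@[simp] theorem eval_sub : (t - u).eval ar r = t.eval ar r - u.eval ar r := rfl
@[simp] theorem eval_mul : (t * u).eval ar r = t.eval ar r * u.eval ar r := rfl
@[simp] theorem eval_div : (t / u).eval ar r = t.eval ar r / u.eval ar r := rfl
@[simp] theorem eval_mod : (t % u).eval ar r = t.eval ar r % u.eval ar r := rfl
@[simp] theorem eval_lt : (t.lt u).eval ar r = if t.eval ar r < u.eval ar r then 1 else 0 := rfl
@[simp] theorem eval_eq : (t.eq u).eval ar r = if t.eval ar r = u.eval ar r then 1 else 0 := rfl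
@[simp] theorem eval_num (k : ℕ) : Tm.eval ar (no_index (OfNat.ofNat k : Tm)) r = k := rfl
@[simp] theorem eval_reg (i : ℕ) : (reg i).eval ar r = r i := rfl
@[simp] theorem eval_load (a : ℕ) : (load a t).eval ar r = ar a (t.eval ar r) := rfl
@[simp] theorem eval_ite : (Tm.ite c t u).eval ar r =
    if c.eval ar r ≠ 0 then t.eval ar r else u.eval ar r := rfl
@[simp] theorem eval_sum (x : ℕ) : (sum x t).eval ar r =
    ∑ v ∈ Finset.range (r 2), t.eval ar (Function.update r x v) := rfl
@[simp] theorem eval_prod (x : ℕ) : (prod x t).eval ar r =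
    ∏ v ∈ Finset.range (r 2), t.eval ar (Function.update r x v) := rfl

end Tm

/-! ### The counting program -/

/-! Registers: `0`, `1`, `2` and `3` hold the numbers of vertices of `H`, of `G`, of `H` without isolated
vertices, and of the current target graph.  Arrays: `1` holds the adjacency matrix of the target
graph, `2` that of the pattern, `3` and `4` the powers of the numbers of vertices of the pattern and
of the target, `5` the representatives of the blocks of a partition, `6` the adjacency matrix of the
quotient, `7` an elimination order, `8` the filled graph, `9` the tables of the dynamic program, and
`10` the vertices of `H` that are not isolated. -/

open Tm

infixr:60 " ;; " => HCmd.seq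

/-- Entry in row `i` and column `j` of the matrix in array `a`. -/
abbrev mat (a : ℕ) (i j : Tm) : Tm := load a (i * reg 2 + j)

/-- Powers of `m` and of the size of the target. -/
def powersProg : HCmd :=
  .store 3 0 1 ;; .store 4 0 1 ;;
  .loop 14 2 (.store 3 (reg 14 + 1) (load 3 (reg 14) * reg 2) ;;
    .store 4 (reg 14 + 1) (load 4 (reg 14) * reg 3))

/-- The value at `i` of the function that is coded by register `7`. -/
def tmP (i : ℕ) : Tm := (reg 7 / load 3 (reg i)) % reg 2

/-- Decodes the function `p` with code in register `7`; register `8` says whether `p i ≤ i` for all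
`i` and the quotient has no loops, and register `9` is the parity of the number of `i` that `p`
moves. -/
def quotProg : HCmd :=
  .loop 14 2 (.store 5 (reg 14) (.ite (lt (tmP 14) (reg 14)) (load 5 (tmP 14)) (reg 14))) ;;
  .loop 15 2 (.loop 16 2 (.store 6 (reg 15 * reg 2 + reg 16) (lt 0 (.sum 50 (.sum 51
    (mat 2 (reg 50) (reg 51) * (eq (load 5 (reg 50)) (reg 15) *
      eq (load 5 (reg 51)) (reg 16)))))))) ;;
  .assign 9 (.sum 50 (lt (tmP 50) (reg 50)) % 2) ;;
  .assign 8 (.prod 50 (1 - lt (reg 50) (tmP 50)) * .prod 50 (1 - mat 6 (reg 50) (reg 50)))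

/-- Decodes the order with code in register `11`, computes the filled graph, and checks whether the
order is an order and has sufficiently small width. -/
def orderProg : HCmd :=
  .loop 14 2 (.store 7 (reg 14) ((reg 11 / load 3 (reg 14)) % reg 2)) ;;
  .loop 15 2 (.loop 16 2 (.store 8 (reg 15 * reg 2 + reg 16)
    (lt (reg 15) (reg 16) * mat 6 (load 7 (reg 15)) (load 7 (reg 16))))) ;;
  .loop 14 2 (.loop 15 2 (.loop 16 2 (.store 8 (reg 15 * reg 2 + reg 16)
    (.ite (lt (reg 15) (reg 16) * (mat 8 (reg 14) (reg 15) * mat 8 (reg 14) (reg 16)))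
      1 (mat 8 (reg 15) (reg 16)))))) ;;
  .assign 12
    (.prod 50 (.prod 51 (1 - lt (reg 50) (reg 51) * eq (load 7 (reg 50)) (load 7 (reg 51)))) *
      .prod 50 (1 - lt (reg 11 / load 3 (reg 2)) (.sum 51 (mat 8 (reg 50) (reg 51)))))

/-- Finds an order of minimum width: the quotient of a code by `m ^ m` is the width, so the codes are
tried by increasing width. -/
def searchProg : HCmd :=
  .assign 12 0 ;; .assign 10 (load 3 (reg 2) * reg 2) ;;
  .loop 11 10 (.ite (reg 12) .skip orderProg)

/-- The value at position `l` of the assignment with code in register `17` for the current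
position. -/
def tmX (l : ℕ) : Tm :=
  (reg 17 / load 4 (.sum 52 (lt (reg 52) (reg l) * mat 8 (reg 14) (reg 52)))) % reg 3

/-- The address in the table of position `c` of the current assignment. -/
def tmEnc (c : ℕ) : Tm :=
  .sum 51 (mat 8 (reg c) (reg 51) * (.ite (eq (reg 51) (reg 14)) (reg 18) (tmX 51) *
    load 4 (.sum 53 (lt (reg 53) (reg 51) * mat 8 (reg c) (reg 53)))))

/-- The contribution of the current assignment to the table of the current position. -/
def tmVal : Tm :=
  .ite (eq (load 5 (load 7 (reg 14))) (load 7 (reg 14))) 1 (eq (reg 18) 0) *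
  .prod 50 (.ite (lt (reg 14) (reg 50) * mat 6 (load 7 (reg 14)) (load 7 (reg 50)))
    (load 1 (reg 18 * reg 3 + tmX 50)) 1) *
  .prod 50 (.ite (mat 8 (reg 50) (reg 14) *
      .prod 51 (1 - lt (reg 51) (reg 14) * mat 8 (reg 50) (reg 51)))
    (load 9 (tmEnc 50 * reg 2 + reg 50)) 1)

/-- Counts the homomorphisms from the quotient to the target along the order. -/
def dpProg : HCmd :=
  .loop 14 2 (.assign 20 (load 4 (.sum 50 (mat 8 (reg 14) (reg 50)))) ;;
    .loop 17 20 (.assign 19 0 ;; .loop 18 3 (.assign 19 (reg 19 + tmVal)) ;;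
      .store 9 (reg 17 * reg 2 + reg 14) (reg 19))) ;;
  .assign 23 (.prod 50 (.ite (.sum 51 (mat 8 (reg 50) (reg 51))) 1 (load 9 (reg 50))))

/-- Counts the injective homomorphisms from the pattern to the target: register `7` runs through the
codes of all functions, and registers `4` and `5` collect the positive and the negative terms. -/
def injProg : HCmd :=
  powersProg ;; .assign 4 0 ;; .assign 5 0 ;; .assign 6 (load 3 (reg 2)) ;;
  .loop 7 6 (quotProg ;; .ite (reg 8)
    (searchProg ;; dpProg ;;
      .ite (reg 9) (.assign 5 (reg 5 + reg 23)) (.assign 4 (reg 4 + reg 23))) .skip) ;;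
  .assign 23 (reg 4 - reg 5)

/-- Removes the isolated vertices of `H`. -/
def patternProg : HCmd :=
  .loop 14 0 (.assign 19 0 ;;
    .loop 15 0 (.ite (load 0 (reg 14 * reg 0 + reg 15)) (.assign 19 1) .skip) ;;
    .ite (reg 19) (.store 10 (reg 2) (reg 14) ;; .assign 2 (reg 2 + 1)) .skip) ;;
  .loop 15 2 (.loop 16 2 (.store 2 (reg 15 * reg 2 + reg 16)
    (load 0 (load 10 (reg 15) * reg 0 + load 10 (reg 16)))))

/-- Counts the injective homomorphisms from the pattern to `G` and to itself. -/
def countProg : HCmd :=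
  patternProg ;; .assign 3 (reg 1) ;; injProg ;; .assign 25 (reg 23) ;;
  .loop 15 2 (.loop 16 2 (.store 1 (reg 15 * reg 2 + reg 16) (mat 2 (reg 15) (reg 16)))) ;;
  .assign 3 (reg 2) ;; injProg ;; .assign 26 (reg 23)

theorem countProg_wf : countProg.wf = true := by decide

end WordRAM

namespace WordRAM

open Tm Finset

/-! ### The dynamic program -/

theorem mul_add_inj {m a b c d : ℕ} (hc : c < m) (hd : d < m) (hab : a * m + c = b * m + d) :
    a = b ∧ c = d := by
  have h1 := congrArg (· % m) hab
  simp only [Nat.mul_add_mod_of_lt hc, Nat.mul_add_mod_of_lt hd] at h1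
  subst h1
  exact ⟨Nat.eq_of_mul_eq_mul_right (by omega) (Nat.add_right_cancel hab), rfl⟩

section Codes

variable {m n : ℕ} {S : ℕ → ℕ → Prop}

open Classical in
/-- The number of successors of `c` below `j`. -/
noncomputable def rk (S : ℕ → ℕ → Prop) (c j : ℕ) : ℕ := ∑ l ∈ range j, if S c l then 1 else 0

open Classical in
/-- The code of the values of `x` at the successors of `c` below `t`. -/
noncomputable def enc (S : ℕ → ℕ → Prop) (n c : ℕ) (x : ℕ → ℕ) (t : ℕ) : ℕ :=
  ∑ j ∈ range t, if S c j then x j * n ^ rk S c j else 0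

/-- The assignment with code `y` at the successors of `c`. -/
noncomputable def dec (S : ℕ → ℕ → Prop) (n c y j : ℕ) : ℕ := y / n ^ rk S c j % n

theorem rk_succ_of {c j : ℕ} (h : S c j) : rk S c (j + 1) = rk S c j + 1 := by
  rw [rk, sum_range_succ, if_pos h, rk]

theorem rk_succ_of_not {c j : ℕ} (h : ¬S c j) : rk S c (j + 1) = rk S c j := by
  rw [rk, sum_range_succ, if_neg h, rk, add_zero]

theorem rk_mono {c i j : ℕ} (h : i ≤ j) : rk S c i ≤ rk S c j :=
  sum_le_sum_of_subset (range_mono h)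

theorem rk_le (c j : ℕ) : rk S c j ≤ j := by
  refine (sum_le_sum (g := fun _ => 1) fun l _ => ?_).trans (by simp)
  split <;> omega

theorem enc_succ_of {c j : ℕ} {x : ℕ → ℕ} (h : S c j) :
    enc S n c x (j + 1) = enc S n c x j + x j * n ^ rk S c j := by
  rw [enc, sum_range_succ, if_pos h, enc]

theorem enc_succ_of_not {c j : ℕ} {x : ℕ → ℕ} (h : ¬S c j) :
    enc S n c x (j + 1) = enc S n c x j := by
  rw [enc, sum_range_succ, if_neg h, enc, add_zero]

theorem enc_lt {c : ℕ} {x : ℕ → ℕ} (t : ℕ) (hx : ∀ j < t, S c j → x j < n) :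
    enc S n c x t < n ^ rk S c t := by
  induction t with
  | zero => simp [enc, rk]
  | succ t ih =>
    have h1 := ih fun j hj => hx j (by omega)
    by_cases h : S c t
    · rw [enc_succ_of h, rk_succ_of h, pow_succ, mul_comm (n ^ _) n]
      have h2 := hx t (by omega) h
      calc _ < (x t + 1) * n ^ rk S c t := by rw [add_mul]; omega
        _ ≤ _ := Nat.mul_le_mul_right _ h2
    · rw [enc_succ_of_not h, rk_succ_of_not h]; exact h1

theorem exists_enc_eq {c t : ℕ} {x : ℕ → ℕ} {u : ℕ} (h : t ≤ u) :
    ∃ q, enc S n c x u = enc S n c x t + n ^ rk S c t * q := by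
  induction u, h using Nat.le_induction with
  | base => exact ⟨0, by simp⟩
  | succ u hu ih =>
    obtain ⟨q, hq⟩ := ih
    by_cases h : S c u
    · obtain ⟨d, hd⟩ := Nat.exists_eq_add_of_le (rk_mono (S := S) (c := c) hu)
      refine ⟨q + x u * n ^ d, ?_⟩
      rw [enc_succ_of h, hq, hd, pow_add]; ring
    · exact ⟨q, by rw [enc_succ_of_not h, hq]⟩

theorem dec_enc {c j : ℕ} {x : ℕ → ℕ} (hx : ∀ j < m, S c j → x j < n) (hj : j < m)
    (hS : S c j) : dec S n c (enc S n c x m) j = x j := by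
  obtain ⟨q, hq⟩ := exists_enc_eq (S := S) (n := n) (c := c) (x := x) (show j + 1 ≤ m from hj)
  have h1 := enc_lt j fun l hl => hx l (by omega)
  have h2 := hx j hj hS
  rw [dec, hq, enc_succ_of hS, rk_succ_of hS, pow_succ,
    show enc S n c x j + x j * n ^ rk S c j + n ^ rk S c j * n * q =
      enc S n c x j + n ^ rk S c j * (x j + n * q) by ring,
    Nat.add_mul_div_left _ _ (by omega), Nat.div_eq_of_lt h1, zero_add, Nat.add_mul_mod_self_left,
    Nat.mod_eq_of_lt h2]

end Codes

theorem sum_lt {m j : ℕ} (h : j ≤ m) (f : ℕ → ℕ) :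
    (∑ l ∈ range m, if l < j then f l else 0) = ∑ l ∈ range j, f l := by
  rw [← sum_filter]
  congr 1
  ext l; simp; omega

open Classical in
/-- What the dynamic program assumes about the contents of the memory: `S` is the filled graph, `M`
the quotient, `Rt` the set of representatives, in each case in terms of positions, and `Ad` is the
target. -/
structure DPInput (m n : ℕ) (S M Ad : ℕ → ℕ → Prop) (Rt : ℕ → Prop) (ar : ℕ → ℕ → ℕ) : Prop where
  pow : ∀ r ≤ m, ar 4 r = n ^ r
  fill : ∀ c < m, ∀ j < m, ar 8 (c * m + j) = if S c j then 1 else 0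
  quot : ∀ c < m, ∀ j < m, c < j → ar 6 (ar 7 c * m + ar 7 j) = if M c j then 1 else 0
  root : ∀ c < m, ar 5 (ar 7 c) = ar 7 c ↔ Rt c
  adj : ∀ u < n, ∀ v < n, ar 1 (u * n + v) = if Ad u v then 1 else 0
  lt : ∀ c j, S c j → c < j
  lt' : ∀ c j, S c j → j < m
  closed : ∀ c i j, S c i → S c j → i < j → S i j
  sub : ∀ c j, c < j → j < m → M c j → S c j

section DP

variable {m n : ℕ} {S M Ad : ℕ → ℕ → Prop} {Rt : ℕ → Prop} {ar : ℕ → ℕ → ℕ}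

theorem DPInput.congr (h : DPInput m n S M Ad Rt ar) {ar' : ℕ → ℕ → ℕ}
    (h' : ∀ a ∈ [1, 4, 5, 6, 7, 8], ar' a = ar a) : DPInput m n S M Ad Rt ar' := by
  obtain ⟨h1, h2, h3, h4, h5, h6, h7, h8, h9⟩ := h
  simp only [List.mem_cons, List.not_mem_nil, or_false, forall_eq_or_imp, forall_eq] at h'
  obtain ⟨a1, a4, a5, a6, a7, a8⟩ := h'
  exact ⟨by rw [a4]; exact h1, by rw [a8]; exact h2, by rw [a6, a7]; exact h3,
    by rw [a5, a7]; exact h4, by rw [a1]; exact h5, h6, h7, h8, h9⟩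

theorem DPInput.sum_fill (h : DPInput m n S M Ad Rt ar) {c j : ℕ} (hc : c < m) (hj : j ≤ m) :
    (∑ l ∈ range m, if l < j then ar 8 (c * m + l) else 0) = rk S c j := by
  rw [sum_lt hj]
  exact sum_congr rfl fun l hl => h.fill c hc l (by have := mem_range.1 hl; omega)

theorem tmX_eval (h : DPInput m n S M Ad Rt ar) {r : ℕ → ℕ} {i y l : ℕ} (h2 : r 2 = m)
    (h3 : r 3 = n) (h14 : r 14 = i) (h17 : r 17 = y) (hi : i < m) (hl : r l ≤ m) (hl52 : l ≠ 52) :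
    (tmX l).eval ar r = dec S n i y (r l) := by
  simp [tmX, Function.update_of_ne hl52, h2, h3, h14, h17,
    h.sum_fill hi hl, dec, h.pow _ ((rk_le i _).trans hl)]

open Classical in
theorem tmEnc_eval (h : DPInput m n S M Ad Rt ar) {r : ℕ → ℕ} {i y v c : ℕ} (h2 : r 2 = m)
    (h3 : r 3 = n) (h14 : r 14 = i) (h17 : r 17 = y) (h18 : r 18 = v) (hi : i < m) (hc : r c < m)
    (hc51 : c ≠ 51) (hc53 : c ≠ 53) :
    (tmEnc c).eval ar r = enc S n (r c) (Function.update (dec S n i y) i v) m := by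
  simp only [tmEnc, eval_sum, h2, enc]
  refine sum_congr rfl fun j hj => ?_
  have hj' := mem_range.1 hj
  have hX := tmX_eval h (r := Function.update r 51 j) (y := y) (i := i) (l := 51)
    (by simp [h2]) (by simp [h3]) (by simp [h14]) (by simp [h17]) hi (by simp; omega) (by decide)
  simp only [Function.update_self] at hX
  simp [Function.update_of_ne hc51, h2, h14, h18, Function.update_apply, hX,
    hc53, h.sum_fill hc hj'.le, h.fill _ hc j hj',
    h.pow _ ((rk_le (r c) _).trans hj'.le)]
  split_ifs <;> rfl

open Classical in
/-- The contribution of the value `v` to the table of `i`. -/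
noncomputable def contrib (m n : ℕ) (S M Ad : ℕ → ℕ → Prop) (Rt : ℕ → Prop) (i : ℕ) (x : ℕ → ℕ)
    (v : ℕ) : ℕ :=
  InjCount.weight m Rt M Ad i (Function.update x i v) *
    ∏ d ∈ range i, if S d i ∧ ElimDP.Alive S d i then
      ElimDP.table S n (InjCount.weight m Rt M Ad) d (Function.update x i v) else 1

theorem prod_alive {m i c : ℕ} (hi : i ≤ m) {f : ℕ → ℕ} [∀ l, Decidable (S c l)]
    (hf : ∀ l < m, f l = if S c l then 1 else 0) :
    ∏ l ∈ range m, (1 - (if l < i then 1 else 0) * f l) ≠ 0 ↔ ElimDP.Alive S c i := by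
  rw [prod_ne_zero_iff, ElimDP.Alive]
  constructor
  · intro h l hl hs
    have := h l (mem_range.2 (by omega))
    rw [hf l (by omega), if_pos hl, if_pos hs] at this
    exact this rfl
  · intro h l hl
    rw [hf l (mem_range.1 hl)]
    by_cases hli : l < i
    · rw [if_neg (h l hli)]; simp
    · simp [hli]

/-- The tables of the positions below `i` are stored in array `9`. -/
def Tables (m n : ℕ) (S M Ad : ℕ → ℕ → Prop) (Rt : ℕ → Prop) (ar : ℕ → ℕ → ℕ) (i : ℕ) : Prop :=
  ∀ c < i, ∀ y < n ^ rk S c m, ar 9 (y * m + c) =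
    ElimDP.table S n (InjCount.weight m Rt M Ad) c (dec S n c y)

theorem DPInput.local (h : DPInput m n S M Ad Rt ar) :
    ElimDP.Local S (InjCount.weight m Rt M Ad) := InjCount.weight_local h.sub

/-- The addresses of the tables are codes of assignments to the successors of a position, so the
value read from a table depends on the current assignment only (`ElimDP.table_congr`). -/
theorem tmVal_eval (h : DPInput m n S M Ad Rt ar) {r : ℕ → ℕ} {i y v : ℕ} (h2 : r 2 = m)
    (h3 : r 3 = n) (h14 : r 14 = i) (h17 : r 17 = y) (h18 : r 18 = v) (hi : i < m) (hn : 1 ≤ n)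
    (hv : v < n) (hT : Tables m n S M Ad Rt ar i) :
    tmVal.eval ar r = contrib m n S M Ad Rt i (dec S n i y) v := by
  classical
  have hd : ∀ j, dec S n i y j < n := fun j => Nat.mod_lt _ hn
  have hu : ∀ j, Function.update (dec S n i y) i v j < n := by
    intro j
    rw [Function.update_apply]; split
    · exact hv
    · exact hd j
  simp only [tmVal, eval_mul, contrib, InjCount.weight]
  congr 1
  · congr 1
    · simp only [eval_ite, eval_eq, eval_load, eval_reg, eval_num, h14, h18, Function.update_self]
      by_cases h1 : Rt i
      · simp [h1, (h.root i hi).2 h1]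
      · have : ¬ ar 5 (ar 7 i) = ar 7 i := fun h' => h1 ((h.root i hi).1 h')
        simp [h1, this]
    · simp only [eval_prod, h2]
      refine prod_congr rfl fun j hj => ?_
      have hj' := mem_range.1 hj
      have hX := tmX_eval h (r := Function.update r 50 j) (y := y) (i := i) (l := 50)
        (by simp [h2]) (by simp [h3]) (by simp [h14]) (by simp [h17]) hi (by simp; omega)
        (by decide)
      simp only [Function.update_self] at hX
      simp only [eval_ite, eval_mul, eval_lt, eval_load, eval_add, eval_num, eval_reg, hX]
      simp only [Function.update_apply, reduceIte, h2, h3, h14, h18, Nat.reduceEqDiff]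
      by_cases hij : i < j
      · rw [h.quot i hi j hj' hij, if_neg (show j ≠ i by omega)]
        by_cases hm : M i j
        · simp [hij, hm, h.adj v hv _ (hd j)]
        · simp [hm]
      · simp [hij]
  · simp only [eval_prod, h2]
    rw [← prod_subset (range_mono hi.le)]
    · refine prod_congr rfl fun d hd' => ?_
      have hdi := mem_range.1 hd'
      have hE := tmEnc_eval h (r := Function.update r 50 d) (y := y) (i := i) (v := v) (c := 50)
        (by simp [h2]) (by simp [h3]) (by simp [h14]) (by simp [h17]) (by simp [h18]) hi
        (by simp; omega) (by decide) (by decide)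
      simp only [Function.update_self] at hE
      have hal := prod_alive (S := S) (c := d) hi.le (f := fun l => ar 8 (d * m + l))
        (fun l hl => h.fill d (by omega) l hl)
      simp only [eval_ite, eval_mul, eval_lt, eval_load, eval_add, eval_num, eval_reg, hE,
        eval_prod, eval_sub]
      simp only [Function.update_apply, reduceIte, h2, h14, Nat.reduceEqDiff, mul_ne_zero_iff, hal]
      rw [h.fill d (by omega) i hi]
      by_cases hs : S d i
      · by_cases ha : ElimDP.Alive S d i
        · simp only [hs, ha, if_true, and_self, ne_eq, one_ne_zero, not_false_eq_true]
          rw [hT d hdi _ (enc_lt m fun j _ _ => hu j)]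
          refine ElimDP.table_congr h.closed h.local fun j hj => ?_
          exact dec_enc (fun j _ _ => hu j) (h.lt' _ _ hj) hj
        · simp [ha]
      · simp [hs]
    · intro d hd hdi
      have hdm := mem_range.1 hd
      have : ¬ S d i := fun hs => hdi (mem_range.2 (h.lt _ _ hs))
      have h8 := h.fill d hdm i hi
      rw [if_neg this] at h8
      simp [h2, h14, h8]

/-- The dynamic program takes `O(m * n ^ (w + 1))` steps if every position has at most `w` successors
(with `e = w + 1`): a table has `n ^ w` entries, each of which is a sum of `n` terms. -/
theorem dpProg_tri {A K e : ℕ} {s : State} (h : DPInput m n S M Ad Rt s.arr) (h2 : s.reg 2 = m)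
    (h3 : s.reg 3 = n) (hn : 1 ≤ n) (hA : n ^ m ≤ A) (he : ∀ c < m, rk S c m + 1 ≤ e) :
    Tri A K dpProg s (11 * (m + 1) * n ^ e) fun s' =>
      s'.reg 23 = ElimDP.total n (InjCount.weight m Rt M Ad) m fun _ => 0 := by
  classical
  set w := InjCount.weight m Rt M Ad with hw
  have hpow : ∀ {a b : ℕ}, a ≤ b → n ^ a ≤ n ^ b := fun h => Nat.pow_le_pow_right hn h
  have hne : 1 ≤ n ^ e := Nat.one_le_pow _ _ hn
  refine (Tri.seq (τ₁ := 1 + m * (1 + 8 * n ^ e)) (τ₂ := 1)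
    (R := fun s' => Tables m n S M Ad Rt s'.arr m) ?_ ?_).mono ?_
  · refine Tri.loop m h2 (fun i s' => Tables m n S M Ad Rt s'.arr i)
      (fun c hc => absurd hc (Nat.not_lt_zero c)) ?_ fun s' _ h' => h'
    intro i hi s1 f1 hT1
    have h1 : DPInput m n S M Ad Rt s1.arr := h.congr fun a ha => f1.arr a (by
      revert a; decide)
    have hb : n ^ rk S i m * (1 + (3 + 2 * n)) ≤ 6 * n ^ e := by
      have := hpow (he i hi)
      rw [pow_succ] at this
      have h' : n ^ rk S i m * 1 ≤ n ^ rk S i m * n := Nat.mul_le_mul_left _ hn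
      nlinarith
    refine (Tri.seq_assign (v := n ^ rk S i m) ?_ ((hpow (rk_le i m)).trans hA) (by simp)
      (τ := 1 + n ^ rk S i m * (1 + (3 + 2 * n))) ?_).mono (by omega)
    · have := h1.sum_fill hi le_rfl
      rw [sum_lt le_rfl] at this
      simp [Tm.val, f1.reg 2 (by decide), h2, this, h1.pow _ (rk_le i m)]
    · set s2 := (s1.set 14 i).set 20 (n ^ rk S i m) with hs2
      have r2 : s2.reg 2 = m := by simp [hs2, f1.reg 2 (by decide), h2]
      have r3 : s2.reg 3 = n := by simp [hs2, f1.reg 3 (by decide), h3]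
      have r14 : s2.reg 14 = i := by simp [hs2]
      have hval : ∀ (s' : State) (y v : ℕ), DPInput m n S M Ad Rt s'.arr → s'.reg 2 = m →
          s'.reg 3 = n → s'.reg 14 = i → s'.reg 17 = y → s'.reg 18 = v → v < n →
          Tables m n S M Ad Rt s'.arr i →
          tmVal.val s' = contrib m n S M Ad Rt i (dec S n i y) v :=
        fun s' y v g1 g2 g3 g4 g5 g6 g7 g8 => tmVal_eval g1 g2 g3 g4 g5 g6 hi hn g7 g8
      refine Tri.loop (n ^ rk S i m) (by simp [hs2])
        (fun y s' => Tables m n S M Ad Rt s'.arr i ∧ ∀ y' < y, s'.arr 9 (y' * m + i) =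
          ElimDP.table S n w i (dec S n i y'))
        ⟨hT1, fun y' hy => absurd hy (Nat.not_lt_zero _)⟩ ?_ ?_
      · rintro y hy s3 f3 ⟨hT3, hy3⟩
        have h3' : DPInput m n S M Ad Rt s3.arr := h1.congr fun a ha => f3.arr a (by
          revert a; decide)
        have htab : ∀ x, ElimDP.table S n w i x ≤ A := fun x =>
          ((ElimDP.table_le h.lt h.closed (fun c x => InjCount.weight_le c x) hn i x).trans
            (hpow (by omega))).trans hA
        have hsum : ∀ x, ElimDP.table S n w i x =
            ∑ v ∈ range n, contrib m n S M Ad Rt i x v := fun x => ElimDP.table_eq i x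
        refine (Tri.seq_assign (v := 0) (by simp [Tm.val]) (Nat.zero_le _) (by simp)
          (τ := (1 + n * (1 + 1)) + 1) ?_).mono (by omega)
        refine Tri.seq (R := fun s' => s'.reg 19 = ElimDP.table S n w i (dec S n i y)) ?_ ?_
        · refine Tri.loop n (by simp [f3.reg 3 (by decide), r3])
            (fun v s' => s'.reg 19 = ∑ v' ∈ range v, contrib m n S M Ad Rt i (dec S n i y) v')
            (by simp) ?_ ?_
          · intro v hv s4 f4 h19
            have e1 : tmVal.val (s4.set 18 v) = contrib m n S M Ad Rt i (dec S n i y) v := by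
              refine hval _ y v (h3'.congr fun a _ => ?_) ?_ ?_ ?_ ?_ (by simp) hv ?_
              · exact f4.arr a (by simp [HCmd.wa])
              · simp [f4.reg 2 (by decide), f3.reg 2 (by decide), r2]
              · simp [f4.reg 3 (by decide), f3.reg 3 (by decide), r3]
              · simp [f4.reg 14 (by decide), f3.reg 14 (by decide), r14]
              · simp [f4.reg 17 (by decide)]
              · simp only [State.set_arr]
                intro c hc y' hy'
                rw [f4.arr 9 (by simp [HCmd.wa])]
                exact hT3 c hc y' hy'
            refine Tri.assign (v := ∑ v' ∈ range (v + 1), contrib m n S M Ad Rt i (dec S n i y) v')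
              ?_ ?_ (by simp) (by simp)
            · rw [sum_range_succ, ← e1, ← h19]
              simp [Tm.val]
            · refine (sum_le_sum_of_subset (range_mono hv)).trans ?_
              rw [← hsum]; exact htab _
          · intro s' _ h'
            rw [hsum]; simpa using h'
        · intro s4 f4 h19
          have g2 : s4.reg 2 = m := by
            simp [f4.reg 2 (by decide), f3.reg 2 (by decide), r2]
          have g17 : s4.reg 17 = y := by simp [f4.reg 17 (by decide)]
          have g14 : s4.reg 14 = i := by
            simp [f4.reg 14 (by decide), f3.reg 14 (by decide), r14]
          have g9 : s4.arr 9 = s3.arr 9 := by simp [f4.arr 9 (by decide)]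
          refine Tri.store (x := y * m + i) (by simp [Tm.val, g2, g17, g14])
            (v := ElimDP.table S n w i (dec S n i y)) (by simp [Tm.val, h19]) (htab _) ⟨?_, ?_⟩
          · intro c hc y' hy'
            rw [State.upd_arr, if_neg (fun h' => by
              have := mul_add_inj (by omega) hi h'.2; omega), g9]
            exact hT3 c hc y' hy'
          · intro y' hy'
            rw [State.upd_arr]
            split
            · rename_i h'
              rw [(mul_add_inj hi hi h'.2).1]
            · rename_i h'
              rw [g9]
              refine hy3 y' (lt_of_le_of_ne (Nat.lt_succ_iff.1 hy') ?_)
              rintro rfl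
              exact h' ⟨rfl, rfl⟩
      · rintro s3 f3 ⟨hT3, hy3⟩ c hc y hy
        simp only [State.set_arr]
        rcases Nat.lt_succ_iff_lt_or_eq.1 hc with hc | rfl
        · exact hT3 c hc y hy
        · exact hy3 y hy
  · intro s' f' hT
    have h' : DPInput m n S M Ad Rt s'.arr := h.congr fun a ha => f'.arr a (by revert a; decide)
    have g2 : s'.reg 2 = m := by rw [f'.reg 2 (by decide), h2]
    have htot := ElimDP.total_eq (n := n) h.lt h.closed h.local m fun _ => 0
    refine Tri.assign (v := ElimDP.total n w m fun _ => 0) ?_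
      ((ElimDP.total_le (fun c x => InjCount.weight_le c x) m _).trans hA) (by simp) (by simp)
    rw [htot]
    simp only [Tm.val, eval_prod, g2]
    refine prod_congr rfl fun c hc => ?_
    have hcm := mem_range.1 hc
    have e1 : ∑ l ∈ range m, s'.arr 8 (c * m + l) = rk S c m :=
      sum_congr rfl fun l hl => h'.fill c hcm l (mem_range.1 hl)
    have e2 : rk S c m = 0 ↔ ElimDP.Alive S c m := by
      rw [rk, sum_eq_zero_iff]
      simp [ElimDP.Alive]
    simp only [eval_ite, eval_sum, eval_load, eval_add, eval_mul, eval_reg, eval_num,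
      Function.update_apply, reduceIte, g2, Nat.reduceEqDiff, e1]
    by_cases ha : ElimDP.Alive S c m
    · rw [if_pos ha, if_neg (by simp [e2.2 ha])]
      -- Positions without successors have tables with the single entry `0`.
      have := hT c hcm 0 (by positivity)
      rw [zero_mul, zero_add] at this
      rw [this]
      exact ElimDP.table_congr h.closed h.local fun j hj => absurd hj (ha j (h.lt' _ _ hj))
    · rw [if_neg ha, if_pos (fun h0 => ha (e2.1 h0))]
  · nlinarith

end DP

end WordRAM

namespace WordRAM

open Tm Finset

/-! ### Powers, quotients and elimination orders -/

theorem Frame.trans {w1 w2 w a1 a2 a : List ℕ} {s s' s'' : State} (h : Frame w1 a1 s s')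
    (h' : Frame w2 a2 s' s'') (hw : ∀ i ∉ w, i ∉ w1 ∧ i ∉ w2) (ha : ∀ i ∉ a, i ∉ a1 ∧ i ∉ a2) :
    Frame w a s s'' :=
  ⟨fun i hi => by rw [h'.reg i (hw i hi).2, h.reg i (hw i hi).1],
    fun i hi => by rw [h'.arr i (ha i hi).2, h.arr i (ha i hi).1]⟩

theorem Frame.set {w a : List ℕ} {s s' : State} (h : Frame w a s s') {i v : ℕ} (hi : i ∈ w) :
    Frame w a s (s'.set i v) :=
  ⟨fun j hj => by rw [State.set_reg, if_neg (by rintro rfl; exact hj hi), h.reg j hj], h.arr⟩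

variable {A K m n : ℕ}

/-- Filling a matrix in array `a`. -/
theorem fill_tri {a : ℕ} {t : Tm} {s : State} (f : ℕ → ℕ → ℕ) (h2 : s.reg 2 = m)
    (hf : ∀ i < m, ∀ j < m, ∀ s', Frame [15, 16] [a] s s' → s'.reg 15 = i → s'.reg 16 = j →
      t.val s' = f i j ∧ f i j ≤ A) :
    Tri A K (.loop 15 2 (.loop 16 2 (.store a (reg 15 * reg 2 + reg 16) t))) s
      (1 + m * (2 + 2 * m)) fun s' => ∀ i < m, ∀ j < m, s'.arr a (i * m + j) = f i j := by
  refine (Tri.loop m h2 (fun i s' => ∀ i' < i, ∀ j < m, s'.arr a (i' * m + j) = f i' j)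
    (fun i hi => absurd hi (Nat.not_lt_zero i)) (τ := 1 + m * (1 + 1)) ?_
    fun s' _ h => h).mono (le_of_eq (by ring))
  intro i hi s1 f1 h1
  refine Tri.loop m (by simp [f1.reg 2 (by simp [HCmd.wr]), h2])
    (fun j s' => (∀ i' < i, ∀ j < m, s'.arr a (i' * m + j) = f i' j) ∧
      ∀ j' < j, s'.arr a (i * m + j') = f i j')
    ⟨h1, fun j hj => absurd hj (Nat.not_lt_zero j)⟩ ?_ ?_
  · rintro j hj s2 f2 ⟨g1, g2⟩
    have f1' : Frame [15, 16] [a] s s1 := f1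
    have f2' : Frame [16] [a] (s1.set 15 i) s2 := f2
    have hfr : Frame [15, 16] [a] s (s2.set 16 j) :=
      ((f1'.set (v := i) (by simp)).trans f2' (w := [15, 16]) (a := [a]) (by simp)
        (by simp)).set (by simp)
    have q2 : s2.reg 2 = m := by
      simp [f2.reg 2 (by simp [HCmd.wr]), f1.reg 2 (by simp [HCmd.wr]), h2]
    have q15 : s2.reg 15 = i := by simp [f2.reg 15 (by simp [HCmd.wr])]
    obtain ⟨hv, hA⟩ := hf i hi j hj _ hfr (by simp [q15]) (by simp)
    refine Tri.store (x := i * m + j) (by simp [Tm.val, q2, q15]) hv hA ⟨?_, ?_⟩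
    · intro i' hi' j' hj'
      rw [State.upd_arr, if_neg (fun h => by have := mul_add_inj hj' hj h.2; omega)]
      exact g1 i' hi' j' hj'
    · intro j' hj'
      rw [State.upd_arr]
      split
      · rename_i h; rw [(mul_add_inj (by omega) hj h.2).2]
      · rename_i h
        exact g2 j' (lt_of_le_of_ne (Nat.lt_succ_iff.1 hj') (by rintro rfl; exact h ⟨rfl, rfl⟩))
  · rintro s2 f2 ⟨g1, g2⟩ i' hi' j hj
    simp only [State.set_arr]
    rcases Nat.lt_succ_iff_lt_or_eq.1 hi' with hi' | rfl
    · exact g1 i' hi' j hj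
    · exact g2 j hj

theorem powersProg_tri {s : State} (h2 : s.reg 2 = m) (h3 : s.reg 3 = n) (hm : 1 ≤ m) (hn : 1 ≤ n)
    (hA : m ^ m ≤ A) (hA' : n ^ m ≤ A) : Tri A K powersProg s (3 + m * 3) fun s' =>
      ∀ i ≤ m, s'.arr 3 i = m ^ i ∧ s'.arr 4 i = n ^ i := by
  have h1A : 1 ≤ A := (Nat.one_le_pow _ _ hm).trans hA
  refine (Tri.seq_store (x := 0) (v := 1) (by simp [Tm.val]) (by simp [Tm.val]) h1A
    (Tri.seq_store (x := 0) (v := 1) (by simp [Tm.val]) (by simp [Tm.val]) h1A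
    (Tri.loop m (by simp [h2]) (fun i s' => ∀ j ≤ i, s'.arr 3 j = m ^ j ∧ s'.arr 4 j = n ^ j)
    ?_ (τ := 1 + 1) ?_ ?_))).mono (le_of_eq (by ring))
  · intro j hj
    obtain rfl := Nat.le_zero.1 hj
    simp [State.upd_arr]
  · intro i hi s1 f1 hI
    have g2 : s1.reg 2 = m := by simp [f1.reg 2 (by simp [HCmd.wr]), h2]
    have g3 : s1.reg 3 = n := by simp [f1.reg 3 (by simp [HCmd.wr]), h3]
    refine Tri.seq_store (x := i + 1) (v := m ^ (i + 1)) (by simp [Tm.val])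
      (by simp [Tm.val, g2, (hI i le_rfl).1, pow_succ])
      ((Nat.pow_le_pow_right hm (by omega)).trans hA) ?_
    refine Tri.store (x := i + 1) (v := n ^ (i + 1)) (by simp [Tm.val])
      (by simp [Tm.val, g3, State.upd_arr, (hI i le_rfl).2, pow_succ])
      ((Nat.pow_le_pow_right hn (by omega)).trans hA') ?_
    intro j hj
    simp only [State.upd_arr, State.set_arr]
    by_cases hj' : j = i + 1
    · simp [hj']
    · simpa [hj'] using hI j (by omega)
  · intro s' _ h; exact h

/-- The representative of `i`: follow `p` as long as it decreases. -/
def rootOf (p : Fin m → Fin m) (i : Fin m) : Fin m :=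
  if p i < i then rootOf p (p i) else i
termination_by i

theorem isRoot_rootOf {p : Fin m → Fin m} (hp : ∀ i, p i ≤ i) : InjCount.IsRoot p (rootOf p) := by
  refine ⟨hp, fun i => ?_⟩
  rw [rootOf]
  rcases (hp i).lt_or_eq with h | h
  · rw [if_pos h, if_neg h.ne]
  · rw [if_neg h.not_lt, if_pos h]

open Classical in
/-- What is known after `quotProg` about the quotient by the function `p`. -/
structure QuotPost (B : SimpleGraph (Fin m)) (p : Fin m → Fin m) (s : State) : Prop where
  root : ∀ i : Fin m, s.arr 5 i = rootOf p i
  adj : ∀ a b : Fin m, s.arr 6 (a * m + b) = if InjCount.QAdj B (rootOf p) a b then 1 else 0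
  parity : s.reg 9 = #{i | p i < i} % 2
  valid : s.reg 8 ≠ 0 ↔ (∀ i, p i ≤ i) ∧ ∀ a, ¬InjCount.QAdj B (rootOf p) a a

open Classical in
theorem quotProg_tri {B : SimpleGraph (Fin m)} {p : Fin m → Fin m} {s : State} {code : ℕ}
    (h2 : s.reg 2 = m) (h7 : s.reg 7 = code) (hp : ∀ i : Fin m, (p i : ℕ) = code / m ^ (i : ℕ) % m)
    (h3 : ∀ i ≤ m, s.arr 3 i = m ^ i)
    (hB : ∀ i j : Fin m, s.arr 2 (i * m + j) = if B.Adj i j then 1 else 0)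
    (hA : 2 ≤ A) (hmA : m ≤ A) :
    Tri A K quotProg s (4 + m * (4 + 2 * m)) fun s' => QuotPost B p s' := by
  have hP : ∀ s' : State, ∀ i : Fin m, ∀ r : ℕ, s'.reg 2 = m → s'.reg 7 = code →
      (∀ i ≤ m, s'.arr 3 i = m ^ i) → s'.reg r = i → (tmP r).val s' = p i := by
    intro s' i r g2 g7 g3 gr
    simp [tmP, Tm.val, g2, g7, gr, g3 i i.2.le, hp]
  refine (Tri.seq (τ₁ := 1 + m * (1 + 1)) (τ₂ := (1 + m * (2 + 2 * m)) + (1 + 1))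
    (R := fun s' => ∀ i : Fin m, s'.arr 5 i = rootOf p i) ?_ ?_).mono (le_of_eq (by ring))
  · refine Tri.loop m h2 (fun i s' => ∀ j : Fin m, j < i → s'.arr 5 j = rootOf p j)
      (fun j hj => absurd hj (Nat.not_lt_zero _)) ?_ fun s' _ h j => h j j.2
    intro i hi s1 f1 hI
    have e1 : (tmP 14).val (s1.set 14 i) = p ⟨i, hi⟩ := by
      refine hP _ ⟨i, hi⟩ 14 ?_ ?_ ?_ (by simp)
      · simp [f1.reg 2 (by decide), h2]
      · simp [f1.reg 7 (by decide), h7]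
      · simpa [f1.arr 3 (by decide)] using h3
    refine Tri.store (x := i) (v := rootOf p ⟨i, hi⟩) (by simp [Tm.val]) ?_
      ((Fin.is_lt _).le.trans hmA) ?_
    · simp only [Tm.val, State.set_arr] at e1
      simp only [Tm.val, eval_ite, eval_lt, eval_load, eval_reg, State.set_arr, e1]
      rw [rootOf]
      by_cases h : p ⟨i, hi⟩ < ⟨i, hi⟩
      · have h' : (p ⟨i, hi⟩ : ℕ) < i := h
        simp [h, h', hI _ h']
      · have h' : ¬ (p ⟨i, hi⟩ : ℕ) < i := h
        simp [h, h']
    · intro j hj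
      rw [State.upd_arr]
      split
      · rename_i h
        have : j = ⟨i, hi⟩ := Fin.ext h.2
        rw [this]
      · rename_i h
        exact hI j (lt_of_le_of_ne (Nat.lt_succ_iff.1 hj) (fun h' => h ⟨rfl, h'⟩))
  · intro s1 f1 h5
    have a2 : ∀ i j : Fin m, s1.arr 2 (i * m + j) = if B.Adj i j then 1 else 0 := by
      rw [f1.arr 2 (by decide)]; exact hB
    have r2 : s1.reg 2 = m := by rw [f1.reg 2 (by decide), h2]
    refine Tri.seq (R := fun s' => ∀ a b : Fin m, s'.arr 6 (a * m + b) =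
      if InjCount.QAdj B (rootOf p) a b then 1 else 0) ?_ ?_
    · refine (fill_tri (m := m) (fun a b => if ∃ a' b' : Fin m, a' = a ∧ b' = b ∧
        InjCount.QAdj B (rootOf p) a' b' then 1 else 0) r2 ?_).weaken ?_
      · intro a ha b hb s2 f2 g15 g16
        refine ⟨?_, by split_ifs <;> omega⟩
        have q2 : s2.reg 2 = m := by rw [f2.reg 2 (by decide), r2]
        have h5' : ∀ i : Fin m, s2.arr 5 i = rootOf p i := by rw [f2.arr 5 (by decide)]; exact h5
        have a2' : ∀ i j : Fin m, s2.arr 2 (i * m + j) = if B.Adj i j then 1 else 0 := by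
          rw [f2.arr 2 (by decide)]; exact a2
        simp only [Tm.val, eval_lt, eval_num, eval_sum, eval_mul, eval_load, eval_add, eval_eq,
          eval_reg, Function.update_apply, reduceIte, Nat.reduceEqDiff, q2, g15, g16]
        congr 1
        rw [eq_iff_iff, Finset.sum_pos_iff]
        simp only [Finset.sum_pos_iff, mem_range]
        constructor
        · rintro ⟨i, hi, j, hj, hpos⟩
          have b1 := a2' ⟨i, hi⟩ ⟨j, hj⟩
          have b2 := h5' ⟨i, hi⟩
          have b3 := h5' ⟨j, hj⟩
          simp only at b1 b2 b3
          rw [b1, b2, b3] at hpos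
          refine ⟨⟨a, ha⟩, ⟨b, hb⟩, rfl, rfl, ⟨i, hi⟩, ⟨j, hj⟩, ?_, ?_, ?_⟩
          · by_contra h; simp [h] at hpos
          · by_contra h; rw [Fin.ext_iff] at h; simp [h] at hpos
          · by_contra h; rw [Fin.ext_iff] at h; simp [h] at hpos
        · rintro ⟨a', b', rfl, rfl, i, j, hij, h1, h2⟩
          refine ⟨i, i.2, j, j.2, ?_⟩
          rw [a2', h5', h5', h1, h2]
          simp [hij]
      · intro s' _ h a b
        rw [h a a.2 b b.2]
        congr 1
        rw [eq_iff_iff]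
        constructor
        · rintro ⟨a', b', h1, h2, h3⟩
          rwa [Fin.ext h1, Fin.ext h2] at h3
        · exact fun h => ⟨a, b, rfl, rfl, h⟩
    · intro s2 f2 h6
      have q2 : s2.reg 2 = m := by rw [f2.reg 2 (by decide), r2]
      have q7 : s2.reg 7 = code := by rw [f2.reg 7 (by decide), f1.reg 7 (by decide), h7]
      have q3 : ∀ i ≤ m, s2.arr 3 i = m ^ i := by
        rw [f2.arr 3 (by decide), f1.arr 3 (by decide)]; exact h3
      have q5 : ∀ i : Fin m, s2.arr 5 i = rootOf p i := by rw [f2.arr 5 (by decide)]; exact h5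
      have hev : ∀ s' : State, s'.arr = s2.arr → s'.reg 2 = m → s'.reg 7 = code → ∀ i : Fin m,
          (tmP 50).eval s'.arr (Function.update s'.reg 50 i) = p i := by
        intro s' e1 e2 e3 i
        simp [tmP, e1, e2, e3, q3 i i.2.le, hp]
      refine Tri.seq_assign (v := #{i | p i < i} % 2) ?_ ((Nat.mod_lt _ (by omega)).le.trans hA)
        (by simp) ?_
      · simp only [Tm.val, eval_mod, eval_sum, eval_lt, eval_num, eval_reg, q2]
        rw [Finset.sum_range]
        simp only [hev s2 rfl q2 q7, Function.update_self, Fin.val_fin_lt]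
        rw [card_filter]
      · set s3 := s2.set 9 (#{i | p i < i} % 2) with hs3
        have hv : ∀ v, v ≤ 1 → (v ≠ 0 ↔ (∀ i, p i ≤ i) ∧ ∀ a, ¬InjCount.QAdj B (rootOf p) a a) →
            QuotPost B p (s3.set 8 v) := fun v _ hv =>
          ⟨by simpa [hs3] using q5, by simpa [hs3] using h6, by simp [hs3], by simpa using hv⟩
        have g1 : ∀ i : Fin m, (tmP 50).eval s3.arr (Function.update s3.reg 50 i) = p i :=
          hev s3 rfl (by simp [hs3, q2]) (by simp [hs3, q7])
        have e : (Tm.prod 50 (1 - lt (reg 50) (tmP 50)) *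
            .prod 50 (1 - mat 6 (reg 50) (reg 50))).val s3 =
            (∏ i : Fin m, (1 - if i < p i then 1 else 0)) *
            ∏ a : Fin m, (1 - if InjCount.QAdj B (rootOf p) a a then 1 else 0) := by
          simp only [Tm.val, eval_mul, eval_prod, eval_sub, eval_lt, eval_num, eval_reg, eval_load,
            eval_add]
          have : s3.reg 2 = m := by simp [hs3, q2]
          have a3 : ∀ a b : Fin m, s3.arr 6 (a * m + b) =
              if InjCount.QAdj B (rootOf p) a b then 1 else 0 := by simpa [hs3] using h6
          rw [this, Finset.prod_range, Finset.prod_range]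
          simp only [g1, Function.update_self, Fin.val_fin_lt, Function.update_apply,
            Nat.reduceEqDiff, reduceIte, this, a3]
        have hle : ∀ (q : Fin m → Prop) [DecidablePred q],
            ∏ a : Fin m, (1 - if q a then 1 else 0) ≤ 1 := fun q _ =>
          Finset.prod_le_one' fun a _ => Nat.sub_le _ _
        refine Tri.assign e ((Nat.mul_le_mul (hle _) (hle _)).trans (by omega)) (by simp)
          (hv _ (Nat.mul_le_mul (hle _) (hle _)) ?_)
        rw [mul_ne_zero_iff, prod_ne_zero_iff, prod_ne_zero_iff]
        refine and_congr ?_ ?_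
        · refine forall_congr' fun i => ?_
          by_cases h : i < p i
          · simp [h]
          · simp [h, not_lt.1 h]
        · refine forall_congr' fun i => ?_
          by_cases h : InjCount.QAdj B (rootOf p) i i <;> simp [h]

end WordRAM

namespace WordRAM

open Tm Finset

/-! ### The filled graph of an elimination order -/

/-- Relations on positions below `m` that are closed under elimination: the later neighbours of a
position are adjacent to each other. -/
structure Closed (m : ℕ) (M C : ℕ → ℕ → Prop) : Prop where
  sub : ∀ c j, c < j → j < m → M c j → C c j
  closed : ∀ c i j, c < i → i < j → j < m → C c i → C c j → C i j

/-- `G` is part of the filled graph of `M`, and the triples in `P` have been processed. -/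
structure FillInv (m : ℕ) (M G : ℕ → ℕ → Prop) (P : ℕ → ℕ → ℕ → Prop) : Prop where
  lt : ∀ c j, G c j → c < j
  lt' : ∀ c j, G c j → j < m
  sub : ∀ c j, c < j → j < m → M c j → G c j
  least : ∀ C, Closed m M C → ∀ c j, G c j → C c j
  closed : ∀ c a b, P c a b → a < b → G c a → G c b → G a b

/-- Processing the triple `(i, a, b)` adds an edge between the later neighbours `a` and `b` of `i`. -/
theorem FillInv.step {m : ℕ} {M G : ℕ → ℕ → Prop} {P : ℕ → ℕ → ℕ → Prop} (h : FillInv m M G P)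
    {i a b : ℕ} (hP : ∀ c a' b', P c a' b' → c ≤ i) :
    FillInv m M (fun c j => G c j ∨ (c = a ∧ j = b ∧ a < b ∧ G i a ∧ G i b))
      (fun c a' b' => P c a' b' ∨ (c = i ∧ a' = a ∧ b' = b)) := by
  have key : ∀ c j, c ≤ i → (G c j ∨ (c = a ∧ j = b ∧ a < b ∧ G i a ∧ G i b)) → G c j := by
    rintro c j hc (h' | ⟨rfl, rfl, -, h1, -⟩)
    · exact h'
    · have := h.lt _ _ h1; omega
  refine ⟨?_, ?_, fun c j h1 h2 h3 => .inl (h.sub c j h1 h2 h3), ?_, ?_⟩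
  · rintro c j (h' | ⟨rfl, rfl, h', -, -⟩)
    · exact h.lt _ _ h'
    · exact h'
  · rintro c j (h' | ⟨rfl, rfl, -, -, h'⟩)
    · exact h.lt' _ _ h'
    · exact h.lt' _ _ h'
  · rintro C hC c j (h' | ⟨rfl, rfl, h1, h2, h3⟩)
    · exact h.least C hC _ _ h'
    · exact hC.closed i c j (h.lt _ _ h2) h1 (h.lt' _ _ h3) (h.least C hC _ _ h2)
        (h.least C hC _ _ h3)
  · rintro c a' b' (hp | ⟨rfl, rfl, rfl⟩) hab h1 h2
    · exact .inl (h.closed c a' b' hp hab (key _ _ (hP _ _ _ hp) h1) (key _ _ (hP _ _ _ hp) h2))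
    · exact .inr ⟨rfl, rfl, hab, key _ _ le_rfl h1, key _ _ le_rfl h2⟩

theorem FillInv.weaken {m : ℕ} {M G : ℕ → ℕ → Prop} {P P' : ℕ → ℕ → ℕ → Prop}
    (h : FillInv m M G P) (hP : ∀ c a b, G c a → G c b → P' c a b → P c a b) :
    FillInv m M G P' :=
  ⟨h.lt, h.lt', h.sub, h.least, fun c a b hp hab h1 h2 =>
    h.closed c a b (hP c a b h1 h2 hp) hab h1 h2⟩

open Classical in
/-- The matrix in array `8` satisfies `FillInv`. -/
def FillState (m : ℕ) (M : ℕ → ℕ → Prop) (P : ℕ → ℕ → ℕ → Prop) (s : State) : Prop :=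
  ∃ G, FillInv m M G P ∧ ∀ c < m, ∀ j < m, s.arr 8 (c * m + j) = if G c j then 1 else 0

theorem FillState.weaken {m : ℕ} {M : ℕ → ℕ → Prop} {P P' : ℕ → ℕ → ℕ → Prop} {s s' : State}
    (h : FillState m M P s) (hs : s'.arr 8 = s.arr 8)
    (hP : ∀ c a b, a < m → b < m → P' c a b → P c a b) : FillState m M P' s' := by
  obtain ⟨G, h1, h2⟩ := h
  exact ⟨G, h1.weaken fun c a b ha hb => hP c a b (h1.lt' _ _ ha) (h1.lt' _ _ hb),
    by rw [hs]; exact h2⟩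

variable {A K m n : ℕ} {M : ℕ → ℕ → Prop}

/-- Processing the triples in lexicographic order yields the filled graph: the neighbours of `i` later
than `i` no longer change once `i` is eliminated. -/
theorem elimLoop_tri {s : State} (h2 : s.reg 2 = m) (hA : 1 ≤ A)
    (h0 : FillState m M (fun _ _ _ => False) s) :
    Tri A K (.loop 14 2 (.loop 15 2 (.loop 16 2 (.store 8 (reg 15 * reg 2 + reg 16)
      (.ite (lt (reg 15) (reg 16) * (mat 8 (reg 14) (reg 15) * mat 8 (reg 14) (reg 16)))
        1 (mat 8 (reg 15) (reg 16))))))) s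
      (1 + m * (1 + (1 + m * (1 + (1 + m * (1 + 1)))))) (FillState m M fun _ _ _ => True) := by
  refine Tri.loop m h2 (fun i => FillState m M fun c _ _ => c < i)
    (h0.weaken rfl fun c a b _ _ h => absurd h (Nat.not_lt_zero c)) ?_ ?_
  · intro i hi s1 f1 i1
    refine Tri.loop m (by simp [f1.reg 2 (by decide), h2])
      (fun a => FillState m M fun c a' _ => c < i ∨ (c = i ∧ a' < a))
      (i1.weaken rfl fun c a b _ _ h => by omega) ?_ ?_
    · intro a ha s2 f2 i2
      refine Tri.loop m (by simp [f2.reg 2 (by decide), f1.reg 2 (by decide), h2])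
        (fun b => FillState m M fun c a' b' => c < i ∨ (c = i ∧ (a' < a ∨ a' = a ∧ b' < b)))
        (i2.weaken rfl fun c a b _ _ h => by omega) ?_ ?_
      · rintro b hb s3 f3 ⟨G, hG, hs⟩
        classical
        have g2 : s3.reg 2 = m := by
          simp [f3.reg 2 (by decide), f2.reg 2 (by decide), f1.reg 2 (by decide), h2]
        have g14 : s3.reg 14 = i := by
          simp [f3.reg 14 (by decide), f2.reg 14 (by decide)]
        have g15 : s3.reg 15 = a := by simp [f3.reg 15 (by decide)]
        have hstep := hG.step (i := i) (a := a) (b := b) (by rintro c a' b' h; omega)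
        refine Tri.store (x := a * m + b) (v := if G a b ∨ (a < b ∧ G i a ∧ G i b) then 1 else 0)
          (by simp [Tm.val, g2, g15]) ?_ (by split_ifs <;> omega)
          ⟨_, hstep.weaken fun c a' b' _ _ h => by omega, ?_⟩
        · simp only [Tm.val, eval_ite, eval_mul, eval_lt, eval_load, eval_add, eval_reg, eval_num,
            State.set_reg, State.set_arr, Nat.reduceEqDiff, if_true, if_false, g2, g14, g15,
            hs i hi a ha, hs i hi b hb, hs a ha b hb]
          by_cases h1 : a < b <;> by_cases h2 : G i a <;> by_cases h3 : G i b <;> simp [h1, h2, h3]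
        · intro c hc j hj
          rw [State.upd_arr]
          split
          · rename_i h
            obtain ⟨rfl, rfl⟩ := mul_add_inj hj hb h.2
            simp
          · rename_i h
            rw [State.set_arr, hs c hc j hj]
            congr 1
            rw [eq_iff_iff]
            constructor
            · exact .inl
            · rintro (h' | ⟨rfl, rfl, -⟩)
              · exact h'
              · exact absurd ⟨rfl, rfl⟩ h
      · intro s3 f3 i3
        exact i3.weaken rfl fun c a b _ _ h => by omega
    · intro s2 f2 i2
      exact i2.weaken rfl fun c a b _ _ h => by omega
  · intro s1 f1 i1
    obtain ⟨G, hG, hs⟩ := i1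
    exact ⟨G, ⟨hG.lt, hG.lt', hG.sub, hG.least, fun c a b _ hab h1 h2 => by
      have := hG.lt _ _ h1
      have := hG.lt' _ _ h1
      exact hG.closed c a b (by omega) hab h1 h2⟩, hs⟩

/-- The vertex at position `c` in the order with code `z`. -/
def ord (m z c : ℕ) : ℕ := z / m ^ c % m

open Classical in
/-- What is known after `orderProg` about the order with code `z` and the quotient `Qd`. -/
structure OrderPost (m : ℕ) (Qd : ℕ → ℕ → Prop) (z : ℕ) (S : ℕ → ℕ → Prop) (s : State) : Prop where
  ord : ∀ c < m, s.arr 7 c = ord m z c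
  inv : FillInv m (fun c j => Qd (WordRAM.ord m z c) (WordRAM.ord m z j)) S fun _ _ _ => True
  fill : ∀ c < m, ∀ j < m, s.arr 8 (c * m + j) = if S c j then 1 else 0
  found : s.reg 12 ≠ 0 ↔ (∀ i < m, ∀ j < m, i < j → WordRAM.ord m z i ≠ WordRAM.ord m z j) ∧
    ∀ c < m, rk S c m ≤ z / m ^ m

open Classical in
theorem orderProg_tri {Qd : ℕ → ℕ → Prop} {s : State} {z : ℕ} (h2 : s.reg 2 = m)
    (h11 : s.reg 11 = z) (h3 : ∀ i ≤ m, s.arr 3 i = m ^ i)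
    (h6 : ∀ a < m, ∀ b < m, s.arr 6 (a * m + b) = if Qd a b then 1 else 0)
    (hA : 1 ≤ A) (hmA : m ≤ A) :
    Tri A K orderProg s (20 * (m + 1) ^ 3) fun s' => ∃ S, OrderPost m Qd z S s' := by
  rcases Nat.eq_zero_or_pos m with hm0 | hm
  · refine (Tri.seq (τ₁ := 1 + 0 * (1 + 1)) (R := fun s' => s'.reg 2 = 0)
      (Tri.loop 0 (by rw [h2, hm0]) (fun _ s' => s'.reg 2 = 0) (by rw [h2, hm0])
        (fun j hj => absurd hj (Nat.not_lt_zero j)) (by simp)) fun s1 f1 g1 =>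
      Tri.seq (τ₁ := 1 + 0 * (1 + 1)) (R := fun s' => s'.reg 2 = 0)
        (Tri.loop 0 g1 (fun _ s' => s'.reg 2 = 0) g1
        (fun j hj => absurd hj (Nat.not_lt_zero j)) (by simp)) fun s2 f2 g2 =>
      Tri.seq (τ₁ := 1 + 0 * (1 + 1)) (R := fun s' => s'.reg 2 = 0)
        (Tri.loop 0 g2 (fun _ s' => s'.reg 2 = 0) g2
        (fun j hj => absurd hj (Nat.not_lt_zero j)) (by simp)) fun s3 f3 g3 =>
      Tri.assign (v := 1) ?_ hA (by simp) ?_).mono ?_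
    · simp [Tm.val, g3]
    · refine ⟨fun _ _ => False, ?_, ⟨?_, ?_, ?_, ?_, ?_⟩, ?_, ?_⟩ <;> simp [hm0]
    · rw [hm0]; norm_num
  have hord : ∀ c, ord m z c < m := fun c => Nat.mod_lt _ hm
  refine (Tri.seq (τ₁ := 1 + m * (1 + 1)) (R := fun s' => ∀ c < m, s'.arr 7 c = ord m z c)
    (τ₂ := (1 + m * (2 + 2 * m)) + ((1 + m * (1 + (1 + m * (1 + (1 + m * (1 + 1)))))) + 1))
    ?_ ?_).mono ?_
  · refine Tri.loop m h2 (fun i s' => ∀ c < i, s'.arr 7 c = ord m z c)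
      (fun c hc => absurd hc (Nat.not_lt_zero c)) ?_ fun s' _ h => h
    intro i hi s1 f1 i1
    refine Tri.store (x := i) (v := ord m z i) (by simp [Tm.val]) ?_ ((hord i).le.trans hmA) ?_
    · simp [Tm.val, f1.reg 11 (by decide), h11, f1.reg 2 (by decide), h2, f1.arr 3 (by decide),
        h3 i hi.le, ord]
    · intro c hc
      rw [State.upd_arr]
      split
      · rename_i h; rw [h.2]
      · rename_i h
        exact i1 c (lt_of_le_of_ne (Nat.lt_succ_iff.1 hc) (fun h' => h ⟨rfl, h'⟩))
  · intro s1 f1 h7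
    set M : ℕ → ℕ → Prop := fun c j => Qd (ord m z c) (ord m z j) with hM
    have g2 : s1.reg 2 = m := by rw [f1.reg 2 (by decide), h2]
    refine Tri.seq (R := FillState m M fun _ _ _ => False) ?_ ?_
    · refine (fill_tri (m := m) (fun c j => if c < j ∧ M c j then 1 else 0) g2 ?_).weaken ?_
      · intro c hc j hj s2 f2 g15 g16
        refine ⟨?_, by split_ifs <;> omega⟩
        simp only [Tm.val, eval_mul, eval_lt, eval_reg, eval_load, eval_add, g15, g16,
          f2.reg 2 (by decide), g2, f2.arr 6 (by decide), f2.arr 7 (by decide), h7 c hc, h7 j hj,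
          f1.arr 6 (by decide), h6 _ (hord c) _ (hord j)]
        by_cases h : c < j <;> simp [h, hM]
      · intro s2 f2 i2
        refine ⟨fun c j => (c < j ∧ j < m) ∧ M c j, ⟨fun c j h => h.1.1, fun c j h => h.1.2,
          fun c j h1 h2 h3 => ⟨⟨h1, h2⟩, h3⟩, fun C hC c j h => hC.sub c j h.1.1 h.1.2 h.2,
          fun c a b h => h.elim⟩, fun c hc j hj => ?_⟩
        rw [i2 c hc j hj]
        simp [hj]
    · intro s2 f2 i2
      have g2' : s2.reg 2 = m := by rw [f2.reg 2 (by decide), g2]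
      refine Tri.seq (elimLoop_tri g2' hA i2) ?_
      rintro s3 f3 ⟨S, hS, hs⟩
      have q2 : s3.reg 2 = m := by rw [f3.reg 2 (by decide), g2']
      have q11 : s3.reg 11 = z := by
        rw [f3.reg 11 (by decide), f2.reg 11 (by decide), f1.reg 11 (by decide), h11]
      have q7 : ∀ c < m, s3.arr 7 c = ord m z c := by
        rw [f3.arr 7 (by decide), f2.arr 7 (by decide)]; exact h7
      have q3 : s3.arr 3 m = m ^ m := by
        rw [f3.arr 3 (by decide), f2.arr 3 (by decide), f1.arr 3 (by decide)]; exact h3 m le_rfl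
      have hv : ∀ v, (v ≠ 0 ↔ (∀ i < m, ∀ j < m, i < j → ord m z i ≠ ord m z j) ∧
          ∀ c < m, rk S c m ≤ z / m ^ m) → ∃ S, OrderPost m Qd z S (s3.set 12 v) :=
        fun v hv => ⟨S, by simpa using q7, hS, by simpa using hs, by simpa using hv⟩
      have e : (Tm.prod 50 (.prod 51 (1 - lt (reg 50) (reg 51) * eq (load 7 (reg 50))
          (load 7 (reg 51)))) * .prod 50 (1 - lt (reg 11 / load 3 (reg 2))
          (.sum 51 (mat 8 (reg 50) (reg 51))))).val s3 =
          (∏ i ∈ range m, ∏ j ∈ range m, (1 - if i < j ∧ ord m z i = ord m z j then 1 else 0)) *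
          ∏ c ∈ range m, (1 - if z / m ^ m < rk S c m then 1 else 0) := by
        simp only [Tm.val, eval_mul, eval_prod, eval_sub, eval_lt, eval_num, eval_reg, eval_load,
          eval_add, eval_eq, eval_div, eval_sum, Function.update_apply, Nat.reduceEqDiff, reduceIte,
          q2, q11, q3]
        congr 1
        · refine prod_congr rfl fun i hi => prod_congr rfl fun j hj => ?_
          rw [q7 i (mem_range.1 hi), q7 j (mem_range.1 hj)]
          by_cases h1 : i < j <;> simp [h1]
        · refine prod_congr rfl fun c hc => ?_
          rw [show ∑ l ∈ range m, s3.arr 8 (c * m + l) = rk S c m from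
            sum_congr rfl fun l hl => hs c (mem_range.1 hc) l (mem_range.1 hl)]
      have hle : ∀ (q : ℕ → Prop) [DecidablePred q],
          ∏ a ∈ range m, (1 - if q a then 1 else 0) ≤ 1 := fun q _ =>
        Finset.prod_le_one' fun a _ => Nat.sub_le _ _
      refine Tri.assign e ((Nat.mul_le_mul (Finset.prod_le_one' fun a _ => hle _) (hle _)).trans
        (by omega)) (by simp) (hv _ ?_)
      rw [mul_ne_zero_iff, prod_ne_zero_iff, prod_ne_zero_iff]
      simp only [prod_ne_zero_iff, mem_range]
      refine and_congr ?_ ?_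
      · refine forall₂_congr fun i _ => forall₂_congr fun j _ => ?_
        by_cases h1 : i < j <;> by_cases h2 : ord m z i = ord m z j <;> simp [h1, h2]
      · refine forall₂_congr fun c _ => ?_
        by_cases h : z / m ^ m < rk S c m
        · simp [h]
        · simp [h, not_lt.1 h]
  · ring_nf; nlinarith [hm]

/-- If some order of small width exists, then the search finds an order whose width is at most as
large. -/
theorem searchProg_tri {Qd : ℕ → ℕ → Prop} {s : State} {z₀ : ℕ} (h2 : s.reg 2 = m)
    (h3 : ∀ i ≤ m, s.arr 3 i = m ^ i)
    (h6 : ∀ a < m, ∀ b < m, s.arr 6 (a * m + b) = open Classical in if Qd a b then 1 else 0)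
    (hA : 1 ≤ A) (hmA : m ^ (m + 1) ≤ A) (hm : 1 ≤ m) (hz : z₀ < m ^ (m + 1))
    (hinj : ∀ i < m, ∀ j < m, i < j → ord m z₀ i ≠ ord m z₀ j) {C : ℕ → ℕ → Prop}
    (hC : Closed m (fun c j => Qd (ord m z₀ c) (ord m z₀ j)) C)
    (hw : ∀ c (t : Finset ℕ), (∀ j ∈ t, j < m ∧ c < j ∧ C c j) → #t ≤ z₀ / m ^ m) :
    Tri A K searchProg s (3 + m ^ (m + 1) * (2 + 20 * (m + 1) ^ 3)) fun s' =>
      ∃ z S, OrderPost m Qd z S s' ∧ s'.reg 12 ≠ 0 ∧ z / m ^ m ≤ z₀ / m ^ m := by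
  classical
  refine (Tri.seq_assign (v := 0) (by simp [Tm.val]) (Nat.zero_le _) (by simp)
    (Tri.seq_assign (v := m ^ (m + 1)) (by simp [Tm.val, h2, h3 m le_rfl, pow_succ]) hmA (by simp)
    (Tri.loop (τ := 1 + 20 * (m + 1) ^ 3) (m ^ (m + 1)) (by simp) (fun j s' =>
      (s'.reg 12 = 0 → j ≤ z₀) ∧ (s'.reg 12 ≠ 0 → ∃ z ≤ z₀, ∃ S, OrderPost m Qd z S s'))
      (by simp) ?_ ?_))).mono (by ring_nf; rfl)
  · rintro z - s1 f1 ⟨i1, i2⟩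
    refine Tri.ite (fun h => Tri.mono (Tri.skip ?_) ?_) fun h => ?_
    · have h : s1.reg 12 ≠ 0 := by simpa [Tm.val] using h
      refine ⟨fun h' => absurd h' (by simpa using h), fun _ => ?_⟩
      obtain ⟨z', hz', S, o1, o2, o3, o4⟩ := i2 h
      exact ⟨z', hz', S, o1, o2, o3, o4⟩
    · have := Nat.one_le_pow 3 (m + 1) (by omega); omega
    · have h : s1.reg 12 = 0 := by simpa [Tm.val] using h
      have hzz := i1 h
      refine (orderProg_tri (m := m) (Qd := Qd) (z := z) ?_ ?_ ?_ ?_ hA ?_).weaken ?_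
      · simp [f1.reg 2 (by decide), h2]
      · simp
      · simpa [f1.arr 3 (by decide)] using h3
      · simpa [f1.arr 6 (by decide)] using h6
      · exact (Nat.le_self_pow (by omega) m).trans hmA
      · rintro s' _ ⟨S, hS⟩
        refine ⟨fun h0 => ?_, fun _ => ⟨z, hzz, S, hS⟩⟩
        by_contra hcon
        obtain rfl : z = z₀ := by omega
        refine hS.found.2 ⟨hinj, fun c hc => ?_⟩ h0
        have : rk S c m = #((range m).filter fun j => S c j) := by
          rw [rk, card_filter]
        rw [this]
        refine hw c _ fun j hj => ?_
        rw [mem_filter, mem_range] at hj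
        exact ⟨hj.1, hS.inv.lt _ _ hj.2, hS.inv.least C hC _ _ hj.2⟩
  · rintro s1 f1 ⟨i1, i2⟩
    have h12 : s1.reg 12 ≠ 0 := fun h => by have := i1 h; omega
    obtain ⟨z, hz', S, o1, o2, o3, o4⟩ := i2 h12
    refine ⟨z, S, ⟨by simpa using o1, o2, by simpa using o3, by simpa using o4⟩, by simpa using h12,
      Nat.div_le_div_right hz'⟩

end WordRAM

namespace WordRAM

open Tm Finset

/-! ### Counting injective homomorphisms -/

variable {A K m n w : ℕ}

theorem ord_lt (hm : 1 ≤ m) (z c : ℕ) : ord m z c < m := Nat.mod_lt _ hm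

/-- The function with code `z`. -/
def decodeFun (hm : 1 ≤ m) (z : ℕ) (i : Fin m) : Fin m := ⟨ord m z i, ord_lt hm z i⟩

/-- An order is encoded together with a width `w < m` in one number below `m ^ (m + 1)`. -/
theorem exists_code (hm : 1 ≤ m) (hw : w < m) (f : Fin m → Fin m) :
    ∃ z < m ^ (m + 1), z / m ^ m = w ∧ ∀ c : Fin m, ord m z c = f c := by
  have hy := (finFunctionFinEquiv f).2
  have hpos : 0 < m ^ m := Nat.pow_pos hm
  refine ⟨(finFunctionFinEquiv f : ℕ) + m ^ m * w, ?_, ?_, fun c => ?_⟩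
  · calc (finFunctionFinEquiv f : ℕ) + m ^ m * w < m ^ m + m ^ m * w := by omega
      _ = m ^ m * (w + 1) := by ring
      _ ≤ m ^ m * m := Nat.mul_le_mul_left _ hw
      _ = _ := (pow_succ _ _).symm
  · rw [Nat.add_mul_div_left _ _ hpos, Nat.div_eq_of_lt hy, zero_add]
  · have h1 := finFunctionFinEquiv_symm_apply_val (finFunctionFinEquiv f) c
    rw [Equiv.symm_apply_apply] at h1
    obtain ⟨d, hd⟩ := Nat.exists_eq_add_of_lt c.2
    have h2 : m ^ m = m ^ (c : ℕ) * (m * m ^ d) := by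
      conv_lhs => rw [show m ^ m = m ^ ((c : ℕ) + d + 1) by rw [← hd]]
      ring
    rw [ord, h1]
    have h3 : (finFunctionFinEquiv f : ℕ) + m ^ m * w =
        (finFunctionFinEquiv f : ℕ) + m ^ (c : ℕ) * (m * (m ^ d * w)) := by
      rw [Nat.add_left_cancel_iff]
      calc m ^ m * w = m ^ (c : ℕ) * (m * m ^ d) * w := by rw [h2]
        _ = _ := by ring
    rw [h3, Nat.add_mul_div_left _ _ (Nat.pow_pos hm), Nat.add_mul_mod_self_left]

/-- The quotient of `B` by the fibres of `R` has an elimination order of width at most `w`: there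
are a linear order `σ` and a graph `C` on the positions that contains the quotient, is closed under
elimination and in which every position has at most `w` later neighbours. -/
def HasOrder (B : SimpleGraph (Fin m)) (R : Fin m → Fin m) (w : ℕ) : Prop :=
  ∃ (σ : Equiv.Perm (Fin m)) (C : Fin m → Fin m → Prop),
    (∀ i j, InjCount.QAdj B R (σ i) (σ j) → C i j) ∧
    (∀ c i j, c < i → i < j → C c i → C c j → C i j) ∧
    ∀ i (s : Finset (Fin m)), (∀ j ∈ s, i < j ∧ C i j) → #s ≤ w

/-- A relation on `Fin m` as a relation on the natural numbers. -/
theorem exists_rel_extend (R : Fin m → Fin m → Prop) :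
    ∃ Q : ℕ → ℕ → Prop, ∀ a b : Fin m, Q a b ↔ R a b := by
  refine ⟨fun a b => ∃ a' b' : Fin m, (a' : ℕ) = a ∧ (b' : ℕ) = b ∧ R a' b', fun a b =>
    ⟨?_, fun h => ⟨a, b, rfl, rfl, h⟩⟩⟩
  rintro ⟨a', b', h1, h2, h⟩
  rwa [Fin.ext h1, Fin.ext h2] at h

theorem homCount_le (B : SimpleGraph (Fin m)) (G : SimpleGraph (Fin n)) (p : Fin m → Fin m) :
    InjCount.homCount B G p ≤ n ^ m := by
  classical
  refine (card_filter_le _ _).trans ?_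
  simp

open Classical in
/-- For a quotient without loops, searching an order and running the dynamic program along it counts
the homomorphisms that factor through the quotient. -/
theorem searchDP_tri {B : SimpleGraph (Fin m)} {G : SimpleGraph (Fin n)} {p : Fin m → Fin m}
    {s : State} (hm : 1 ≤ m) (hn : 1 ≤ n) (h2 : s.reg 2 = m) (h3 : s.reg 3 = n)
    (hpow : ∀ i ≤ m, s.arr 3 i = m ^ i ∧ s.arr 4 i = n ^ i)
    (hG : ∀ u v : Fin n, s.arr 1 (u * n + v) = if G.Adj u v then 1 else 0)
    (hq : QuotPost B p s) (hp : ∀ i, p i ≤ i) (hl : ∀ a, ¬InjCount.QAdj B (rootOf p) a a)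
    (hw : w < m) (ho : HasOrder B (rootOf p) w) (hA : m ^ (m + 1) ≤ A) (hA' : n ^ m ≤ A) :
    Tri A K (searchProg ;; dpProg) s
      ((3 + m ^ (m + 1) * (2 + 20 * (m + 1) ^ 3)) + 11 * (m + 1) * n ^ (w + 1))
      fun s' => s'.reg 23 = InjCount.homCount B G p := by
  have : NeZero n := ⟨by omega⟩
  obtain ⟨σ, C, c1, c2, c3⟩ := ho
  obtain ⟨z₀, hz, hzw, hzσ⟩ := exists_code hm hw σ
  obtain ⟨Qd, hQ⟩ := exists_rel_extend (InjCount.QAdj B (rootOf p))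
  obtain ⟨Ad, hAd⟩ := exists_rel_extend G.Adj
  refine Tri.seq (searchProg_tri (m := m) (Qd := Qd) (z₀ := z₀)
    (C := fun i j => ∃ i' j' : Fin m, (i' : ℕ) = i ∧ (j' : ℕ) = j ∧ C i' j')
    h2 (fun i hi => (hpow i hi).1) ?_ ((Nat.one_le_pow _ _ hm).trans hA) hA hm hz ?_ ⟨?_, ?_⟩ ?_) ?_
  · intro a ha b hb
    have := hq.adj ⟨a, ha⟩ ⟨b, hb⟩
    simp only at this
    rw [this]
    exact if_congr (hQ ⟨a, ha⟩ ⟨b, hb⟩).symm rfl rfl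
  · intro i hi j hj hij h
    have h1 := hzσ ⟨i, hi⟩
    have h2 := hzσ ⟨j, hj⟩
    simp only at h1 h2
    rw [h1, h2] at h
    have := congrArg Fin.val (σ.injective (Fin.ext h))
    simp only at this
    omega
  · intro c j hcj hj h
    refine ⟨⟨c, hcj.trans hj⟩, ⟨j, hj⟩, rfl, rfl, c1 _ _ ?_⟩
    rw [← hQ, ← hzσ, ← hzσ]
    exact h
  · rintro c i j hci hij hj ⟨c', i', rfl, rfl, h1⟩ ⟨c'', j', h2, rfl, h3⟩
    rw [Fin.ext h2] at h3
    exact ⟨i', j', rfl, rfl, c2 c' i' j' hci hij h1 h3⟩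
  · intro c t ht
    rw [hzw]
    rcases t.eq_empty_or_nonempty with rfl | ⟨j, hj⟩
    · simp
    have hc : c < m := (ht j hj).2.1.trans (ht j hj).1
    have := c3 ⟨c, hc⟩ (univ.filter fun j : Fin m => (j : ℕ) ∈ t) ?_
    · refine le_trans (le_of_eq ?_) this
      refine card_bij' (fun j hj => ⟨j, (ht j hj).1⟩) (fun j _ => j) ?_ ?_ ?_ ?_ <;> simp
    · intro j hj
      obtain ⟨-, h1, i', j', h2, h3, h4⟩ := ht j (by simpa using hj)
      rw [Fin.ext (a := i') (b := ⟨c, hc⟩) h2, Fin.ext h3] at h4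
      exact ⟨h1, h4⟩
  · rintro s1 f1 ⟨z, S, hO, h12, hzz⟩
    have hf := hO.found.1 h12
    have hinj : Function.Injective (decodeFun hm z) := by
      intro i j h
      have h' : ord m z i = ord m z j := congrArg Fin.val h
      rcases lt_trichotomy i j with h1 | h1 | h1
      · exact absurd h' (hf.1 i i.2 j j.2 h1)
      · exact h1
      · exact absurd h'.symm (hf.1 j j.2 i i.2 h1)
    let τ : Equiv.Perm (Fin m) := Equiv.ofBijective _ (Finite.injective_iff_bijective.1 hinj)
    have hτ : ∀ c : Fin m, (τ c : ℕ) = ord m z c := fun c => rfl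
    have a5 : ∀ i : Fin m, s1.arr 5 i = rootOf p i := by rw [f1.arr 5 (by decide)]; exact hq.root
    refine (dpProg_tri (m := m) (n := n) (S := S) (M := fun c j => Qd (ord m z c) (ord m z j))
      (Ad := Ad)
      (Rt := fun c => ∃ a : Fin m, (a : ℕ) = ord m z c ∧ rootOf p a = a) (e := w + 1)
      ⟨?_, hO.fill, ?_, ?_, ?_, hO.inv.lt, hO.inv.lt', fun c i j h1 h2 h3 =>
        hO.inv.closed c i j trivial h3 h1 h2, hO.inv.sub⟩ ?_ ?_ hn hA' ?_).weaken ?_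
    · intro r hr; rw [f1.arr 4 (by decide)]; exact (hpow r hr).2
    · intro c hc j hj _
      rw [hO.ord c hc, hO.ord j hj, f1.arr 6 (by decide)]
      have := hq.adj (τ ⟨c, hc⟩) (τ ⟨j, hj⟩)
      rw [hτ, hτ] at this
      rw [this]
      exact if_congr (hQ _ _).symm rfl rfl
    · intro c hc
      have := a5 (τ ⟨c, hc⟩)
      rw [hτ] at this
      simp only at this
      rw [hO.ord c hc, this]
      constructor
      · intro h
        exact ⟨τ ⟨c, hc⟩, rfl, Fin.ext h⟩
      · rintro ⟨a, h1, h2⟩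
        rw [show τ ⟨c, hc⟩ = a from Fin.ext h1.symm, h2, h1]
    · intro u hu v hv
      rw [f1.arr 1 (by decide)]
      have := hG ⟨u, hu⟩ ⟨v, hv⟩
      simp only at this
      rw [this]
      exact if_congr (hAd ⟨u, hu⟩ ⟨v, hv⟩).symm rfl rfl
    · rw [f1.reg 2 (by decide), h2]
    · rw [f1.reg 3 (by decide), h3]
    · intro c hc
      have := hf.2 c hc
      omega
    · intro s2 _ h
      rw [h]
      refine InjCount.total_weight (isRoot_rootOf hp) hl τ ?_ ?_ ?_ hO.inv.lt hO.inv.sub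
      · intro c
        constructor
        · rintro ⟨a, h1, h2⟩
          rwa [show τ c = a from Fin.ext h1.symm]
        · exact fun h => ⟨τ c, rfl, h⟩
      · intro c j; exact hQ (τ c) (τ j)
      · exact hAd

open Classical in
/-- The contribution of the function with code `c` if the number of moved points has parity `b`. -/
noncomputable def signedTerm (hm : 1 ≤ m) (B : SimpleGraph (Fin m)) (G : SimpleGraph (Fin n))
    (b c : ℕ) : ℕ :=
  if (∀ i, decodeFun hm c i ≤ i) ∧ #{i | decodeFun hm c i < i} % 2 = b then
    InjCount.homCount B G (decodeFun hm c) else 0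

/-- The positive terms exceed the negative ones by the number of injective homomorphisms, so the
truncated subtraction is exact. -/
theorem injCount_eq_sub (hm : 1 ≤ m) (B : SimpleGraph (Fin m)) (G : SimpleGraph (Fin n)) :
    (∑ c ∈ range (m ^ m), signedTerm hm B G 0 c) - ∑ c ∈ range (m ^ m), signedTerm hm B G 1 c =
      InjCount.injCount B G := by
  classical
  have h : (InjCount.injCount B G : ℤ) = (∑ c ∈ range (m ^ m), signedTerm hm B G 0 c : ℕ) -
      (∑ c ∈ range (m ^ m), signedTerm hm B G 1 c : ℕ) := by
    rw [InjCount.injCount_eq, ← finFunctionFinEquiv.symm.sum_comp, Finset.sum_range,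
      Finset.sum_range, Nat.cast_sum, Nat.cast_sum, ← Finset.sum_sub_distrib]
    refine sum_congr rfl fun c _ => ?_
    have hd : finFunctionFinEquiv.symm c = decodeFun hm c := by
      funext i
      exact Fin.ext (finFunctionFinEquiv_symm_apply_val c i)
    rw [hd]
    unfold signedTerm
    by_cases h1 : ∀ i, decodeFun hm c i ≤ i
    · simp only [h1, implies_true, true_and, if_true]
      rcases Nat.mod_two_eq_zero_or_one (#{i | decodeFun hm c i < i}) with h2 | h2
      · rw [(Nat.even_iff.2 h2).neg_one_pow]; simp [h2]
      · rw [(Nat.odd_iff.2 h2).neg_one_pow]; simp [h2]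
    · simp [h1]
  omega

theorem sum_signedTerm_le (hm : 1 ≤ m) (B : SimpleGraph (Fin m)) (G : SimpleGraph (Fin n))
    (b : ℕ) {j : ℕ} (hj : j ≤ m ^ m) : ∑ c ∈ range j, signedTerm hm B G b c ≤ m ^ m * n ^ m := by
  refine (sum_le_card_nsmul _ _ (n ^ m) fun c _ => ?_).trans ?_
  · unfold signedTerm
    split_ifs
    · exact homCount_le _ _ _
    · exact Nat.zero_le _
  · simpa using Nat.mul_le_mul_right _ hj

open Classical in
/-- The number of steps is `m ^ O(m) * n ^ (w + 1)` if all quotients without loops have an elimination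
order of width at most `w`. -/
theorem injProg_tri {B : SimpleGraph (Fin m)} {G : SimpleGraph (Fin n)}
    {s : State} (hm : 1 ≤ m) (hn : 1 ≤ n) (h2 : s.reg 2 = m) (h3 : s.reg 3 = n)
    (hB : ∀ i j : Fin m, s.arr 2 (i * m + j) = if B.Adj i j then 1 else 0)
    (hG : ∀ u v : Fin n, s.arr 1 (u * n + v) = if G.Adj u v then 1 else 0)
    (hw : w < m) (ho : ∀ p : Fin m → Fin m, (∀ i, p i ≤ i) →
      (∀ a, ¬InjCount.QAdj B (rootOf p) a a) → HasOrder B (rootOf p) w)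
    (h2A : 2 ≤ A) (hA : m ^ (m + 1) ≤ A) (hA' : m ^ m * n ^ m ≤ A) :
    Tri A K injProg s (100 * (m + 1) ^ (2 * m + 4) * n ^ (w + 1))
      fun s' => s'.reg 23 = InjCount.injCount B G := by
  have hmm : 1 ≤ m ^ m := Nat.one_le_pow _ _ hm
  have hnm : 1 ≤ n ^ m := Nat.one_le_pow _ _ hn
  have hA1 : m ^ m ≤ A := (Nat.pow_le_pow_right hm (by omega)).trans hA
  have hA2 : n ^ m ≤ A := (Nat.le_mul_of_pos_left _ hmm).trans hA'
  have hmA : m ≤ A := (Nat.le_self_pow (by omega) m).trans hA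
  refine (Tri.seq (powersProg_tri h2 h3 hm hn hA1 hA2)
    (τ₂ := 1 + (1 + (1 + ((1 + m ^ m * (1 + ((4 + m * (4 + 2 * m)) + (1 +
      (((3 + m ^ (m + 1) * (2 + 20 * (m + 1) ^ 3)) + 11 * (m + 1) * n ^ (w + 1)) + (1 + 1)))))) + 1))))
    ?_).mono ?_
  · intro s1 f1 hpow
    have g2 : s1.reg 2 = m := by rw [f1.reg 2 (by decide), h2]
    have g3 : s1.reg 3 = n := by rw [f1.reg 3 (by decide), h3]
    refine Tri.seq_assign (v := 0) (by simp [Tm.val]) (Nat.zero_le _) (by simp) ?_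
    refine Tri.seq_assign (v := 0) (by simp [Tm.val]) (Nat.zero_le _) (by simp) ?_
    refine Tri.seq_assign (v := m ^ m) (by simp [Tm.val, g2, hpow m le_rfl]) hA1 (by simp) ?_
    refine Tri.seq (R := fun s' => s'.reg 4 = ∑ c ∈ range (m ^ m), signedTerm hm B G 0 c ∧
      s'.reg 5 = ∑ c ∈ range (m ^ m), signedTerm hm B G 1 c) ?_ ?_
    · refine Tri.loop (m ^ m) (by simp) (fun j s' =>
        s'.reg 4 = ∑ c ∈ range j, signedTerm hm B G 0 c ∧
        s'.reg 5 = ∑ c ∈ range j, signedTerm hm B G 1 c) (by simp) ?_ ?_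
      · rintro j hj s2 f2 ⟨i4, i5⟩
        set p := decodeFun hm j with hp
        set s3 := s2.set 7 j with hs3
        have q2 : s3.reg 2 = m := by simp [hs3, f2.reg 2 (by decide), g2]
        have q3 : s3.reg 3 = n := by simp [hs3, f2.reg 3 (by decide), g3]
        have qp : ∀ i ≤ m, s3.arr 3 i = m ^ i ∧ s3.arr 4 i = n ^ i := by
          simpa [hs3, f2.arr 3 (by decide), f2.arr 4 (by decide)] using hpow
        have qB : ∀ i j : Fin m, s3.arr 2 (i * m + j) = if B.Adj i j then 1 else 0 := by
          simpa [hs3, f2.arr 2 (by decide), f1.arr 2 (by decide)] using hB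
        have qG : ∀ u v : Fin n, s3.arr 1 (u * n + v) = if G.Adj u v then 1 else 0 := by
          simpa [hs3, f2.arr 1 (by decide), f1.arr 1 (by decide)] using hG
        refine Tri.seq (quotProg_tri (p := p) q2 (by simp [hs3]) (fun i => rfl)
          (fun i hi => (qp i hi).1) qB h2A hmA) ?_
        intro s4 f4 hq
        have u4 : s4.reg 4 = s2.reg 4 := by simp [f4.reg 4 (by decide), hs3]
        have u5 : s4.reg 5 = s2.reg 5 := by simp [f4.reg 5 (by decide), hs3]
        refine Tri.ite (fun h8 => ?_) (fun h8 => ?_)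
        · obtain ⟨v1, v2⟩ := hq.valid.1 (by simpa [Tm.val] using h8)
          have hseq := searchDP_tri (A := A) (K := K) (G := G) (w := w) hm hn
            (by rw [f4.reg 2 (by decide), q2]) (by rw [f4.reg 3 (by decide), q3])
            (by rw [f4.arr 3 (by decide), f4.arr 4 (by decide)]; exact qp)
            (by rw [f4.arr 1 (by decide)]; exact qG) hq v1 v2 hw (ho p v1 v2) hA hA2
          have h' := hseq.seq (q := .ite (reg 9) (.assign 5 (reg 5 + reg 23))
              (.assign 4 (reg 4 + reg 23))) (τ₂ := 1 + 1)
            (Q := fun s' => s'.reg 4 = ∑ c ∈ range (j + 1), signedTerm hm B G 0 c ∧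
              s'.reg 5 = ∑ c ∈ range (j + 1), signedTerm hm B G 1 c) ?_
          · -- Sequential composition is associative.
            obtain ⟨⟨⟨k1, k2⟩, k3⟩, k4, k5⟩ := h'
            refine ⟨⟨k1, k2, k3⟩, le_trans (Nat.add_assoc _ _ _).ge k4, k5⟩
          intro s5 f5 h23
          have w4 : s5.reg 4 = ∑ c ∈ range j, signedTerm hm B G 0 c := by
            rw [f5.reg 4 (by decide), u4, i4]
          have w5 : s5.reg 5 = ∑ c ∈ range j, signedTerm hm B G 1 c := by
            rw [f5.reg 5 (by decide), u5, i5]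
          have w9 : s5.reg 9 = #{i | p i < i} % 2 := by
            rw [f5.reg 9 (by decide)]; exact hq.parity
          have ht : ∀ b, signedTerm hm B G b j = if #{i | p i < i} % 2 = b then
              InjCount.homCount B G p else 0 := by
            intro b
            unfold signedTerm
            rw [← hp]
            simp [v1]
          have hb := fun b => (sum_signedTerm_le hm B G b (Nat.succ_le_of_lt hj)).trans hA'
          refine Tri.ite (fun h9 => ?_) (fun h9 => ?_)
          · have h9 : #{i | p i < i} % 2 = 1 := by
              have : s5.reg 9 ≠ 0 := by simpa [Tm.val] using h9
              omega
            have e : (reg 5 + reg 23 : Tm).val s5 = ∑ c ∈ range (j + 1), signedTerm hm B G 1 c := by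
              rw [sum_range_succ, ht, if_pos h9]
              simp [Tm.val, w5, h23]
            refine Tri.assign e (hb 1) (by simp) ⟨?_, by simp⟩
            simp [sum_range_succ, ht, h9, w4]
          · have h9 : #{i | p i < i} % 2 = 0 := by
              have : s5.reg 9 = 0 := by simpa [Tm.val] using h9
              omega
            have e : (reg 4 + reg 23 : Tm).val s5 = ∑ c ∈ range (j + 1), signedTerm hm B G 0 c := by
              rw [sum_range_succ, ht, if_pos h9]
              simp [Tm.val, w4, h23]
            refine Tri.assign e (hb 0) (by simp) ⟨by simp, ?_⟩
            simp [sum_range_succ, ht, h9, w5]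
        · have hz : ∀ b, signedTerm hm B G b j = 0 := by
            intro b
            unfold signedTerm
            split_ifs with h
            · by_contra h0
              refine (hq.valid.2 ⟨h.1, fun a ha => h0 ?_⟩) (by simpa [Tm.val] using h8)
              exact (isRoot_rootOf h.1).homCount_eq_zero ha
            · rfl
          refine (Tri.skip ?_).mono (by omega)
          simp [sum_range_succ, hz, u4, u5, i4, i5]
      · intro s2 _ h; simpa using h
    · rintro s2 f2 ⟨h4, h5⟩
      have e : (reg 4 - reg 5 : Tm).val s2 = InjCount.injCount B G := by
        rw [← injCount_eq_sub hm]
        simp [Tm.val, h4, h5]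
      refine Tri.assign e ?_ (by simp) (by simp)
      rw [← injCount_eq_sub hm]
      exact ((Nat.sub_le _ _).trans (sum_signedTerm_le hm B G 0 le_rfl)).trans hA'
  · set N := n ^ (w + 1)
    have hN : 1 ≤ N := Nat.one_le_pow _ _ hn
    have hM : m ≤ m + 1 := by omega
    set M := m + 1 with hMdef
    have hM1 : 1 ≤ M := by omega
    have p1 : m ^ m ≤ M ^ m := Nat.pow_le_pow_left hM _
    have p2 : m ^ M ≤ M ^ (m + 1) := Nat.pow_le_pow_left hM _
    have p3 : ∀ a b, a ≤ b → M ^ a ≤ M ^ b := fun a b h => Nat.pow_le_pow_right hM1 h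
    have q1 : M ≤ M ^ (m + 4) := Nat.le_self_pow (by omega) M
    have q2 : M ^ 2 ≤ M ^ (m + 4) := p3 _ _ (by omega)
    have q3 : m ^ M * (2 + 20 * M ^ 3) ≤ 22 * M ^ (m + 4) := by
      have : 2 + 20 * M ^ 3 ≤ 22 * M ^ 3 := by have := Nat.one_le_pow 3 M hM1; omega
      calc _ ≤ M ^ (m + 1) * (22 * M ^ 3) := Nat.mul_le_mul p2 this
        _ = _ := by ring
    have q4 : m * (4 + 2 * m) ≤ 4 * M ^ (m + 4) := by nlinarith
    set X := M ^ (m + 4) with hX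
    have hX1 : 1 ≤ X := Nat.one_le_pow _ _ hM1
    have hXN : X ≤ X * N := Nat.le_mul_of_pos_right _ hN
    have q5 : 11 * M * N ≤ 11 * (X * N) := by
      rw [mul_assoc]; exact Nat.mul_le_mul_left _ (Nat.mul_le_mul_right _ q1)
    have inner : 1 + ((4 + m * (4 + 2 * m)) + (1 + (((3 + m ^ M * (2 + 20 * M ^ 3)) +
        11 * M * N) + (1 + 1)))) ≤ 50 * (X * N) := by omega
    have outer : m ^ m * (1 + ((4 + m * (4 + 2 * m)) + (1 + (((3 + m ^ M *
        (2 + 20 * M ^ 3)) + 11 * M * N) + (1 + 1))))) ≤ M ^ m * (50 * (X * N)) :=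
      Nat.mul_le_mul p1 inner
    have e : M ^ (2 * m + 4) * N = M ^ m * (X * N) := by rw [hX]; ring
    have r1 : X * N ≤ M ^ m * (X * N) := Nat.le_mul_of_pos_left _ (Nat.one_le_pow _ _ hM1)
    have e' : 100 * M ^ (2 * m + 4) * N = 100 * (M ^ m * (X * N)) := by rw [mul_assoc, e]
    rw [e']
    have : M ^ m * (50 * (X * N)) = 50 * (M ^ m * (X * N)) := by ring
    omega

end WordRAM

/-! ### Elimination orders of quotients -/

namespace WordRAM

open Finset

theorem hasTreewidthLE_treewidth {r : ℕ} (F : SimpleGraph (Fin r)) :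
    HasTreewidthLE F (treewidth F) := by
  refine Nat.sInf_mem (s := {w | HasTreewidthLE F w}) ⟨r, 1, ⊥, fun _ => univ,
    ⟨.of_subsingleton, fun v => ?_, fun u v _ => ⟨0, by simp, by simp⟩⟩, fun _ => by simp⟩
  have : Nonempty {t : Fin 1 | v ∈ (univ : Finset (Fin r))} := ⟨⟨0, by simp⟩⟩
  exact SimpleGraph.Connected.of_subsingleton

theorem treewidth_le_maxSpasmTreewidth {h r : ℕ} {H : SimpleGraph (Fin h)}
    {F : SimpleGraph (Fin r)} (f : H →g F) (hf : IsSurjectiveHom f) :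
    treewidth F ≤ maxSpasmTreewidth H :=
  (isGreatest_maxSpasmTreewidth H).2 ⟨⟨r, F⟩, ⟨f, hf⟩, rfl⟩

/-- A bag that contains both ends of an edge has at least two elements. -/
theorem one_le_maxSpasmTreewidth {h : ℕ} {H : SimpleGraph (Fin h)} {u v : Fin h}
    (huv : H.Adj u v) : 1 ≤ maxSpasmTreewidth H := by
  refine le_trans ?_ (treewidth_le_maxSpasmTreewidth (SimpleGraph.Hom.id (G := H))
    ⟨fun x => ⟨x, rfl⟩, fun x y hxy => ⟨x, y, hxy, rfl, rfl⟩⟩)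
  by_contra h0
  obtain ⟨k, T, β, hT, hw⟩ := hasTreewidthLE_treewidth H
  obtain ⟨t, hu, hv⟩ := hT.edge_mem u v huv
  have := Finset.card_le_one.1 ((hw t).trans (by omega)) u hu v hv
  exact huv.ne this

/-- `ι` enumerates the vertices of `H` that are not isolated, and `B` is the graph that `H` induces
on them. -/
structure IsPattern {h m : ℕ} (H : SimpleGraph (Fin h)) (B : SimpleGraph (Fin m))
    (ι : Fin m → Fin h) : Prop where
  inj : Function.Injective ι
  adj : ∀ i j, B.Adj i j ↔ H.Adj (ι i) (ι j)
  mem_range : ∀ u v, H.Adj u v → ∃ i, ι i = u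
  exists_adj : ∀ i, ∃ v, H.Adj (ι i) v

/-- A quotient without loops is, up to isolated vertices, a member of the spasm, and so it inherits
an elimination order from a tree decomposition. -/
theorem IsPattern.hasOrder {h m : ℕ} {H : SimpleGraph (Fin h)} {B : SimpleGraph (Fin m)}
    {ι : Fin m → Fin h} (hB : IsPattern H B ι) (hm : 1 ≤ m) {R : Fin m → Fin m}
    (hR : ∀ i, R (R i) = R i) (hl : ∀ a, ¬InjCount.QAdj B R a a) :
    HasOrder B R (min (maxSpasmTreewidth H) (m - 1)) := by
  classical
  let V := {a : Fin m // R a = a}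
  let e : V ≃ Fin (Fintype.card V) := Fintype.equivFin V
  let F : SimpleGraph (Fin (Fintype.card V)) :=
    { Adj := fun x y => InjCount.QAdj B R (e.symm x).1 (e.symm y).1
      symm := ⟨fun x y hxy => hxy.symm⟩
      loopless := ⟨fun x hx => hl _ hx⟩ }
  -- Isolated vertices of `H` may be mapped anywhere.
  let g : Fin h → Fin m := fun v => if hv : ∃ i, ι i = v then hv.choose else ⟨0, hm⟩
  have hg : ∀ i, g (ι i) = i := by
    intro i
    have hv : ∃ i', ι i' = ι i := ⟨i, rfl⟩
    simp only [g, dif_pos hv]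
    exact hB.inj hv.choose_spec
  let f : H →g F :=
    { toFun := fun v => e ⟨R (g v), hR _⟩
      map_rel' := by
        intro u v huv
        obtain ⟨i, rfl⟩ := hB.mem_range u v huv
        obtain ⟨j, rfl⟩ := hB.mem_range v _ huv.symm
        simp only [F, Equiv.symm_apply_apply, hg]
        exact ⟨i, j, (hB.adj i j).2 huv, rfl, rfl⟩ }
  have hfv : ∀ i, f (ι i) = e ⟨R i, hR i⟩ := by
    intro i
    change e ⟨R (g (ι i)), hR _⟩ = _
    simp only [hg]
  have hf : IsSurjectiveHom f := by
    refine ⟨fun x => ⟨ι (e.symm x).1, ?_⟩, ?_⟩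
    · rw [hfv]
      simp [(e.symm x).2]
    · rintro x y ⟨i, j, hij, hi, hj⟩
      refine ⟨ι i, ι j, (hB.adj i j).1 hij, ?_, ?_⟩
      · rw [hfv]; simp [hi]
      · rw [hfv]; simp [hj]
  obtain ⟨k, T, β, hT, hw⟩ := hasTreewidthLE_treewidth F
  have htw := treewidth_le_maxSpasmTreewidth f hf
  let β' : Fin k → Finset (Fin m) := fun t => (β t).map
    (e.symm.toEmbedding.trans (Function.Embedding.subtype _))
  have hβ' : ∀ (v : V) t, v.1 ∈ β' t ↔ e v ∈ β t := by
    intro v t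
    simp only [β', mem_map, Function.Embedding.trans_apply, Equiv.coe_toEmbedding]
    constructor
    · rintro ⟨x, hx, hxv⟩
      rw [← Subtype.ext hxv]; simpa using hx
    · exact fun hx => ⟨e v, hx, by rw [Equiv.symm_apply_apply]; rfl⟩
  have hroot : ∀ v t, v ∈ β' t → R v = v := by
    intro v t hv
    simp only [β', mem_map, Function.Embedding.trans_apply, Equiv.coe_toEmbedding] at hv
    obtain ⟨x, -, rfl⟩ := hv
    exact (e.symm x).2
  -- A vertex of `B` that is not a representative lies in no bag, and its set of nodes is empty.
  have hconn : ∀ v, (T.induce {t | v ∈ β' t}).Preconnected := by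
    intro v
    by_cases hv : R v = v
    · have := (hT.connected (e ⟨v, hv⟩)).preconnected
      have hset : {t | v ∈ β' t} = {t | e ⟨v, hv⟩ ∈ β t} := Set.ext fun t => hβ' ⟨v, hv⟩ t
      rw [hset]
      exact this
    · rintro ⟨t, ht⟩
      exact absurd (hroot v t ht) hv
  have hwidth : ∀ t, #(β' t) ≤ min (maxSpasmTreewidth H) (m - 1) + 1 := by
    intro t
    have h1 : #(β' t) ≤ treewidth F + 1 := by
      rw [card_map]; exact hw t
    have h2 : #(β' t) ≤ m := by simpa using card_le_univ (β' t)
    omega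
  obtain ⟨σ, C, c1, c2, c3⟩ := TreeElim.exists_order hT.isTree hconn hwidth
  refine ⟨σ, C, fun i j hij => ?_, c2, c3⟩
  have hi : R (σ i) = σ i := by
    obtain ⟨a, b, -, h1, -⟩ := hij
    rw [← h1, hR]
  have hj : R (σ j) = σ j := by
    obtain ⟨a, b, -, -, h1⟩ := hij
    rw [← h1, hR]
  obtain ⟨t, h1, h2⟩ := hT.edge_mem (e ⟨_, hi⟩) (e ⟨_, hj⟩) (by
    simpa only [F, Equiv.symm_apply_apply] using hij)
  exact c1 i j t ((hβ' ⟨_, hi⟩ t).2 h1) ((hβ' ⟨_, hj⟩ t).2 h2)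

end WordRAM

/-! ### Copies, injective homomorphisms and isolated vertices -/

namespace InjCount

open Finset Function

variable {V W : Type}

/-- Copies are injective homomorphisms. -/
def copyEquiv (B : SimpleGraph V) (A : SimpleGraph W) :
    B.Copy A ≃ {x : V → W // (∀ i j, B.Adj i j → A.Adj (x i) (x j)) ∧ Injective x} where
  toFun f := ⟨f, fun _ _ h => f.toHom.map_adj h, f.injective⟩
  invFun x := ⟨⟨x.1, fun h => x.2.1 _ _ h⟩, x.2.2⟩
  left_inv _ := rfl
  right_inv _ := rfl

theorem injCount_self_pos [Finite V] (B : SimpleGraph V) : 0 < injCount B B :=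
  have : Nonempty {x : V → V // (∀ i j, B.Adj i j → B.Adj (x i) (x j)) ∧ Injective x} :=
    ⟨⟨id, fun _ _ h => h, injective_id⟩⟩
  Nat.card_pos

/-- An injective endomorphism of a finite graph is an automorphism. -/
theorem _root_.SimpleGraph.Copy.exists_adj_of_adj [Finite V] {B : SimpleGraph V} (g : B.Copy B)
    {a b : V} (h : B.Adj a b) : ∃ c d, B.Adj c d ∧ g c = a ∧ g d = b := by
  obtain ⟨⟨e, he⟩, heq⟩ := (Finite.injective_iff_surjective.1 g.mapEdgeSet.injective)
    ⟨s(a, b), (SimpleGraph.mem_edgeSet B).2 h⟩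
  induction e with
  | _ c d =>
    have h1 : s(g c, g d) = s(a, b) := congrArg Subtype.val heq
    rw [SimpleGraph.mem_edgeSet] at he
    rcases Sym2.eq_iff.1 h1 with ⟨h2, h3⟩ | ⟨h2, h3⟩
    · exact ⟨c, d, he, h2, h3⟩
    · exact ⟨d, c, he.symm, h3, h2⟩

/-- The copies with the same image as `f` arise from `f` by composition with an injective
endomorphism. -/
theorem exists_comp_iff [Finite V] {B : SimpleGraph V} {A : SimpleGraph W} (f f' : B.Copy A) :
    f'.toSubgraph = f.toSubgraph ↔ ∃ g : B.Copy B, f.comp g = f' := by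
  constructor
  · intro h
    have hv : ∀ v, ∃ u, f u = f' v := by
      intro v
      have : f' v ∈ f.toSubgraph.verts := by rw [← h]; exact ⟨v, trivial, rfl⟩
      obtain ⟨u, -, hu⟩ := this
      exact ⟨u, hu⟩
    choose g hg using hv
    have hadj : ∀ {a b}, B.Adj a b → B.Adj (g a) (g b) := by
      intro a b hab
      have : f.toSubgraph.Adj (f' a) (f' b) := by rw [← h]; exact ⟨a, b, hab, rfl, rfl⟩
      obtain ⟨c, d, hcd, hc, hd⟩ := this
      rw [f.injective ((hg a).trans hc.symm), f.injective ((hg b).trans hd.symm)]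
      exact hcd
    have hinj : Injective g := fun a b hab => f'.injective (by
      change f' a = f' b
      rw [← hg a, ← hg b, hab])
    exact ⟨⟨⟨g, hadj⟩, hinj⟩, SimpleGraph.Copy.ext hg⟩
  · rintro ⟨g, rfl⟩
    have hs : Surjective g := Finite.injective_iff_surjective.1 g.injective
    refine SimpleGraph.Subgraph.ext ?_ ?_
    · ext w
      constructor
      · rintro ⟨v, -, rfl⟩; exact ⟨g v, trivial, rfl⟩
      · rintro ⟨v, -, rfl⟩
        obtain ⟨u, rfl⟩ := hs v
        exact ⟨u, trivial, rfl⟩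
    · ext x y
      constructor
      · rintro ⟨a, b, hab, rfl, rfl⟩; exact ⟨g a, g b, g.toHom.map_adj hab, rfl, rfl⟩
      · rintro ⟨a, b, hab, rfl, rfl⟩
        obtain ⟨c, d, hcd, rfl, rfl⟩ := g.exists_adj_of_adj hab
        exact ⟨c, d, hcd, rfl, rfl⟩

/-- Every subgraph of `A` that is isomorphic to `B` is the image of as many injective homomorphisms
as `B` has injective endomorphisms. -/
theorem copyCount_mul [Fintype V] [Fintype W] (B : SimpleGraph V) (A : SimpleGraph W) :
    A.copyCount B * injCount B B = injCount B A := by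
  classical
  have : Fintype (B.Copy A) := Fintype.ofEquiv _ (copyEquiv B A).symm
  have : Fintype (B.Copy B) := Fintype.ofEquiv _ (copyEquiv B B).symm
  have e : ∀ C : SimpleGraph V, injCount B C = Nat.card (B.Copy C) := fun C =>
    (Nat.card_congr (copyEquiv B C)).symm
  have e' : injCount B A = Nat.card (B.Copy A) := (Nat.card_congr (copyEquiv B A)).symm
  have hc : A.copyCount B = #((univ : Finset (B.Copy A)).image SimpleGraph.Copy.toSubgraph) := by
    rw [SimpleGraph.copyCount]
    congr
    refine Finset.coe_injective ?_
    simpa [-SimpleGraph.Copy.range_toSubgraph] using SimpleGraph.Copy.range_toSubgraph.symm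
  rw [hc, e, e', Nat.card_eq_fintype_card, Nat.card_eq_fintype_card, ← card_univ (α := B.Copy A),
    card_eq_sum_card_image SimpleGraph.Copy.toSubgraph univ, sum_const_nat]
  intro S hS
  obtain ⟨f, -, rfl⟩ := mem_image.1 hS
  rw [← card_univ]
  symm
  refine card_nbij (fun g => f.comp g) ?_ ?_ ?_
  · intro g _
    simpa using (exists_comp_iff f (f.comp g)).2 ⟨g, rfl⟩
  · intro g _ g' _ h
    refine SimpleGraph.Copy.ext fun a => f.injective ?_
    exact DFunLike.congr_fun h a
  · intro f' hf'
    obtain ⟨g, hg⟩ := (exists_comp_iff f f').1 (by simpa using hf')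
    exact ⟨g, by simp, hg⟩

/-- The injective extensions of an injective function `y` along an injective function `ι`. -/
noncomputable def extensionEquiv {U : Type} {ι : U → V} (hι : Injective ι) {y : U → W}
    (hy : Injective y) : {x : V → W // Injective x ∧ ∀ i, x (ι i) = y i} ≃
      (((Set.range ι)ᶜ : Set V) ↪ ((Set.range y)ᶜ : Set W)) := by
  classical
  exact
  { toFun := fun x => ⟨fun v => ⟨x.1 v, by
      rintro ⟨i, hi⟩
      rw [← x.2.2] at hi
      exact v.2 ⟨i, x.2.1 hi⟩⟩, fun v v' h => Subtype.ext (x.2.1 (congrArg Subtype.val h))⟩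
    invFun := fun f => ⟨fun v => if hv : v ∈ Set.range ι then y hv.choose else f ⟨v, hv⟩, by
      constructor
      · intro v v' h
        by_cases hv : v ∈ Set.range ι <;> by_cases hv' : v' ∈ Set.range ι
        · simp only [dif_pos hv, dif_pos hv'] at h
          rw [← hv.choose_spec, ← hv'.choose_spec, hy h]
        · simp only [dif_pos hv, dif_neg hv'] at h
          exact absurd ⟨_, h⟩ (f ⟨v', hv'⟩).2
        · simp only [dif_neg hv, dif_pos hv'] at h
          exact absurd ⟨_, h.symm⟩ (f ⟨v, hv⟩).2
        · simp only [dif_neg hv, dif_neg hv'] at h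
          exact congrArg Subtype.val (f.injective (Subtype.ext h))
      · intro i
        have hv : ι i ∈ Set.range ι := ⟨i, rfl⟩
        simp only [dif_pos hv]
        rw [hι hv.choose_spec]⟩
    left_inv := by
      intro x
      refine Subtype.ext (funext fun v => ?_)
      by_cases hv : v ∈ Set.range ι
      · simp only [dif_pos hv]
        rw [← x.2.2, hv.choose_spec]
      · simp only [dif_neg hv]
        rfl
    right_inv := by
      intro f
      refine DFunLike.ext _ _ fun v => Subtype.ext ?_
      exact dif_neg v.2 }

/-- An injective homomorphism from the pattern extends to the isolated vertices of `H` by an arbitrary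
injection into the unused vertices. -/
theorem injCount_isolated {h m g : ℕ} {H : SimpleGraph (Fin h)} {B : SimpleGraph (Fin m)}
    {ι : Fin m → Fin h} (hB : WordRAM.IsPattern H B ι) (A : SimpleGraph (Fin g)) :
    injCount H A = injCount B A * (g - m).descFactorial (h - m) := by
  classical
  let X := {x : Fin h → Fin g // (∀ i j, H.Adj i j → A.Adj (x i) (x j)) ∧ Injective x}
  let Y := {y : Fin m → Fin g // (∀ i j, B.Adj i j → A.Adj (y i) (y j)) ∧ Injective y}
  let r : X → Y := fun x => ⟨fun i => x.1 (ι i), fun i j hij => x.2.1 _ _ ((hB.adj i j).1 hij),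
    x.2.2.comp hB.inj⟩
  have hfib : ∀ y : Y, Nat.card {x : X // r x = y} = (g - m).descFactorial (h - m) := by
    intro y
    have e : {x : X // r x = y} ≃ {x : Fin h → Fin g // Injective x ∧ ∀ i, x (ι i) = y.1 i} :=
      { toFun := fun x => ⟨x.1.1, x.1.2.2, fun i => congrFun (congrArg Subtype.val x.2) i⟩
        invFun := fun x => ⟨⟨x.1, fun i j hij => by
          obtain ⟨a, rfl⟩ := hB.mem_range i j hij
          obtain ⟨b, rfl⟩ := hB.mem_range j _ hij.symm
          rw [x.2.2, x.2.2]
          exact y.2.1 _ _ ((hB.adj a b).2 hij), x.2.1⟩, Subtype.ext (funext x.2.2)⟩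
        left_inv := fun _ => rfl
        right_inv := fun _ => rfl }
    rw [Nat.card_congr e, Nat.card_congr (extensionEquiv hB.inj y.2.2), Nat.card_eq_fintype_card,
      Fintype.card_embedding_eq, Fintype.card_compl_set, Fintype.card_compl_set,
      Set.card_range_of_injective hB.inj, Set.card_range_of_injective y.2.2]
    simp
  change Nat.card X = Nat.card Y * _
  rw [Nat.card_congr (Equiv.sigmaFiberEquiv r).symm, Nat.card_sigma,
    sum_congr rfl fun y _ => hfib y]
  simp [Nat.card_eq_fintype_card]

/-- The pattern has no isolated vertices, so its copies avoid the isolated vertices of `H`. -/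
theorem injCount_pattern {h m : ℕ} {H : SimpleGraph (Fin h)} {B : SimpleGraph (Fin m)}
    {ι : Fin m → Fin h} (hB : WordRAM.IsPattern H B ι) : injCount B H = injCount B B := by
  symm
  refine Nat.card_congr (Equiv.ofBijective (fun y => ⟨fun i => ι (y.1 i), fun i j hij =>
    (hB.adj _ _).1 (y.2.1 i j hij), hB.inj.comp y.2.2⟩) ⟨?_, ?_⟩)
  · intro y y' h
    exact Subtype.ext (funext fun i => hB.inj (congrFun (congrArg Subtype.val h) i))
  · rintro ⟨x, hx, hi⟩
    have : ∀ i, ∃ j, ι j = x i := by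
      intro i
      obtain ⟨v, hv⟩ := hB.exists_adj i
      obtain ⟨j, rfl⟩ := hB.mem_range v _ hv.symm
      exact hB.mem_range _ _ (hx i j ((hB.adj i j).2 hv))
    choose y hy using this
    refine ⟨⟨y, fun i j hij => (hB.adj _ _).2 ?_, fun i j hij => hi ?_⟩,
      Subtype.ext (funext hy)⟩
    · rw [hy, hy]; exact hx i j hij
    · rw [← hy, ← hy, hij]

/-- Dividing out the factor `(h - m)!` that is common to the extensions to `G` and to `H` leaves a
binomial coefficient. -/
theorem copyCount_eq_div {h m n : ℕ} {H : SimpleGraph (Fin h)} {B : SimpleGraph (Fin m)}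
    {ι : Fin m → Fin h} (hB : WordRAM.IsPattern H B ι) (G : SimpleGraph (Fin n)) :
    G.copyCount H = injCount B G * (n - m).choose (h - m) / injCount B B := by
  have h1 := copyCount_mul H G
  rw [injCount_isolated hB, injCount_isolated hB, injCount_pattern hB, Nat.descFactorial_self,
    Nat.descFactorial_eq_factorial_mul_choose] at h1
  have h2 : G.copyCount H * injCount B B = injCount B G * (n - m).choose (h - m) := by
    refine Nat.eq_of_mul_eq_mul_right (Nat.factorial_pos (h - m)) ?_
    rw [mul_assoc, h1]; ring
  rw [← h2, Nat.mul_div_cancel _ (injCount_self_pos B)]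

theorem copyCount_eq_zero_of_lt {h n : ℕ} (H : SimpleGraph (Fin h)) (G : SimpleGraph (Fin n))
    (hlt : n < h) : G.copyCount H = 0 := by
  have h1 := copyCount_mul H G
  have h2 : injCount H G = 0 := by
    have : IsEmpty {x : Fin h → Fin n // (∀ i j, H.Adj i j → G.Adj (x i) (x j)) ∧
        Injective x} := ⟨fun x => by
      have := Fintype.card_le_of_injective _ x.2.2
      simp at this
      omega⟩
    exact Nat.card_of_isEmpty
  rw [h2] at h1
  exact (Nat.mul_eq_zero.1 h1).resolve_right (injCount_self_pos H).ne'

end InjCount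

namespace WordRAM

open Tm Finset

/-! ### The counting program on the input -/

theorem adjArray_apply {m : ℕ} (G : SimpleGraph (Fin m)) [DecidableRel G.Adj] (i j : Fin m) :
    adjArray G (i * m + j) = if G.Adj i j then 1 else 0 := by
  unfold adjArray
  split_ifs with h1 h2 h2
  · rfl
  · obtain ⟨i', j', h, hadj⟩ := h1
    obtain ⟨h3, h4⟩ := mul_add_inj j.2 j'.2 h
    rw [← Fin.ext h3, ← Fin.ext h4] at hadj
    exact absurd hadj h2
  · exact absurd ⟨i, j, rfl, h2⟩ h1
  · rfl

open Classical in
/-- The number of vertices that are not isolated. -/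
noncomputable def supportCard {h : ℕ} (H : SimpleGraph (Fin h)) : ℕ :=
  #{v : Fin h | ∃ u, H.Adj v u}

section Pattern

variable {h m : ℕ} {H : SimpleGraph (Fin h)}

theorem card_le_supportCard {ι : Fin m → Fin h} (hι : Function.Injective ι)
    (ha : ∀ i, ∃ v, H.Adj (ι i) v) : m ≤ supportCard H := by
  classical
  have : #((univ : Finset (Fin m)).image ι) ≤ supportCard H :=
    card_le_card fun v hv => by
      obtain ⟨i, -, rfl⟩ := mem_image.1 hv
      simpa using ha i
  rwa [card_image_of_injective _ hι, card_univ, Fintype.card_fin] at this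

theorem IsPattern.eq_supportCard {B : SimpleGraph (Fin m)} {ι : Fin m → Fin h}
    (hB : IsPattern H B ι) : m = supportCard H := by
  classical
  refine le_antisymm (card_le_supportCard hB.inj hB.exists_adj) ?_
  refine (card_le_card (t := (univ : Finset (Fin m)).image ι) fun v hv => ?_).trans ?_
  · obtain ⟨u, hu⟩ := (mem_filter.1 hv).2
    obtain ⟨i, rfl⟩ := hB.mem_range v u hu
    simp
  · exact card_image_le.trans (by simp)

theorem supportCard_le : supportCard H ≤ h := by
  classical exact (card_filter_le _ _).trans (by simp)

theorem supportCard_le_two_mul : supportCard H ≤ 2 * H.edgeSet.ncard := by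
  classical
  have h1 := H.sum_degrees_eq_twice_card_edges
  rw [← SimpleGraph.coe_edgeFinset, Set.ncard_coe_finset, ← h1, supportCard, card_filter]
  refine sum_le_sum fun v _ => ?_
  split_ifs with hv
  · exact (H.degree_pos_iff_exists_adj v).2 hv
  · exact Nat.zero_le _

/-- Array `10` enumerates, in the cells below `c`, the vertices below `i` that are not isolated. -/
structure Enumerates (H : SimpleGraph (Fin h)) (i c : ℕ) (f : ℕ → ℕ) : Prop where
  val : ∀ a < c, ∃ v : Fin h, f a = v ∧ (v : ℕ) < i ∧ ∃ u, H.Adj v u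
  inj : ∀ a < c, ∀ b < c, f a = f b → a = b
  surj : ∀ v : Fin h, (v : ℕ) < i → (∃ u, H.Adj v u) → ∃ a < c, f a = v

theorem Enumerates.exists_pattern {c : ℕ} {f : ℕ → ℕ} (he : Enumerates H h c f) :
    ∃ (B : SimpleGraph (Fin c)) (ι : Fin c → Fin h), IsPattern H B ι ∧ ∀ i : Fin c, f i = ι i := by
  choose ι hι using fun i : Fin c => he.val i i.2
  refine ⟨H.comap ι, ι, ⟨fun i j hij => ?_, fun _ _ => Iff.rfl, fun u v huv => ?_,
    fun i => (hι i).2.2⟩, fun i => (hι i).1⟩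
  · refine Fin.ext (he.inj i i.2 j j.2 ?_)
    rw [(hι i).1, (hι j).1, hij]
  · obtain ⟨a, ha, hav⟩ := he.surj u u.2 ⟨v, huv⟩
    exact ⟨⟨a, ha⟩, Fin.ext (by rw [← (hι ⟨a, ha⟩).1, ← hav])⟩

theorem Enumerates.le_supportCard {i c : ℕ} {f : ℕ → ℕ} (he : Enumerates H i c f) :
    c ≤ supportCard H := by
  choose ι hι using fun i : Fin c => he.val i i.2
  refine card_le_supportCard (ι := ι) (fun i j hij => ?_) fun i => (hι i).2.2
  refine Fin.ext (he.inj i i.2 j j.2 ?_)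
  rw [(hι i).1, (hι j).1, hij]

theorem Enumerates.succ {i c : ℕ} (hi : i < h) {f : ℕ → ℕ} (he : Enumerates H i c f)
    (hu : ∃ u, H.Adj ⟨i, hi⟩ u) : Enumerates H (i + 1) (c + 1) (Function.update f c i) := by
  have hlt : ∀ a < c, f a < i := fun a ha => by
    obtain ⟨v, h1, h2, -⟩ := he.val a ha; omega
  refine ⟨fun a ha => ?_, fun a ha b hb => ?_, fun v hv hvu => ?_⟩
  · rcases Nat.lt_succ_iff_lt_or_eq.1 ha with ha | rfl
    · obtain ⟨v, h1, h2, h3⟩ := he.val a ha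
      exact ⟨v, by rw [Function.update_of_ne ha.ne, h1], by omega, h3⟩
    · exact ⟨⟨i, hi⟩, by simp, by simp, hu⟩
  · rcases Nat.lt_succ_iff_lt_or_eq.1 ha with ha | rfl <;>
      rcases Nat.lt_succ_iff_lt_or_eq.1 hb with hb | rfl
    · rw [Function.update_of_ne ha.ne, Function.update_of_ne hb.ne]
      exact he.inj a ha b hb
    · rw [Function.update_of_ne ha.ne, Function.update_self]
      intro h'; have := hlt a ha; omega
    · rw [Function.update_of_ne hb.ne, Function.update_self]
      intro h'; have := hlt b hb; omega
    · intro _; rfl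
  · rcases Nat.lt_succ_iff_lt_or_eq.1 hv with hv | hv
    · obtain ⟨a, ha, h1⟩ := he.surj v hv hvu
      exact ⟨a, by omega, by rw [Function.update_of_ne ha.ne, h1]⟩
    · exact ⟨c, by omega, by simp [hv]⟩

theorem Enumerates.succ_of_not {i c : ℕ} (hi : i < h) {f : ℕ → ℕ} (he : Enumerates H i c f)
    (hu : ¬∃ u, H.Adj ⟨i, hi⟩ u) : Enumerates H (i + 1) c f := by
  refine ⟨fun a ha => ?_, he.inj, fun v hv hvu => ?_⟩
  · obtain ⟨v, h1, h2, h3⟩ := he.val a ha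
    exact ⟨v, h1, by omega, h3⟩
  · rcases Nat.lt_succ_iff_lt_or_eq.1 hv with hv | rfl
    · exact he.surj v hv hvu
    · exact absurd hvu hu

variable {A K n : ℕ}

open Classical in
/-- What is known after `patternProg`: the `m` vertices that are not isolated have been found, and
array `2` holds the adjacency matrix of the graph `B` that they induce. -/
def PatternPost (H : SimpleGraph (Fin h)) (m : ℕ) (s : State) : Prop :=
  s.reg 2 = m ∧ ∃ (B : SimpleGraph (Fin m)) (ι : Fin m → Fin h), IsPattern H B ι ∧
    ∀ i j : Fin m, s.arr 2 (i * m + j) = if B.Adj i j then 1 else 0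

theorem patternProg_tri {s : State} (h0 : s.reg 0 = h) (h2 : s.reg 2 = 0)
    (hH : s.arr 0 = adjArray H) (hA : h ≤ A) (h1A : 1 ≤ A) (hK : supportCard H ≤ K)
    (hm : m = supportCard H) :
    Tri A K patternProg s
      ((1 + h * (1 + (1 + ((1 + h * (1 + (1 + 1))) + (1 + (1 + 1)))))) + (1 + m * (2 + 2 * m)))
      (PatternPost H m) := by
  classical
  refine Tri.seq (R := fun s' => Enumerates H h m (s'.arr 10) ∧ s'.reg 2 = m) ?_ ?_
  · refine Tri.loop h h0 (fun i s' => Enumerates H i (s'.reg 2) (s'.arr 10)) ?_ ?_ ?_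
    · simp only [h2]
      exact ⟨fun a ha => absurd ha (Nat.not_lt_zero a), fun a ha => absurd ha (Nat.not_lt_zero a),
        fun v hv => absurd hv (Nat.not_lt_zero _)⟩
    · intro i hi s1 f1 he
      refine Tri.seq_assign (v := 0) (by simp [Tm.val]) (Nat.zero_le _) (by simp) ?_
      refine Tri.seq (R := fun s' => s'.reg 19 = if ∃ u, H.Adj ⟨i, hi⟩ u then 1 else 0) ?_ ?_
      · refine Tri.loop h (by simp [f1.reg 0 (by decide), h0])
          (fun j s' => s'.reg 19 = if ∃ u : Fin h, (u : ℕ) < j ∧ H.Adj ⟨i, hi⟩ u then 1 else 0)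
          (by simp) ?_ ?_
        · intro j hj s2 f2 h19
          have e : (load 0 (reg 14 * reg 0 + reg 15)).val (s2.set 15 j) =
              if H.Adj ⟨i, hi⟩ ⟨j, hj⟩ then 1 else 0 := by
            rw [← adjArray_apply]
            simp [Tm.val, f2.reg 14 (by decide), f2.reg 0 (by decide), f1.reg 0 (by decide), h0,
              f2.arr 0 (by decide), f1.arr 0 (by decide), hH]
          refine Tri.ite (fun h' => ?_) (fun h' => ?_)
          · have hadj : H.Adj ⟨i, hi⟩ ⟨j, hj⟩ := by
              by_contra hn
              rw [e, if_neg hn] at h'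
              exact h' rfl
            refine Tri.assign (v := 1) (by simp [Tm.val]) h1A (by simp) ?_
            rw [if_pos ⟨⟨j, hj⟩, by simp, hadj⟩]
            simp
          · have hadj : ¬H.Adj ⟨i, hi⟩ ⟨j, hj⟩ := by
              intro hn
              rw [e, if_pos hn] at h'
              exact absurd h' one_ne_zero
            refine Tri.skip ?_
            simp only [State.set_reg, Nat.reduceEqDiff, if_false, h19]
            refine if_congr ⟨?_, ?_⟩ rfl rfl
            · rintro ⟨u, h1, h2⟩; exact ⟨u, by omega, h2⟩
            · rintro ⟨u, h1, h2⟩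
              refine ⟨u, lt_of_le_of_ne (by omega) ?_, h2⟩
              rintro rfl
              exact hadj h2
        · intro s2 _ h19
          simpa using h19
      · intro s2 f2 h19
        have g10 : s2.arr 10 = s1.arr 10 := by simp [f2.arr 10 (by decide)]
        have g2 : s2.reg 2 = s1.reg 2 := by simp [f2.reg 2 (by decide)]
        have g14 : s2.reg 14 = i := by simp [f2.reg 14 (by decide)]
        refine Tri.ite (fun h' => ?_) (fun h' => ?_)
        · have hu : ∃ u, H.Adj ⟨i, hi⟩ u := by
            by_contra hn
            rw [if_neg hn] at h19
            exact h' (by simpa [Tm.val] using h19)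
          have hs := he.succ hi hu
          have hc := hs.le_supportCard.trans hK
          refine Tri.seq_store (x := s1.reg 2) (v := i) (by simp [Tm.val, g2])
            (by simp [Tm.val, g14]) (hi.le.trans hA) ?_
          refine Tri.assign (v := s1.reg 2 + 1) (by simp [Tm.val, g2])
            ((hs.le_supportCard.trans supportCard_le).trans hA) (fun _ => hc) ?_
          convert hs using 1
          · simp
          · funext x
            simp [State.upd_arr, g10, Function.update_apply]
        · have hu : ¬∃ u, H.Adj ⟨i, hi⟩ u := by
            intro hn
            rw [if_pos hn] at h19
            have : s2.reg 19 = 0 := by simpa [Tm.val] using h'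
            omega
          refine (Tri.skip ?_).mono (by omega)
          rw [g2, g10]
          exact he.succ_of_not hi hu
    · intro s1 f1 he
      obtain ⟨B, ι, hB, -⟩ := he.exists_pattern
      have := hB.eq_supportCard.trans hm.symm
      simp only [State.set_reg, State.set_arr, Nat.reduceEqDiff, if_false]
      rw [this] at he
      exact ⟨he, this⟩
  · rintro s1 f1 ⟨he, g2⟩
    obtain ⟨B, ι, hB, hι⟩ := he.exists_pattern
    refine (fill_tri (m := m) (fun i j => if ∃ a b : Fin m, (a : ℕ) = i ∧ (b : ℕ) = j ∧
      B.Adj a b then 1 else 0) g2 ?_).weaken ?_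
    · intro i hi j hj s2 f2 g15 g16
      refine ⟨?_, by split_ifs <;> omega⟩
      have e1 : s2.arr 10 i = ι ⟨i, hi⟩ := by rw [f2.arr 10 (by decide)]; exact hι ⟨i, hi⟩
      have e2 : s2.arr 10 j = ι ⟨j, hj⟩ := by rw [f2.arr 10 (by decide)]; exact hι ⟨j, hj⟩
      have e3 : s2.reg 0 = h := by rw [f2.reg 0 (by decide), f1.reg 0 (by decide), h0]
      have e4 : s2.arr 0 = adjArray H := by rw [f2.arr 0 (by decide), f1.arr 0 (by decide), hH]
      simp only [Tm.val, eval_load, eval_add, eval_mul, eval_reg, g15, g16, e1, e2, e3, e4]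
      rw [adjArray_apply]
      refine if_congr ?_ rfl rfl
      rw [← hB.adj]
      constructor
      · exact fun h => ⟨_, _, rfl, rfl, h⟩
      · rintro ⟨a, b, h1, h2, h3⟩
        rwa [Fin.ext (b := ⟨i, hi⟩) h1, Fin.ext (b := ⟨j, hj⟩) h2] at h3
    · intro s' f' hf
      refine ⟨by rw [f'.reg 2 (by decide), g2], B, ι, hB, fun i j => ?_⟩
      rw [hf i i.2 j j.2]
      refine if_congr ⟨?_, fun h => ⟨i, j, rfl, rfl, h⟩⟩ rfl rfl
      rintro ⟨a, b, h1, h2, h3⟩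
      rwa [Fin.ext h1, Fin.ext h2] at h3

/-- What is known after `countProg`: registers `25` and `26` hold the numbers of injective
homomorphisms from the pattern `B` to `G` and to itself. -/
def CountPost (H : SimpleGraph (Fin h)) (G : SimpleGraph (Fin n)) (m : ℕ) (s : State) : Prop :=
  ∃ (B : SimpleGraph (Fin m)) (ι : Fin m → Fin h), IsPattern H B ι ∧
    s.reg 0 = h ∧ s.reg 1 = n ∧ s.reg 2 = m ∧
    s.reg 25 = InjCount.injCount B G ∧ s.reg 26 = InjCount.injCount B B

/-- The preprocessing takes `O(h ^ 2)` steps, which is `O(n ^ (t + 1))` because `h ≤ n` and `1 ≤ t`. -/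
theorem countProg_tri {G : SimpleGraph (Fin n)} (hn : 1 ≤ n) (hhn : h ≤ n)
    (hm : m = supportCard H) (hm1 : 2 ≤ m) (hmK : m ≤ K) (hA : (n + 2) ^ (2 * m + 2) ≤ A) :
    Tri A K countProg (input H G)
      (400 * (m + 1) ^ (2 * m + 4) * n ^ (maxSpasmTreewidth H + 1)) (CountPost H G m) := by
  classical
  have hmh : m ≤ h := hm ▸ supportCard_le
  have hmn : m ≤ n := hmh.trans hhn
  have hp : ∀ a, a ≤ 2 * m + 2 → (n + 2) ^ a ≤ A := fun a ha =>
    (Nat.pow_le_pow_right (by omega) ha).trans hA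
  have hnA : n + 2 ≤ A := by simpa using hp 1 (by omega)
  have hA1 : m ^ (m + 1) ≤ A := (Nat.pow_le_pow_left (by omega) _).trans (hp (m + 1) (by omega))
  have hA2 : m ^ m * n ^ m ≤ A :=
    calc _ ≤ (n + 2) ^ m * (n + 2) ^ m :=
          Nat.mul_le_mul (Nat.pow_le_pow_left (by omega) _) (Nat.pow_le_pow_left (by omega) _)
      _ = (n + 2) ^ (m + m) := (pow_add _ _ _).symm
      _ ≤ A := hp _ (by omega)
  have hA3 : m ^ m * m ^ m ≤ A :=
    (Nat.mul_le_mul_left _ (Nat.pow_le_pow_left hmn _)).trans hA2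
  set t := maxSpasmTreewidth H with ht
  set w := min t (m - 1) with hw
  have hle : ∀ (B : SimpleGraph (Fin m)) (g : ℕ) (G' : SimpleGraph (Fin g)),
      m ^ m * g ^ m ≤ A → InjCount.injCount B G' ≤ A := by
    intro B g G' h'
    rw [← injCount_eq_sub (by omega)]
    exact ((Nat.sub_le _ _).trans (sum_signedTerm_le (by omega) _ _ 0 le_rfl)).trans h'
  set X := 100 * (m + 1) ^ (2 * m + 4) with hX
  refine (Tri.seq (patternProg_tri (A := A) (K := K) (m := m) (H := H) rfl rfl rfl (by omega)
    (by omega) (hm ▸ hmK) hm)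
    (τ₂ := 1 + (X * n ^ (w + 1) + (1 + ((1 + m * (2 + 2 * m)) + (1 + (X * m ^ (w + 1) + 1))))))
    ?_).mono ?_
  · rintro s1 f1 ⟨g2, B, ι, hB, hB2⟩
    have ho : ∀ p : Fin m → Fin m, (∀ i, p i ≤ i) →
        (∀ a, ¬InjCount.QAdj B (rootOf p) a a) → HasOrder B (rootOf p) w := fun p hp hl =>
      hB.hasOrder (by omega) (isRoot_rootOf hp).root_root hl
    have r0 : s1.reg 0 = h := by rw [f1.reg 0 (by decide)]; rfl
    have r1 : s1.reg 1 = n := by rw [f1.reg 1 (by decide)]; rfl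
    refine Tri.seq_assign (v := n) (by simp [Tm.val, r1]) (by omega) (by simp) ?_
    refine Tri.seq (injProg_tri (B := B) (G := G) (by omega) hn (by simp [g2]) (by simp)
      (by simpa using hB2) ?_ (by omega) ho (by omega) hA1 hA2) ?_
    · intro u v
      rw [State.set_arr, f1.arr 1 (by decide)]
      exact adjArray_apply G u v
    intro s2 f2 h23
    have q2 : s2.reg 2 = m := by simp [f2.reg 2 (by decide), g2]
    have q0 : s2.reg 0 = h := by simp [f2.reg 0 (by decide), r0]
    have q1 : s2.reg 1 = n := by simp [f2.reg 1 (by decide), r1]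
    have qB : ∀ i j : Fin m, s2.arr 2 (i * m + j) = if B.Adj i j then 1 else 0 := by
      simpa [f2.arr 2 (by decide)] using hB2
    refine Tri.seq_assign (v := InjCount.injCount B G) (by simp [Tm.val, h23])
      (hle B n G hA2) (by simp) ?_
    refine Tri.seq (R := fun s' => ∀ i j : Fin m, s'.arr 1 (i * m + j) =
      if B.Adj i j then 1 else 0) ?_ ?_
    · refine (fill_tri (m := m) (fun i j => if ∃ a b : Fin m, (a : ℕ) = i ∧ (b : ℕ) = j ∧
        B.Adj a b then 1 else 0) (by simp [q2]) ?_).weaken ?_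
      · intro i hi j hj s3 f3 g15 g16
        refine ⟨?_, by split_ifs <;> omega⟩
        have e2 : s3.reg 2 = m := by simp [f3.reg 2 (by decide), q2]
        have e3 : s3.arr 2 = s2.arr 2 := by simp [f3.arr 2 (by decide)]
        have := qB ⟨i, hi⟩ ⟨j, hj⟩
        simp only at this
        simp only [Tm.val, eval_load, eval_add, eval_mul, eval_reg, g15, g16, e2, e3, this]
        refine if_congr ⟨fun h => ⟨_, _, rfl, rfl, h⟩, ?_⟩ rfl rfl
        rintro ⟨a, b, h1, h2, h3⟩
        rwa [Fin.ext (b := ⟨i, hi⟩) h1, Fin.ext (b := ⟨j, hj⟩) h2] at h3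
      · intro s' f' hf i j
        rw [hf i i.2 j j.2]
        refine if_congr ⟨?_, fun h => ⟨i, j, rfl, rfl, h⟩⟩ rfl rfl
        rintro ⟨a, b, h1, h2, h3⟩
        rwa [Fin.ext h1, Fin.ext h2] at h3
    intro s3 f3 hB1
    have u2 : s3.reg 2 = m := by simp [f3.reg 2 (by decide), q2]
    refine Tri.seq_assign (v := m) (by simp [Tm.val, u2]) (by omega) (by simp) ?_
    refine Tri.seq (injProg_tri (B := B) (G := B) (by omega) (by omega) (by simp [u2]) (by simp)
      (by simpa [f3.arr 2 (by decide)] using qB) (by simpa using hB1) (by omega) ho (by omega)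
      hA1 hA3) ?_
    intro s4 f4 h23'
    refine Tri.assign (v := InjCount.injCount B B) (by simp [Tm.val, h23'])
      (hle B m B hA3) (by simp) ⟨B, ι, hB, ?_, ?_, ?_, ?_, ?_⟩
    · simp [f4.reg 0 (by decide), f3.reg 0 (by decide), q0]
    · simp [f4.reg 1 (by decide), f3.reg 1 (by decide), q1]
    · simp [f4.reg 2 (by decide), u2]
    · simp [f4.reg 25 (by decide), f3.reg 25 (by decide)]
    · simp
  · have ht1 : 1 ≤ t := by
      obtain ⟨v, hv⟩ := card_pos.1 (show 0 < supportCard H by omega)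
      obtain ⟨u, hu⟩ := (mem_filter.1 hv).2
      exact one_le_maxSpasmTreewidth hu
    set N := n ^ (t + 1) with hN
    have n1 : n ^ (w + 1) ≤ N := Nat.pow_le_pow_right hn (by omega)
    have n2 : m ^ (w + 1) ≤ N := (Nat.pow_le_pow_left hmn _).trans n1
    have n3 : n * n ≤ N := by
      rw [← pow_two]; exact Nat.pow_le_pow_right hn (by omega)
    have n4 : n ≤ n * n := Nat.le_mul_of_pos_left _ hn
    have hh2 : h * h ≤ n * n := Nat.mul_le_mul hhn hhn
    have hm2 : m * m ≤ n * n := Nat.mul_le_mul hmn hmn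
    set Y := (m + 1) ^ (2 * m + 4) with hY
    have hY1 : 1 ≤ Y := Nat.one_le_pow _ _ (by omega)
    have k1 : N ≤ Y * N := Nat.le_mul_of_pos_left _ hY1
    have k2 : X * n ^ (w + 1) ≤ 100 * (Y * N) := by
      rw [hX, mul_assoc]; exact Nat.mul_le_mul_left _ (Nat.mul_le_mul_left _ n1)
    have k3 : X * m ^ (w + 1) ≤ 100 * (Y * N) := by
      rw [hX, mul_assoc]; exact Nat.mul_le_mul_left _ (Nat.mul_le_mul_left _ n2)
    have k4 : h * (1 + (1 + ((1 + h * (1 + (1 + 1))) + (1 + (1 + 1))))) = 3 * (h * h) + 6 * h := by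
      ring
    have k5 : m * (2 + 2 * m) = 2 * m + 2 * (m * m) := by ring
    rw [k4, k5, mul_assoc 400 Y N]
    omega

end Pattern

end WordRAM

namespace WordRAM

/-! ### Isolated vertices and the running time -/

/-- `Z := (n - m).choose (h - m)`, and the result `X * Z / Y`, where register `25` holds `X` and
register `26` holds `Y`. -/
def finalCmd : Cmd :=
  .seq (.assign 100 (.const 0)) <| .seq (.assign 101 (.op .sub (.reg 0) (.reg 2))) <|
  .seq (.assign 102 (.op .sub (.reg 1) (.reg 2))) <| .seq (.assign 103 (.const 1)) <|
  .seq (.while (.op .lt (.reg 100) (.reg 101))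
    (.seq (.assign 103 (.op .div (.op .mul (.reg 103) (.op .sub (.reg 102) (.reg 100)))
      (.op .add (.reg 100) (.const 1))))
    (.assign 100 (.op .add (.reg 100) (.const 1))))) <|
  .assign 0 (.op .div (.op .mul (.reg 25) (.reg 103)) (.reg 26))

/-- The program for counting subgraphs. If `H` has more vertices than `G`, then the answer is `0`. -/
def mainCmd : Cmd :=
  .ite (.op .lt (.reg 1) (.reg 0)) (.assign 0 (.const 0)) (.seq countProg.toCmd finalCmd)

theorem words_le_two {L x y : ℕ} (hL : L = Nat.size y) (h : x ≤ y) : words L x ≤ 2 := by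
  have h1 : Nat.size x ≤ L := hL ▸ Nat.size_le_size h
  have h2 : Nat.size x / L ≤ 1 := by
    rcases Nat.eq_zero_or_pos L with h0 | h0
    · simp [h0]
    · exact (Nat.div_le_div_right h1).trans (Nat.div_self h0).le
  unfold words; omega

theorem words_le_of_lt_two_pow {L x a : ℕ} (h : x < 2 ^ a) : words L x ≤ 1 + a :=
  Nat.add_le_add_left ((Nat.div_le_self _ _).trans (Nat.size_le.2 h)) 1

theorem words_mul_le {L x y : ℕ} : words L (x * y) ≤ words L x + words L y + 1 := by
  have h1 : Nat.size (x * y) ≤ Nat.size x + Nat.size y := by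
    rw [Nat.size_le, pow_add]
    exact Nat.mul_lt_mul'' (Nat.lt_size_self x) (Nat.lt_size_self y)
  unfold words
  rcases Nat.eq_zero_or_pos L with h0 | h0
  · simp [h0]
  have h2 := Nat.div_le_div_right (c := L) h1
  have h3 : (Nat.size x + Nat.size y) / L ≤ Nat.size x / L + Nat.size y / L + 1 := by
    rw [Nat.add_div h0]; split_ifs <;> omega
  omega

/-- The binomial coefficient is computed by the recursion `choose j * (n - m - j) / (j + 1)`. Its
values have `O(n)` words and are multiplied and divided by numbers of at most two words, so each
iteration takes time `O(n)`. -/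
theorem finalCmd_exec {L h m n W : ℕ} {s : State} (hL : L = Nat.size (h + n)) (hn : 1 ≤ n)
    (hmh : m ≤ h) (hhn : h ≤ n) (h0 : s.reg 0 = h) (h1 : s.reg 1 = n) (h2 : s.reg 2 = m)
    (hW : words L (s.reg 25) ≤ W) (hW' : words L (s.reg 26) ≤ W) (hW1 : 1 ≤ W) :
    ∃ s' T, Exec L finalCmd s s' T ∧
      s'.reg 0 = s.reg 25 * (n - m).choose (h - m) / s.reg 26 ∧ T ≤ 200 * W ^ 2 * n ^ 2 := by
  have hsm : ∀ x, x ≤ h + n → words L x ≤ 2 := fun x hx => words_le_two hL hx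
  have hch : ∀ j, (n - m).choose j ≤ 2 ^ n := fun j =>
    (Nat.choose_le_two_pow _ _).trans (Nat.pow_le_pow_right (by omega) (Nat.sub_le _ _))
  have hcw : ∀ j, words L ((n - m).choose j) ≤ 2 + n := fun j => by
    refine (words_le_of_lt_two_pow (a := n + 1) ?_).trans (by omega)
    have := hch j
    rw [pow_succ]
    have := Nat.two_pow_pos n
    omega
  obtain ⟨s2, hs2⟩ : ∃ s2 : State, s2 = ⟨Function.update (Function.update (Function.update
      (Function.update s.reg 100 0) 101 (h - m)) 102 (n - m)) 103 1, s.arr⟩ := ⟨_, rfl⟩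
  obtain ⟨s3, T3, e3, ⟨i1, i2, i3, i4⟩, -, ht3⟩ := exec_for (L := L) (x := 100) (b := 101)
    (γ := 2) (body := .assign 103 (.op .div (.op .mul (.reg 103) (.op .sub (.reg 102) (.reg 100)))
      (.op .add (.reg 100) (.const 1)))) (h - m) (fun _ => 40 * n)
    (fun j s' => s'.reg 103 = (n - m).choose j ∧ s'.reg 102 = n - m ∧ s'.reg 25 = s.reg 25 ∧
      s'.reg 26 = s.reg 26) s2 (by simp [hs2]) (by simp [hs2])
    (by simp [hs2]) (by norm_num) (fun j hj => hsm j (by omega)) (hsm 1 (by omega)) (by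
      rintro j hj s' ⟨i1, i2, i3, i4⟩ h5 h6
      refine ⟨_, _, .assign _ _ _, ?_, by simpa using h5, by simpa using h6, ?_, by simpa using i2,
        by simpa using i3, by simpa using i4⟩
      · simp only [Expr.cost, Expr.eval, Op.eval, i1, i2, h5]
        have w1 := hcw j
        have w2 := hsm (n - m) (by omega)
        have w3 := hsm j (by omega)
        have w4 := hsm (n - m - j) (by omega)
        have w5 := hsm 1 (by omega)
        have w6 := hsm (j + 1) (by omega)
        have w7 := words_mul_le (L := L) (x := (n - m).choose j) (y := n - m - j)
        have m1 := Nat.mul_le_mul w2 w3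
        have m2 := Nat.mul_le_mul w1 w4
        have m3 := Nat.mul_le_mul w3 w5
        have m4 := Nat.mul_le_mul (w7.trans (by omega : _ ≤ n + 5)) w6
        omega
      · simp only [Expr.eval, Op.eval, i1, i2, h5, Function.update_apply]
        norm_num
        rw [← Nat.choose_succ_right_eq, Nat.mul_div_cancel _ (Nat.succ_pos j)])
  refine ⟨_, _, .seq (.assign _ _ _) (.seq (.assign _ _ _) (.seq (.assign _ _ _)
    (.seq (.assign _ _ _) (.seq (s₂ := s3) (T₁ := T3) ?_ (.assign _ _ _))))), ?_, ?_⟩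
  · convert e3 using 1
    rw [hs2]
    simp [Expr.eval, Op.eval, h0, h1, h2]
  · simp [Expr.eval, Op.eval, i1, i3, i4]
  · simp only [Expr.cost, Expr.eval, Op.eval, i1, i3, i4, h0, h1, h2, Function.update_apply]
    norm_num
    simp only [Finset.sum_const, Finset.card_range, smul_eq_mul] at ht3
    have w0 := hsm 0 (by omega)
    have w1 := hsm 1 (by omega)
    have wh := hsm h (by omega)
    have wn := hsm n (by omega)
    have wm := hsm m (by omega)
    have m1 := Nat.mul_le_mul wh wm
    have m2 := Nat.mul_le_mul wn wm
    have wc := hcw (h - m)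
    have wp := words_mul_le (L := L) (x := s.reg 25) (y := (n - m).choose (h - m))
    have hnn : n ≤ n ^ 2 := Nat.le_self_pow (by omega) n
    have m3 := Nat.mul_le_mul hW wc
    have wp' : words L (s.reg 25 * (n - m).choose (h - m)) ≤ W + n + 3 := by omega
    have m4 := Nat.mul_le_mul wp' hW'
    have hWW : W ≤ W ^ 2 := Nat.le_self_pow (by omega) W
    have t3 : (h - m) * (40 * n + 2 * (1 + 2) ^ 2) ≤ 58 * n ^ 2 := by
      calc _ ≤ n * (58 * n) := Nat.mul_le_mul (by omega) (by omega)
        _ = _ := by ring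
    have p1 : W * (2 + n) ≤ 3 * (W ^ 2 * n ^ 2) := by
      calc W * (2 + n) ≤ W ^ 2 * (3 * n ^ 2) := Nat.mul_le_mul hWW (by omega)
        _ = _ := by ring
    have p2 : (W + n + 3) * W ≤ 5 * (W ^ 2 * n ^ 2) := by
      calc (W + n + 3) * W ≤ (5 * (W * n)) * W := Nat.mul_le_mul_right _ (by nlinarith)
        _ = 5 * (W ^ 2 * n) := by ring
        _ ≤ _ := Nat.mul_le_mul_left _ (Nat.mul_le_mul_left _ hnn)
    have p3 : n ^ 2 ≤ W ^ 2 * n ^ 2 := Nat.le_mul_of_pos_left _ (by positivity)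
    have p4 : W ≤ W ^ 2 * n ^ 2 := hWW.trans (Nat.le_mul_of_pos_right _ (by positivity))
    have p5 : 1 ≤ W ^ 2 * n ^ 2 := hW1.trans p4
    rw [mul_assoc]
    omega

/-- The factor `b ^ a` is needed for `k = 1` only. -/
theorem const_pow_le {b a k : ℕ} (hb : 1 ≤ b) (hk : 1 ≤ k) :
    b ^ (a * k) ≤ b ^ a * k ^ (b * a * k) := by
  rcases hk.eq_or_lt with rfl | hk
  · simp
  · have h1 : b ≤ k ^ b := (Nat.lt_two_pow_self).le.trans (Nat.pow_le_pow_left hk b)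
    calc b ^ (a * k) ≤ (k ^ b) ^ (a * k) := Nat.pow_le_pow_left h1 _
      _ = k ^ (b * a * k) := by rw [← pow_mul, mul_assoc]
      _ ≤ _ := Nat.le_mul_of_pos_left _ (Nat.pow_pos hb)

/-- The running time in terms of the number of edges. -/
theorem time_bound {E k m : ℕ} (hk : 1 ≤ k) (hm : m ≤ 2 * k) :
    (m + 1) ^ (2 * m + 4) * (2 * m + 4) ^ E ≤
      (3 ^ 8 * 8 ^ E) * k ^ ((32 + E) * k) := by
  have h1 : (m + 1) ^ (2 * m + 4) ≤ (3 * k) ^ (8 * k) :=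
    (Nat.pow_le_pow_left (by omega) _).trans (Nat.pow_le_pow_right (by omega) (by omega))
  have h2 : (2 * m + 4) ^ E ≤ (8 * k) ^ E := Nat.pow_le_pow_left (by omega) _
  have h3 : (3 * k) ^ (8 * k) ≤ 3 ^ 8 * k ^ (32 * k) := by
    rw [mul_pow]
    calc 3 ^ (8 * k) * k ^ (8 * k) ≤ (3 ^ 8 * k ^ (3 * 8 * k)) * k ^ (8 * k) :=
          Nat.mul_le_mul_right _ (const_pow_le (by omega) hk)
      _ = 3 ^ 8 * k ^ (32 * k) := by
          rw [mul_assoc, ← pow_add]; congr 2; ring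
  have h4 : (8 * k) ^ E ≤ 8 ^ E * k ^ (E * k) := by
    rw [mul_pow]
    exact Nat.mul_le_mul_left _ (Nat.pow_le_pow_right hk (Nat.le_mul_of_pos_right _ hk))
  calc _ ≤ (3 ^ 8 * k ^ (32 * k)) * (8 ^ E * k ^ (E * k)) :=
        Nat.mul_le_mul (h1.trans h3) (h2.trans h4)
    _ = _ := by rw [add_mul, pow_add]; ring

end WordRAM

namespace WordRAM

/-- Correctness and running time of the program, with explicit constants. -/
theorem mainCmd_exec {h n : ℕ} (H : SimpleGraph (Fin h)) (G : SimpleGraph (Fin n))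
    (hk : 1 ≤ H.edgeSet.ncard) (hn : 1 ≤ n) :
    ∃ s T, Exec (wordLength h n) mainCmd (input H G) s T ∧ s.reg 0 = G.copyCount H ∧
      T ≤ 609 * (3 ^ 8 * 8 ^ (countProg.cexp + 4) *
        H.edgeSet.ncard ^ ((32 + (countProg.cexp + 4)) * H.edgeSet.ncard)) *
        n ^ (maxSpasmTreewidth H + 1) := by
  set k := H.edgeSet.ncard with hkdef
  set e := countProg.cexp
  set N := n ^ (maxSpasmTreewidth H + 1) with hN
  have hN1 : 1 ≤ N := Nat.one_le_pow _ _ hn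
  have hw : ∀ x, x ≤ h + n → words (wordLength h n) x ≤ 2 := fun x hx => words_le_two rfl hx
  have hlt : 1 + Expr.cost (wordLength h n) (input H G) (.op .lt (.reg 1) (.reg 0)) ≤ 9 := by
    have w0 := hw h (by omega)
    have w1 := hw n (by omega)
    have w2 := Nat.mul_le_mul w1 w0
    simp only [Expr.cost, Expr.eval, input]
    norm_num
    omega
  by_cases hhn : n < h
  · refine ⟨_, _, .ite_true ?_ (.assign _ _ _), ?_, ?_⟩
    · simp [Expr.eval, Op.eval, input, hhn]
    · simp [Expr.eval, InjCount.copyCount_eq_zero_of_lt H G hhn]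
    · have w0 := hw 0 (by omega)
      have h1 : 1 ≤ 3 ^ 8 * 8 ^ (e + 4) * k ^ ((32 + (e + 4)) * k) := Nat.mul_pos
        (by positivity) (Nat.pow_pos hk)
      have h2 := Nat.mul_le_mul (Nat.mul_le_mul_left 609 h1) hN1
      have h3 : Expr.cost (wordLength h n) (input H G) (.const 0) ≤ 2 := w0
      omega
  rw [not_lt] at hhn
  obtain ⟨u, v, huv⟩ : ∃ u v, H.Adj u v := by
    obtain ⟨x, hx⟩ := (Set.ncard_pos (Set.toFinite _)).1 hk
    induction x with
    | _ u v => exact ⟨u, v, hx⟩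
  obtain ⟨m, hm⟩ : ∃ m, m = supportCard H := ⟨_, rfl⟩
  have hm2 : 2 ≤ m := by
    classical
    rw [hm, supportCard]
    refine (Finset.card_pair huv.ne).symm.le.trans (Finset.card_le_card ?_)
    intro x hx
    rcases Finset.mem_insert.1 hx with rfl | hx
    · simpa using ⟨v, huv⟩
    · rw [Finset.mem_singleton.1 hx]
      simpa using ⟨u, huv.symm⟩
  have hmk : m ≤ 2 * k := hm ▸ supportCard_le_two_mul
  have hmh : m ≤ h := hm ▸ supportCard_le
  -- The word length is at least `Nat.log 2 (n + 2)`, so numbers up to `A` have at most `K` words.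
  obtain ⟨K, hK⟩ : ∃ K, K = 2 * m + 4 := ⟨_, rfl⟩
  obtain ⟨A, hA⟩ : ∃ A, A = (n + 2) ^ (2 * m + 2) := ⟨_, rfl⟩
  have hA2 : (n + 2) * (n + 2) ≤ A := by
    rw [hA, ← pow_two]; exact Nat.pow_le_pow_right (by omega) (by omega)
  have hP : Par (wordLength h n) A K := by
    refine ⟨by omega, by nlinarith, ?_, Nat.size_pos.2 (by omega)⟩
    have h1 : n + 2 ≤ 2 ^ wordLength h n := by
      have := Nat.lt_size_self (h + n)
      unfold wordLength; omega
    calc A = (n + 2) ^ (2 * m + 2) := hA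
      _ ≤ (2 ^ wordLength h n) ^ (2 * m + 2) := Nat.pow_le_pow_left h1 _
      _ = 2 ^ (wordLength h n * (2 * m + 2)) := (pow_mul _ _ _).symm
      _ ≤ _ := Nat.pow_le_pow_right (by omega) (Nat.mul_le_mul_left _ (by omega))
  have hAn : n + 2 ≤ A := by nlinarith
  have hB : Bdd A K (input H G) := by
    refine ⟨fun i _ => ?_, fun a x => ?_, Nat.zero_le _⟩
    · simp only [input]
      split_ifs <;> omega
    · have h1 : ∀ {j} (F : SimpleGraph (Fin j)), adjArray F x ≤ 1 := fun F => by
        unfold adjArray; split_ifs <;> omega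
      have := h1 H
      have := h1 G
      simp only [input]
      split_ifs <;> omega
  obtain ⟨t1, t2, B, ι, hpat, g0, g1, g2, g25, g26⟩ := countProg_tri (K := K) (A := A) (G := G)
    hn hhn hm hm2 (by omega) hA.ge
  obtain ⟨s1, T1, e1, hs1, hb1, ht1⟩ := countProg.exec hP countProg_wf
    (s := input H G) (σ := input H G) ⟨rfl, fun _ _ => rfl⟩ hB t1
  have hreg := hs1.2
  have hwb : ∀ i < 50, words (wordLength h n) (s1.reg i) ≤ K ^ 2 := fun i hi => by
    rw [hreg i hi]; exact hP.words_le_of_le (hb1.1 i hi)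
  obtain ⟨s2, T2, e2, hr, ht2⟩ := finalCmd_exec (L := wordLength h n) (m := m) (s := s1) rfl hn hmh
    hhn (by rw [hreg 0 (by omega), g0]) (by rw [hreg 1 (by omega), g1])
    (by rw [hreg 2 (by omega), g2]) (hwb 25 (by omega)) (hwb 26 (by omega))
    (Nat.one_le_pow _ _ hP.one_le)
  refine ⟨s2, _, .ite_false ?_ (.seq e1 e2), ?_, ?_⟩
  · simp [Expr.eval, Op.eval, input, hhn]
  · rw [hr, hreg 25 (by omega), hreg 26 (by omega), g25, g26, InjCount.copyCount_eq_div hpat]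
  · have ht := one_le_maxSpasmTreewidth huv
    have hn2 : n ^ 2 ≤ N := Nat.pow_le_pow_right hn (by omega)
    set F := (m + 1) ^ (2 * m + 4) with hF
    have hF1 : 1 ≤ F := Nat.one_le_pow _ _ (by omega)
    have hb : F * K ^ (e + 4) ≤ 3 ^ 8 * 8 ^ (e + 4) * k ^ ((32 + (e + 4)) * k) :=
      hK ▸ time_bound hk hmk
    have hK1 : 1 ≤ K := hP.one_le
    have q1 : T1 ≤ 400 * (F * K ^ (e + 4) * N) := by
      calc T1 ≤ (400 * F * N) * K ^ e := ht1.trans (Nat.mul_le_mul_right _ t2)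
        _ ≤ (400 * F * N) * K ^ (e + 4) :=
          Nat.mul_le_mul_left _ (Nat.pow_le_pow_right hK1 (by omega))
        _ = _ := by ring
    have q2 : T2 ≤ 200 * (F * K ^ (e + 4) * N) := by
      calc T2 ≤ 200 * (K ^ 2) ^ 2 * n ^ 2 := ht2
        _ = 200 * (1 * K ^ 4 * n ^ 2) := by ring
        _ ≤ _ := Nat.mul_le_mul_left _ (Nat.mul_le_mul (Nat.mul_le_mul hF1
          (Nat.pow_le_pow_right hK1 (by omega))) hn2)
    have q3 : 1 ≤ F * K ^ (e + 4) * N :=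
      Nat.mul_pos (Nat.mul_pos hF1 (Nat.pow_pos hK1)) hN1
    calc _ ≤ 609 * (F * K ^ (e + 4) * N) := by omega
      _ = 609 * (F * K ^ (e + 4)) * N := by ring
      _ ≤ _ := Nat.mul_le_mul_right _ (Nat.mul_le_mul_left _ hb)

end WordRAM

theorem mainTheorem2 :
    ∃ (P : WordRAM.Cmd) (c : ℕ),
      ∀ (h n : ℕ) (H : SimpleGraph (Fin h)) (G : SimpleGraph (Fin n)),
        1 ≤ H.edgeSet.ncard → 1 ≤ n →
          ∃ (s : WordRAM.State) (T : ℕ),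
            WordRAM.Exec (WordRAM.wordLength h n) P (WordRAM.input H G) s T ∧
            s.reg 0 = G.copyCount H ∧
            T ≤ c * H.edgeSet.ncard ^ (c * H.edgeSet.ncard) * n ^ (maxSpasmTreewidth H + 1) := by
  obtain ⟨C, E, hCE⟩ : ∃ C E : ℕ, ∀ (h n : ℕ) (H : SimpleGraph (Fin h)) (G : SimpleGraph (Fin n)),
      1 ≤ H.edgeSet.ncard → 1 ≤ n → ∃ s T,
        WordRAM.Exec (WordRAM.wordLength h n) WordRAM.mainCmd (WordRAM.input H G) s T ∧
        s.reg 0 = G.copyCount H ∧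
        T ≤ C * H.edgeSet.ncard ^ (E * H.edgeSet.ncard) * n ^ (maxSpasmTreewidth H + 1) :=
    ⟨_, _, fun h n H G hk hn => by
      have := WordRAM.mainCmd_exec H G hk hn
      rwa [← mul_assoc] at this⟩
  refine ⟨WordRAM.mainCmd, C + E, fun h n H G hk hn => ?_⟩
  obtain ⟨s, T, h1, h2, h3⟩ := hCE h n H G hk hn
  exact ⟨s, T, h1, h2, h3.trans (Nat.mul_le_mul_right _ (Nat.mul_le_mul (Nat.le_add_right _ _)
    (Nat.pow_le_pow_right hk (Nat.mul_le_mul_right _ (Nat.le_add_left _ _)))))⟩
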